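/- Let $M$ be a compact manifold with corners (every boundary hypersurface $H$ of $M$ has a defining function $\rho_H$), $M^\circ$ its interior, $\mathcal M_1(M)$ its set of boundary hypersurfaces, $E\to M$ a smooth vector bundle of finite rank, and $T>0$. A positive index set is a set $G\subset\mathbb C\times\mathbb N_0$ such that $\{(z,k)\in G:\operatorname{Re}z\le r\}$ is finite for every $r$; $(z,k)\in G$ implies $(z+p,k)\in G$ for all $p\in\mathbb N$ and $(z,p)\in G$ for $0\le p\le k$; $\mathbb N_0\times\{0\}\subset G$; $\operatorname{Im}z=0$ and $\operatorname{Re}z\ge 0$ for $(z,k)\in G$; and $(0,k)\in G$ implies $k=0$. A positive index family $\mathcal G$ of $M$ assigns a positive index set $\mathcal G(H)$ to every $H\in\mathcal M_1(M)$. Sums $\mathcal G+\mathcal G'$ (sums of elements in $\mathbb C\times\mathbb N_0$) and unions of index families are taken hypersurface by hypersurface, and $\mathcal G_\infty=\bigcup_{j\ge1}(\mathcal G+\dots+\mathcal G)$ ($j$ summands). $\mathcal A^{\mathcal G}_{\mathrm{phg}}(M)$ is the space of $f\in C^\infty(M^\circ)$ that have at each $H\in\mathcal M_1(M)$ an expansion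 $f\sim\sum_{(z,k)\in\mathcal G(H)}a(z,k)\,\rho_H^z(\log\rho_H)^k$, with coefficients $a(z,k)$ smooth up to $H$ and (recursively) polyhomogeneous with respect to $\mathcal G$ at the other hypersurfaces, where $\sim$ means that for every $N\in\mathbb N_0$ the difference of $f$ and the sum of the terms with $\operatorname{Re}z\le N$ is in $\rho_H^NC_b^\infty(M^\circ)$; here $C_b^\infty(M^\circ)$ consists of the smooth functions on $M^\circ$ that stay bounded after application of any number of smooth vector fields tangent to all boundary hypersurfaces. $\mathcal A^{\mathcal G}_{\mathrm{phg}}([0,T]\times M)$ is defined likewise: functions smooth at $t=0$ and $t=T$, with expansions at $[0,T]\times H$ given by $\mathcal G(H)$. For bundles, $\mathcal A^{\mathcal G}_{\mathrm{phg}}(M;E)=\mathcal A^{\mathcal G}_{\mathrm{phg}}(M)\otimes_{C^\infty(M)}C^\infty(M;E)$, and similarly over $[0,T]\times M$ with $E$ pulled back from $M$. Proposition. Let $\mathcal G,\mathcal G_1,\mathcal G_2$ be positive index families of $M$, and let $l_t\in\mathcal A^{\mathcal G}_{\mathrm{phg}}([0,T]\times M;\operatorname{End}(E))$, $u_0\in\mathcal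 A^{\mathcal G_1}_{\mathrm{phg}}(M;E)$ and $f\in\mathcal A^{\mathcal G_2}_{\mathrm{phg}}([0,T]\times M;E)$. Then the linear ordinary differential equation $$\frac{\partial u}{\partial t}-l_tu=f,\qquad u|_{t=0}=u_0$$ on $[0,T]\times M^\circ$ has a unique solution $u$, and $u\in\mathcal A^{\mathcal K}_{\mathrm{phg}}([0,T]\times M;E)$, where $\mathcal K=\big(\mathcal G_1\cup(\mathcal G_\infty+\mathcal G_2)\big)+\mathcal G_\infty$, which is again a positive index family. -/

import Mathlib

open Set Manifold Bundle
open scoped ContDiff Pointwise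

noncomputable section

namespace Polyhomogeneous

/-! ### Index sets -/

/-- An index set: a subset of `ℂ × ℕ` with finitely many elements in each half plane `Re z ≤ r`
(that is, closed discrete, with `Re z → ∞` along it), stable under `z ↦ z + p` for `p ∈ ℕ` and
under lowering the exponent of the logarithm. -/
structure IsIndexSet (G : Set (ℂ × ℕ)) : Prop where
  finite_re_le : ∀ r : ℝ, {p ∈ G | p.1.re ≤ r}.Finite
  add_nat_mem : ∀ (z : ℂ) (k : ℕ), (z, k) ∈ G → ∀ p : ℕ, (z + p, k) ∈ G
  log_le_mem : ∀ (z : ℂ) (k : ℕ), (z, k) ∈ G → ∀ p ≤ k, (z, p) ∈ G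

/-- A positive index set. -/
structure IsPositiveIndexSet (G : Set (ℂ × ℕ)) : Prop extends IsIndexSet G where
  nat_mem : ∀ p : ℕ, ((p : ℂ), 0) ∈ G
  im_eq_zero : ∀ p ∈ G, p.1.im = 0
  re_nonneg : ∀ p ∈ G, 0 ≤ p.1.re
  no_log_at_zero : ∀ k : ℕ, (0, k) ∈ G → k = 0

/-- The sum `G + ⋯ + G` of `j + 1` copies of `G`. -/
def sumCopies (G : Set (ℂ × ℕ)) : ℕ → Set (ℂ × ℕ)
  | 0 => G
  | j + 1 => sumCopies G j + G

/-- `G_∞`, the union over `j ≥ 1` of the sums of `j` copies of `G`. -/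
def indexInfinity (G : Set (ℂ × ℕ)) : Set (ℂ × ℕ) := ⋃ j : ℕ, sumCopies G j

/-! ### Manifolds with corners

`M` is modelled on the quadrants `[0, ∞)ⁿ`. -/

section Corners

variable (n : ℕ) (M : Type*) [TopologicalSpace M] [ChartedSpace (EuclideanQuadrant n) M]

/-- The points of depth (codimension) one: exactly one coordinate vanishes there. -/
def depthOne : Set M :=
  {x | {i : Fin n | (chartAt (EuclideanQuadrant n) x x).1 i = 0}.ncard = 1}

/-- The boundary hypersurfaces of `M`: the closures of the connected components of the set of
points of depth one. -/
def BoundaryHypersurface : Type _ :=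
  {H : Set M // ∃ x ∈ depthOne n M, H = closure (connectedComponentIn (depthOne n M) x)}

variable {n M}

/-- The points of `M` that lie on none of the hypersurfaces in `S`. If `S` consists of all the
boundary hypersurfaces, this is the interior of `M`. -/
def awayFrom (S : Set (BoundaryHypersurface n M)) : Set M := {x | ∀ H ∈ S, x ∉ H.1}

variable (n M) in
/-- The interior `M° = M \ ∂M`. -/
def cornerInterior : Set M := awayFrom (univ : Set (BoundaryHypersurface n M))

/-- `ρ` is a defining function of the boundary hypersurface `H`. -/
structure IsDefiningFunction (H : BoundaryHypersurface n M) (ρ : M → ℝ) : Prop where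
  smooth : ContMDiff (modelWithCornersEuclideanQuadrant n) 𝓘(ℝ, ℝ) ∞ ρ
  nonneg : ∀ x, 0 ≤ ρ x
  eq_zero_iff : ∀ x, ρ x = 0 ↔ x ∈ H.1
  mfderiv_ne_zero :
    ∀ x ∈ H.1, mfderiv (modelWithCornersEuclideanQuadrant n) 𝓘(ℝ, ℝ) ρ x ≠ 0

/-- The smooth vector fields on `M` that are tangent to the hypersurfaces `H ∈ S`, i.e. such that
`V ρ_H ∈ ρ_H C^∞(M)`. If `S` consists of all the boundary hypersurfaces, these are the b-vector
fields of `M`. -/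
def bVectorFields [IsManifold (modelWithCornersEuclideanQuadrant n) ∞ M]
    (ρ : BoundaryHypersurface n M → M → ℝ) (S : Set (BoundaryHypersurface n M)) :
    Set (∀ x : M, TangentSpace (modelWithCornersEuclideanQuadrant n) x) :=
  {V | ContMDiff (modelWithCornersEuclideanQuadrant n)
        (modelWithCornersEuclideanQuadrant n).tangent ∞
        (fun x => (⟨x, V x⟩ : TangentBundle (modelWithCornersEuclideanQuadrant n) M)) ∧
      ∀ H ∈ S, ∃ a : M → ℝ,
        ContMDiff (modelWithCornersEuclideanQuadrant n) 𝓘(ℝ, ℝ) ∞ a ∧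
        ∀ x, mfderiv (modelWithCornersEuclideanQuadrant n) 𝓘(ℝ, ℝ) (ρ H) x (V x) = a x * ρ H x}

/-- The derivative `V f` of a function along a vector field. -/
def derivAlong (V : ∀ x : M, TangentSpace (modelWithCornersEuclideanQuadrant n) x)
    (f : M → ℝ) : M → ℝ :=
  fun x => mfderiv (modelWithCornersEuclideanQuadrant n) 𝓘(ℝ, ℝ) f x (V x)

/-- The first order operators `f ↦ V f` on functions on `M`, for `V` tangent to all `H ∈ S`. -/
def bOperators [IsManifold (modelWithCornersEuclideanQuadrant n) ∞ M]
    (ρ : BoundaryHypersurface n M → M → ℝ) (S : Set (BoundaryHypersurface n M)) :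
    Set ((M → ℝ) → M → ℝ) :=
  {P | ∃ V ∈ bVectorFields ρ S, P = derivAlong V}

/-- The first order operators on functions on `[0,T] × M` that are used to test conormality
at `[0,T] × H` for `H ∈ S`: the derivative `∂_t` (one-sided at `t = 0` and `t = T`) and the
operators `f ↦ V f` acting in the `M`-variable, for `V` tangent to all `H ∈ S`. Together
they span over `C^∞([0,T] × M)` the vector fields tangent to all `[0,T] × H`, `H ∈ S`; nothing
degenerates at `t = 0` and `t = T`, where the functions considered are smooth. -/
def timeBOperators [IsManifold (modelWithCornersEuclideanQuadrant n) ∞ M] (T : ℝ)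
    (ρ : BoundaryHypersurface n M → M → ℝ) (S : Set (BoundaryHypersurface n M)) :
    Set ((ℝ × M → ℝ) → ℝ × M → ℝ) :=
  {P | P = (fun f p => derivWithin (fun s => f (s, p.2)) (Icc 0 T) p.1) ∨
    ∃ V ∈ bVectorFields ρ S, P = fun f p => derivAlong V (fun y => f (p.1, y)) p.2}

end Corners

/-! ### Polyhomogeneous functions

The two cases of interest are `X = M`, with `pr` the identity and `D = M`, and `X = ℝ × M`,
with `pr` the projection to `M` and `D = [0,T] × M`. -/

section Phg

variable {EX HX X : Type*} [NormedAddCommGroup EX] [NormedSpace ℝ EX] [TopologicalSpace HX]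
  [TopologicalSpace X] [ChartedSpace HX X]
  {n : ℕ} {M : Type*} [TopologicalSpace M] [ChartedSpace (EuclideanQuadrant n) M]

/-- `C_b^∞`: the functions that are smooth on `U` and stay bounded on `U` after any number
of applications of the operators in `Op`. -/
def IsConormal (J : ModelWithCorners ℝ EX HX) (U : Set X) (Op : Set ((X → ℝ) → X → ℝ))
    (f : X → ℝ) : Prop :=
  ContMDiffOn J 𝓘(ℝ, ℝ) ∞ f U ∧
    ∀ L : List ((X → ℝ) → X → ℝ), (∀ P ∈ L, P ∈ Op) →
      ∃ C : ℝ, ∀ x ∈ U, |L.foldr (fun P g => P g) f x| ≤ C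

/-- `IsPhg J pr D Op ρ G S f`: the function `f` on `D` is polyhomogeneous at the hypersurfaces in
`S`, with respect to the positive index family `G`, and smooth up to those that are not in `S`.

It is smooth away from the hypersurfaces in `S`, and at each `H ∈ S` it has an expansion
`f ∼ ∑_{(z,k) ∈ G(H)} a(z,k) ρ_H^z (log ρ_H)^k`, where `a(z,k)` is smooth up to `H`
and polyhomogeneous at the other hypersurfaces in `S`, with the same index sets; `∼` means
that for all `N` the difference of `f` and the sum of the terms with `Re z ≤ N` is in
`ρ_H^N C_b^∞`. (The coefficients are extended from `H` to `D`: the index sets being stable under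
`z ↦ z + 1`, the choice of the extension does not matter.
The exponents are real since `G` is positive, and for the same reason no
weights at the other hypersurfaces appear in the remainder.) The recursion ends at `S = ∅`,
where the condition is that `f` be smooth on `D`. -/
inductive IsPhg (J : ModelWithCorners ℝ EX HX) (pr : X → M) (D : Set X)
    (Op : Set (BoundaryHypersurface n M) → Set ((X → ℝ) → X → ℝ))
    (ρ : BoundaryHypersurface n M → M → ℝ) (G : BoundaryHypersurface n M → Set (ℂ × ℕ)) :
    Set (BoundaryHypersurface n M) → (X → ℝ) → Prop
  | intro (S : Set (BoundaryHypersurface n M)) (f : X → ℝ)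
      (a : BoundaryHypersurface n M → ℂ × ℕ → X → ℝ)
      (smooth : ContMDiffOn J 𝓘(ℝ, ℝ) ∞ f (D ∩ pr ⁻¹' awayFrom S))
      (coeff : ∀ H ∈ S, ∀ p ∈ G H, IsPhg J pr D Op ρ G (S \ {H}) (a H p))
      (expansion : ∀ H ∈ S, ∀ N : ℕ, ∃ r : X → ℝ,
        IsConormal J (D ∩ pr ⁻¹' awayFrom S) (Op S) r ∧
        ∀ x ∈ D ∩ pr ⁻¹' awayFrom S,
          f x - ∑ᶠ p ∈ {p ∈ G H | p.1.re ≤ N},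
              a H p x * (ρ H (pr x) ^ p.1.re * Real.log (ρ H (pr x)) ^ p.2) =
            ρ H (pr x) ^ N * r x) :
      IsPhg J pr D Op ρ G S f

/-- Sections over `U` of (the pull-back by `pr` of) a vector bundle `E → M` with coefficients in a
space `𝒜` of functions: the finite sums `∑ cᵢ sᵢ` with `cᵢ ∈ 𝒜` and `sᵢ` a smooth section
over `D`. This is the tensor product of `𝒜` with the space of smooth sections over `D`, its
elements being seen as sections over `U`. -/
def IsSectionWithCoeffs (n : ℕ) {M : Type*} [TopologicalSpace M]
    [ChartedSpace (EuclideanQuadrant n) M] (J : ModelWithCorners ℝ EX HX) (pr : X → M) (D U : Set X)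
    (𝒜 : Set (X → ℝ)) (F : Type*) [NormedAddCommGroup F] [NormedSpace ℝ F]
    {E : M → Type*} [∀ x, AddCommGroup (E x)] [∀ x, Module ℝ (E x)]
    [∀ x, TopologicalSpace (E x)] [TopologicalSpace (TotalSpace F E)] [FiberBundle F E]
    (u : ∀ x : X, E (pr x)) : Prop :=
  ∃ (m : ℕ) (c : Fin m → X → ℝ) (s : Fin m → ∀ x : X, E (pr x)),
    (∀ i, c i ∈ 𝒜) ∧
    (∀ i, ContMDiffOn J ((modelWithCornersEuclideanQuadrant n).prod 𝓘(ℝ, F)) ∞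
      (fun x => (TotalSpace.mk' F (pr x) (s i x) : TotalSpace F E)) D) ∧
    ∀ x ∈ U, u x = ∑ i, c i x • s i x

variable [IsManifold (modelWithCornersEuclideanQuadrant n) ∞ M]

/-- The space `A_phg^G(M)` for a positive index family `G`. -/
def phgFunctions (ρ : BoundaryHypersurface n M → M → ℝ)
    (G : BoundaryHypersurface n M → Set (ℂ × ℕ)) : Set (M → ℝ) :=
  {f | IsPhg (modelWithCornersEuclideanQuadrant n) id univ (bOperators ρ) ρ G univ f}

/-- The space `A_phg^G([0,T] × M)` for a positive index family `G` of `M`: smooth at `t = 0` and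
`t = T`, with expansions at `[0,T] × H` given by `G(H)`. -/
def phgFunctionsTime (T : ℝ) (ρ : BoundaryHypersurface n M → M → ℝ)
    (G : BoundaryHypersurface n M → Set (ℂ × ℕ)) : Set (ℝ × M → ℝ) :=
  {f | IsPhg (𝓘(ℝ, ℝ).prod (modelWithCornersEuclideanQuadrant n)) Prod.snd
    (Icc 0 T ×ˢ univ) (timeBOperators T ρ) ρ G univ f}

/-- The space `A_phg^G(M; E)`. -/
def IsPhgSection (ρ : BoundaryHypersurface n M → M → ℝ)
    (G : BoundaryHypersurface n M → Set (ℂ × ℕ))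
    (F : Type*) [NormedAddCommGroup F] [NormedSpace ℝ F]
    {E : M → Type*} [∀ x, AddCommGroup (E x)] [∀ x, Module ℝ (E x)]
    [∀ x, TopologicalSpace (E x)] [TopologicalSpace (TotalSpace F E)] [FiberBundle F E]
    (u : ∀ x : M, E x) : Prop :=
  IsSectionWithCoeffs n (modelWithCornersEuclideanQuadrant n) id univ (cornerInterior n M)
    (phgFunctions ρ G) F u

/-- The space `A_phg^G([0,T] × M; E)`. -/
def IsPhgSectionTime (T : ℝ) (ρ : BoundaryHypersurface n M → M → ℝ)
    (G : BoundaryHypersurface n M → Set (ℂ × ℕ))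
    (F : Type*) [NormedAddCommGroup F] [NormedSpace ℝ F]
    {E : M → Type*} [∀ x, AddCommGroup (E x)] [∀ x, Module ℝ (E x)]
    [∀ x, TopologicalSpace (E x)] [TopologicalSpace (TotalSpace F E)] [FiberBundle F E]
    (u : ∀ q : ℝ × M, E q.2) : Prop :=
  IsSectionWithCoeffs n (𝓘(ℝ, ℝ).prod (modelWithCornersEuclideanQuadrant n)) Prod.snd
    (Icc 0 T ×ˢ univ) (Icc 0 T ×ˢ cornerInterior n M) (phgFunctionsTime T ρ G) F u

end Phg

/-- `u` solves `∂_t u - l_t u = f`, `u|_{t=0} = u₀`, on `[0,T] × M°`. -/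
def IsSolution (n : ℕ) {M : Type*} [TopologicalSpace M] [ChartedSpace (EuclideanQuadrant n) M]
    {E : M → Type*} [∀ x, AddCommGroup (E x)] [∀ x, Module ℝ (E x)]
    [∀ x, TopologicalSpace (E x)] [∀ x, ContinuousSMul ℝ (E x)]
    (T : ℝ) (l : ∀ q : ℝ × M, E q.2 →L[ℝ] E q.2) (f : ∀ q : ℝ × M, E q.2) (u₀ : ∀ x, E x)
    (u : ∀ q : ℝ × M, E q.2) : Prop :=
  ∀ x ∈ cornerInterior n M, u (0, x) = u₀ x ∧
    ∀ t ∈ Icc 0 T, ∃ u' : E x,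
      HasDerivWithinAt (fun s => u (s, x)) u' (Icc 0 T) t ∧
      u' - l (t, x) (u (t, x)) = f (t, x)

/-- The index family `K = (G₁ ∪ (G_∞ + G₂)) + G_∞`. -/
def solutionIndexFamily {ι : Type*} (G G₁ G₂ : ι → Set (ℂ × ℕ)) : ι → Set (ℂ × ℕ) :=
  fun H => (G₁ H ∪ (indexInfinity (G H) + G₂ H)) + indexInfinity (G H)

end Polyhomogeneous

end

/-! In a frame of `E` the equation is a linear system of ordinary differential equations in `t` in
which the point of `M` is only a parameter. `E` need not be trivial, but over the compact `M`
finitely many sections span every fiber with smooth coefficient functionals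
(`exists_isGlobalFrame`). Such a redundant frame suffices, and the unknowns are the coefficients of
`u - u₀`, which vanish at `t = 0`.

Three facts about such systems carry the proof. Grönwall's inequality bounds a solution by its
forcing, uniformly in the parameter. A vector field `V` on `M` commutes with `∂_t`, so `V u` solves
the system with the same matrix and the forcing `(V l) u + V f`; by induction on the number of
derivatives, conormal data give conormal solutions (`SolvesSystem.conormalAway`). Finally `ρ_H` does
not depend on `t`, so the system may be divided by `ρ_H ^ N`: forcing in `ρ_H ^ N C_b^∞` gives a
solution in `ρ_H ^ N C_b^∞` (`SolvesSystem.isRemainder`).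

For the expansion of `u` at `H`, comparison of the coefficients of `ρ_H ^ z (log ρ_H) ^ k` gives
`∂_t a_p = ∑ l_q a_{q'} + f_p`, summed over `q + q' = p`. Up to `Re p ≤ r` these are finitely many
equations, hence a larger linear system whose data are polyhomogeneous at one hypersurface fewer;
induction on the number of hypersurfaces solves it (`exists_solvesCoeffSystem`). The difference of
`u` and the partial sum up to `N` then solves the original system with forcing in `ρ_H ^ N C_b^∞`,
so it is a remainder (`SolvesSystem.isRemainder_sub_partialSum`). Of the index family `K` only this
is used: it is positive, contains `G₁` and `G₂`, and satisfies `G + K ⊆ K`. Positivity makes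
truncations finite and leaves the constant as the only term without decay. -/

noncomputable section

namespace Polyhomogeneous

/-! ### Linear ordinary differential equations depending on a parameter -/

section LinearODE

open Filter Topology

variable {E F : Type} [NormedAddCommGroup E] [NormedSpace ℝ E]
  [NormedAddCommGroup F] [NormedSpace ℝ F]

/-- The derivatives of the terms of the Dyson series. -/
def dysonDeriv (L : ℝ → F →L[ℝ] F) (g : ℝ → F) : ℕ → ℝ → F
  | 0 => g
  | j + 1 => fun t => L t (∫ s in (0 : ℝ)..t, dysonDeriv L g j s)

theorem continuous_dysonDeriv [CompleteSpace F] {L : ℝ → F →L[ℝ] F} {g : ℝ → F}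
    (hL : Continuous L) (hg : Continuous g) : ∀ j, Continuous (dysonDeriv L g j)
  | 0 => hg
  | j + 1 => by
    have h := continuous_dysonDeriv hL hg j
    have : Continuous fun t => ∫ s in (0 : ℝ)..t, dysonDeriv L g j s :=
      intervalIntegral.continuous_primitive (fun a b => h.intervalIntegrable a b) 0
    exact hL.clm_apply this

theorem norm_dysonDeriv_integral_le {L : ℝ → F →L[ℝ] F} {g : ℝ → F}
    {j : ℕ} {t c : ℝ}
    (h : ∀ s, |s| ≤ |t| → ‖dysonDeriv L g j s‖ ≤ c * |s| ^ j) :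
    ‖∫ s in (0 : ℝ)..t, dysonDeriv L g j s‖ ≤ c * (|t| ^ (j + 1) / (j + 1)) := by
  have hi : ∫ s in uIoc 0 t, c * |s| ^ j = c * (|t| ^ (j + 1) / (j + 1)) := by
    rw [MeasureTheory.integral_const_mul]
    have := integral_pow_abs_sub_uIoc (a := 0) (b := t) j
    simp only [sub_zero] at this
    rw [this]
  refine intervalIntegral.norm_integral_le_integral_norm_uIoc.trans ?_
  rw [← hi]
  refine MeasureTheory.integral_mono_of_nonneg (Eventually.of_forall fun _ => norm_nonneg _) ?_ ?_
  · have : Continuous fun s : ℝ => c * |s| ^ j := by fun_prop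
    exact (intervalIntegrable_iff.1 (this.intervalIntegrable (μ := MeasureTheory.volume) 0 t))
  · refine (MeasureTheory.ae_restrict_mem measurableSet_uIoc).mono fun s hs => h s ?_
    rcases le_total 0 t with ht | ht
    · rw [uIoc_of_le ht] at hs
      rw [abs_of_nonneg ht, abs_of_pos hs.1]; exact hs.2
    · rw [uIoc_of_ge ht] at hs
      rw [abs_of_nonpos ht, abs_of_nonpos hs.2]; linarith [hs.1]

/-- Each integration turns `|s| ^ j` into `|t| ^ (j + 1) / (j + 1)`; these denominators accumulate
to the factorial that makes the Dyson series converge for any bound on `L`. -/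
theorem norm_dysonDeriv_le {L : ℝ → F →L[ℝ] F} {g : ℝ → F} {R M B : ℝ} (hM : 0 ≤ M)
    (hL : ∀ t, |t| ≤ R → ‖L t‖ ≤ M) (hg : ∀ t, |t| ≤ R → ‖g t‖ ≤ B) :
    ∀ (j : ℕ) (t : ℝ), |t| ≤ R → ‖dysonDeriv L g j t‖ ≤ B * M ^ j / j.factorial * |t| ^ j
  | 0, t, ht => by simpa [dysonDeriv] using hg t ht
  | j + 1, t, ht => by
    have ih := norm_dysonDeriv_integral_le (t := t)
      fun s hs => norm_dysonDeriv_le hM hL hg j s (hs.trans ht)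
    refine ((L t).le_opNorm _).trans ((mul_le_mul (hL t ht) ih (norm_nonneg _) hM).trans
      (le_of_eq ?_))
    rw [Nat.factorial_succ, pow_succ M]
    push_cast
    field_simp

/-- The solution is the sum of the primitives `U j` of the `dysonDeriv L g j`. Since the derivative
of `U (j + 1)` is `L` applied to `U j`, termwise differentiation yields `g + L u`. -/
theorem exists_linear_ode_of_continuous [CompleteSpace F] {L : ℝ → F →L[ℝ] F} {g : ℝ → F}
    (hL : Continuous L) (hg : Continuous g) :
    ∃ u : ℝ → F, u 0 = 0 ∧ ∀ t, HasDerivAt u (L t (u t) + g t) t := by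
  set U : ℕ → ℝ → F := fun j t => ∫ s in (0 : ℝ)..t, dysonDeriv L g j s with hU
  refine ⟨fun t => ∑' j, U j t, by simp [hU], fun t => ?_⟩
  -- Differentiability at `t` is local; the interval `(-R, R)` contains both `t` and the base point
  -- `0`, and the derivatives are dominated uniformly on it.
  set R := |t| + 1 with hR
  obtain ⟨M, hM⟩ := (isCompact_Icc (a := -R) (b := R)).exists_bound_of_continuousOn
    hL.continuousOn
  obtain ⟨B, hB⟩ := (isCompact_Icc (a := -R) (b := R)).exists_bound_of_continuousOn
    hg.continuousOn
  have hRpos : 0 < R := by positivity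
  have hR0 : (0 : ℝ) ∈ Icc (-R) R := ⟨by linarith, hRpos.le⟩
  have hM0 : 0 ≤ M := (norm_nonneg _).trans (hM 0 hR0)
  have hB0 : 0 ≤ B := (norm_nonneg _).trans (hB 0 hR0)
  have hbd : ∀ (j : ℕ) (s : ℝ), |s| ≤ R →
      ‖dysonDeriv L g j s‖ ≤ B * ((M * R) ^ j / j.factorial) := by
    intro j s hs
    refine (norm_dysonDeriv_le hM0 (fun t ht => hM t (abs_le.1 ht)) (fun t ht => hB t (abs_le.1 ht))
      j s hs).trans ?_
    calc _ ≤ B * M ^ j / j.factorial * R ^ j := by gcongr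
      _ = _ := by rw [mul_pow]; ring
  have hsum : Summable fun j : ℕ => B * ((M * R) ^ j / j.factorial) :=
    (Real.summable_pow_div_factorial _).mul_left _
  have hder : ∀ j s, HasDerivAt (U j) (dysonDeriv L g j s) s := fun j s =>
    ((continuous_dysonDeriv hL hg j).integral_hasStrictDerivAt 0 s).hasDerivAt
  have hmem : ∀ {s : ℝ}, s ∈ Ioo (-R) R → |s| ≤ R := fun hs => abs_le.2 ⟨hs.1.le, hs.2.le⟩
  have htR : t ∈ Ioo (-R) R := abs_lt.1 (by simp [hR])
  have h0R : (0 : ℝ) ∈ Ioo (-R) R := abs_lt.1 (by simpa using hRpos)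
  have key := hasDerivAt_tsum_of_isPreconnected hsum isOpen_Ioo isPreconnected_Ioo
    (fun j s _ => hder j s) (fun j s hs => hbd j s (hmem hs)) h0R (by simp [hU]) htR
  have hsU : Summable fun j => U j t :=
    summable_of_summable_hasDerivAt_of_isPreconnected hsum isOpen_Ioo isPreconnected_Ioo
      (fun j s _ => hder j s) (fun j s hs => hbd j s (hmem hs)) h0R (by simp [hU]) htR
  convert key using 1
  have hsD : Summable fun j => dysonDeriv L g j t :=
    Summable.of_norm_bounded hsum fun j => hbd j t (hmem htR)
  -- The term `j = 0` is `g`; the shifted series is `L` applied to the series of the `U j`.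
  rw [hsD.tsum_eq_zero_add, add_comm, (L t).map_tsum hsU]
  rfl

/-- The data are extended by constants beyond the endpoints, and the equation is solved on the whole
line. -/
theorem exists_linear_ode [CompleteSpace F] {T : ℝ} (hT : 0 ≤ T) {L : ℝ → F →L[ℝ] F} {g : ℝ → F}
    (hL : ContinuousOn L (Icc 0 T)) (hg : ContinuousOn g (Icc 0 T)) :
    ∃ u : ℝ → F, u 0 = 0 ∧
      ∀ t ∈ Icc 0 T, HasDerivWithinAt u (L t (u t) + g t) (Icc 0 T) t := by
  obtain ⟨u, h0, hu⟩ := exists_linear_ode_of_continuous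
    (continuous_IccExtend_iff (h := hT).2 (continuousOn_iff_continuous_domRestrict.1 hL))
    (continuous_IccExtend_iff (h := hT).2 (continuousOn_iff_continuous_domRestrict.1 hg))
  refine ⟨u, h0, fun t ht => ?_⟩
  have := (hu t).hasDerivWithinAt (s := Icc 0 T)
  rwa [IccExtend_of_mem hT _ ht, IccExtend_of_mem hT _ ht] at this

/-! ### Grönwall bounds and uniqueness -/

/-- Grönwall's inequality with the constant `M + 1` in place of `M`: this avoids the degenerate case
of a zero constant, and the factor `ε / (M + 1)` that appears is at most `ε`. -/
theorem norm_le_of_linear_ode {T M ε : ℝ} {u f : ℝ → F} {L : ℝ → F →L[ℝ] F}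
    (hM : 0 ≤ M) (hu0 : u 0 = 0)
    (hu : ∀ t ∈ Icc 0 T, HasDerivWithinAt u (L t (u t) + f t) (Icc 0 T) t)
    (hL : ∀ t ∈ Icc 0 T, ‖L t‖ ≤ M) (hf : ∀ t ∈ Icc 0 T, ‖f t‖ ≤ ε) :
    ∀ t ∈ Icc 0 T, ‖u t‖ ≤ ε * Real.exp ((M + 1) * T) := by
  intro t ht
  have h0 : (0 : ℝ) ∈ Icc 0 T := ⟨le_rfl, ht.1.trans ht.2⟩
  have hε : 0 ≤ ε := (norm_nonneg _).trans (hf 0 h0)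
  have key := norm_le_gronwallBound_of_norm_deriv_right_le (δ := 0) (K := M + 1) (ε := ε)
    (fun t ht => (hu t ht).continuousWithinAt)
    (fun t ht => (hu t ⟨ht.1, ht.2.le⟩).mono_of_mem_nhdsWithin
      (Filter.mem_of_superset (Icc_mem_nhdsGE ht.2) (Icc_subset_Icc_left ht.1)))
    (by simp [hu0]) (fun t ht => by
      have ht' : t ∈ Icc 0 T := ⟨ht.1, ht.2.le⟩
      refine (norm_add_le _ _).trans (add_le_add (((L t).le_opNorm _).trans ?_) (hf t ht'))
      gcongr
      linarith [hL t ht']) t ht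
  refine key.trans ?_
  rw [gronwallBound_of_K_ne_0 (by linarith)]
  simp only [sub_zero, zero_mul, zero_add]
  have h1 : ε / (M + 1) ≤ ε := div_le_self hε (by linarith)
  have h2 : Real.exp ((M + 1) * t) - 1 ≤ Real.exp ((M + 1) * T) := by
    have : Real.exp ((M + 1) * t) ≤ Real.exp ((M + 1) * T) :=
      Real.exp_le_exp.2 (mul_le_mul_of_nonneg_left ht.2 (by linarith))
    linarith
  have h3 : 0 ≤ Real.exp ((M + 1) * t) - 1 := by
    have := Real.one_le_exp (mul_nonneg (by linarith : 0 ≤ M + 1) ht.1)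
    linarith
  exact mul_le_mul h1 h2 h3 hε

theorem eqOn_of_linear_ode {T : ℝ} {u v f : ℝ → F} {L : ℝ → F →L[ℝ] F}
    (h0 : u 0 = v 0) (hL : ContinuousOn L (Icc 0 T))
    (hu : ∀ t ∈ Icc 0 T, HasDerivWithinAt u (L t (u t) + f t) (Icc 0 T) t)
    (hv : ∀ t ∈ Icc 0 T, HasDerivWithinAt v (L t (v t) + f t) (Icc 0 T) t) :
    EqOn u v (Icc 0 T) := by
  obtain ⟨M, hM⟩ := isCompact_Icc.exists_bound_of_continuousOn hL
  intro t ht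
  have := norm_le_of_linear_ode (u := u - v) (f := 0) (L := L) (T := T) (M := |M|) (ε := 0)
    (abs_nonneg _) (by simp [h0]) (fun t ht => by
      convert (hu t ht).sub (hv t ht) using 1
      simp) (fun t ht => (hM t ht).trans (le_abs_self _)) (by simp) t ht
  simpa [sub_eq_zero] using this

/-! ### Continuous and smooth dependence on the parameter -/

omit [NormedSpace ℝ E] [NormedSpace ℝ F] in
/-- Continuity in the parameter is uniform over a compact time interval. -/
theorem eventually_forall_norm_sub_le {T : ℝ} {C : Set E} {h : ℝ × E → F}
    (hh : ContinuousOn h (Icc 0 T ×ˢ C)) {x₀ : E} (hx₀ : x₀ ∈ C) {ε : ℝ} (hε : 0 < ε) :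
    ∀ᶠ x in 𝓝[C] x₀, ∀ t ∈ Icc 0 T, ‖h (t, x) - h (t, x₀)‖ ≤ ε := by
  have hc : ContinuousOn (Function.uncurry fun (x : E) (t : ℝ) => h (t, x)) (C ×ˢ Icc 0 T) :=
    hh.comp (Continuous.continuousOn (by fun_prop)) fun p hp => ⟨hp.2, hp.1⟩
  obtain ⟨v, hv, hv'⟩ := isCompact_Icc.mem_uniformity_of_prod hc hx₀ (Metric.dist_mem_uniformity hε)
  filter_upwards [hv] with x hx t ht
  rw [← dist_eq_norm]
  exact le_of_lt (hv' x hx t ht)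

-- With the operator frozen at `x₀`, the equation can be compared with the linearized one; this form
-- serves differentiability.
omit [NormedAddCommGroup E] [NormedSpace ℝ E] in
theorem hasDerivWithinAt_sub_param {T : ℝ} {L : ℝ × E → F →L[ℝ] F} {g u : ℝ × E → F} {C : Set E}
    (hu : ∀ x ∈ C, ∀ t ∈ Icc 0 T, HasDerivWithinAt (fun s => u (s, x))
      (L (t, x) (u (t, x)) + g (t, x)) (Icc 0 T) t) {x x₀ : E} (hx : x ∈ C) (hx₀ : x₀ ∈ C) :
    ∀ t ∈ Icc 0 T, HasDerivWithinAt (fun s => u (s, x) - u (s, x₀))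
      (L (t, x₀) (u (t, x) - u (t, x₀)) +
        ((L (t, x) - L (t, x₀)) (u (t, x)) + (g (t, x) - g (t, x₀)))) (Icc 0 T) t := by
  intro t ht
  convert (hu x hx t ht).fun_sub (hu x₀ hx₀ t ht) using 1
  simp only [map_sub, sub_apply]
  abel

-- With the operator at `x`, the forcing contains only the fixed solution `u (t, x₀)`, which is
-- bounded in time. This form serves continuity, where nothing is known yet about `u (t, x)`.
omit [NormedAddCommGroup E] [NormedSpace ℝ E] in
theorem hasDerivWithinAt_sub_param' {T : ℝ} {L : ℝ × E → F →L[ℝ] F} {g u : ℝ × E → F} {C : Set E}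
    (hu : ∀ x ∈ C, ∀ t ∈ Icc 0 T, HasDerivWithinAt (fun s => u (s, x))
      (L (t, x) (u (t, x)) + g (t, x)) (Icc 0 T) t) {x x₀ : E} (hx : x ∈ C) (hx₀ : x₀ ∈ C) :
    ∀ t ∈ Icc 0 T, HasDerivWithinAt (fun s => u (s, x) - u (s, x₀))
      (L (t, x) (u (t, x) - u (t, x₀)) +
        ((L (t, x) - L (t, x₀)) (u (t, x₀)) + (g (t, x) - g (t, x₀)))) (Icc 0 T) t := by
  intro t ht
  convert (hu x hx t ht).fun_sub (hu x₀ hx₀ t ht) using 1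
  simp only [map_sub, sub_apply]
  abel

theorem exists_nonneg_bound_of_continuousOn_Icc {T : ℝ} {G : Type*} [NormedAddCommGroup G]
    {h : ℝ → G}
    (hh : ContinuousOn h (Icc 0 T)) : ∃ M, 0 ≤ M ∧ ∀ t ∈ Icc 0 T, ‖h t‖ ≤ M := by
  obtain ⟨M, hM⟩ := isCompact_Icc.exists_bound_of_continuousOn hh
  exact ⟨|M|, abs_nonneg _, fun t ht => (hM t ht).trans (le_abs_self _)⟩

omit [NormedSpace ℝ E] in
theorem continuousOn_slice {T : ℝ} {C : Set E} {G : Type*} [TopologicalSpace G]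
    {h : ℝ × E → G} (hh : ContinuousOn h (Icc 0 T ×ˢ C)) {x : E} (hx : x ∈ C) :
    ContinuousOn (fun t => h (t, x)) (Icc 0 T) :=
  hh.comp (Continuous.continuousOn (by fun_prop)) fun _ ht => ⟨ht, hx⟩

omit [NormedSpace ℝ E] in
/-- Solutions of a linear equation depend continuously on the parameter, uniformly in time. -/
theorem eventually_forall_norm_sub_le_of_linear_ode {T : ℝ} {L : ℝ × E → F →L[ℝ] F}
    {g u : ℝ × E → F} {C : Set E} (hL : ContinuousOn L (Icc 0 T ×ˢ C))
    (hg : ContinuousOn g (Icc 0 T ×ˢ C)) (hu0 : ∀ x ∈ C, u (0, x) = 0)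
    (hu : ∀ x ∈ C, ∀ t ∈ Icc 0 T, HasDerivWithinAt (fun s => u (s, x))
      (L (t, x) (u (t, x)) + g (t, x)) (Icc 0 T) t) {x₀ : E} (hx₀ : x₀ ∈ C)
    {ε : ℝ} (hε : 0 < ε) :
    ∀ᶠ x in 𝓝[C] x₀, ∀ t ∈ Icc 0 T, ‖u (t, x) - u (t, x₀)‖ ≤ ε := by
  obtain ⟨M, hM0, hM⟩ := exists_nonneg_bound_of_continuousOn_Icc (continuousOn_slice hL hx₀)
  obtain ⟨B, hB0, hB⟩ := exists_nonneg_bound_of_continuousOn_Icc (T := T) (h := fun t => u (t, x₀))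
    fun t ht => (hu x₀ hx₀ t ht).continuousWithinAt
  set K := Real.exp ((M + 1 + 1) * T)
  have hK : 0 < K := Real.exp_pos _
  -- If `L` and `g` move by at most `η`, the forcing of the difference is at most `η * (B + 1)`,
  -- which Grönwall multiplies by `K`. The condition `η ≤ 1` keeps the norm of `L (t, x)` below `M +
  -- 1`.
  set η := min 1 (ε / (K * (B + 1))) with hη
  have hη0 : 0 < η := by positivity
  have hηε : η * (B + 1) * K ≤ ε := by
    have := min_le_right 1 (ε / (K * (B + 1)))
    rw [← hη, le_div_iff₀ (by positivity)] at this
    linarith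
  filter_upwards [eventually_forall_norm_sub_le hL hx₀ hη0,
    eventually_forall_norm_sub_le hg hx₀ hη0,
    self_mem_nhdsWithin] with x h1 h2 hx t ht
  refine (norm_le_of_linear_ode (M := M + 1) (ε := η * (B + 1)) (by positivity)
    (show u (0, x) - u (0, x₀) = 0 by rw [hu0 x hx, hu0 x₀ hx₀, sub_zero])
    (hasDerivWithinAt_sub_param' hu hx hx₀) (fun t ht => ?_) (fun t ht => ?_) t ht).trans hηε
  · have := norm_le_norm_add_norm_sub' (L (t, x)) (L (t, x₀))
    linarith [hM t ht, h1 t ht, min_le_left 1 (ε / (K * (B + 1)))]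
  · refine (norm_add_le _ _).trans ?_
    have h3 := ((L (t, x) - L (t, x₀)).le_opNorm (u (t, x₀))).trans
      (mul_le_mul (h1 t ht) (hB t ht) (norm_nonneg _) hη0.le)
    linarith [h2 t ht]

-- Joint continuity follows by passing through `(t, x₀)`: continuity in `x` is uniform in time, and
-- `u (·, x₀)` is continuous.
omit [NormedSpace ℝ E] in
theorem continuousOn_of_linear_ode {T : ℝ} {L : ℝ × E → F →L[ℝ] F}
    {g u : ℝ × E → F} {C : Set E} (hL : ContinuousOn L (Icc 0 T ×ˢ C))
    (hg : ContinuousOn g (Icc 0 T ×ˢ C)) (hu0 : ∀ x ∈ C, u (0, x) = 0)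
    (hu : ∀ x ∈ C, ∀ t ∈ Icc 0 T, HasDerivWithinAt (fun s => u (s, x))
      (L (t, x) (u (t, x)) + g (t, x)) (Icc 0 T) t) :
    ContinuousOn u (Icc 0 T ×ˢ C) := by
  rintro ⟨t₀, x₀⟩ ⟨ht₀, hx₀⟩
  rw [ContinuousWithinAt, Metric.tendsto_nhds]
  intro ε hε
  have h1 := eventually_forall_norm_sub_le_of_linear_ode hL hg hu0 hu hx₀ (half_pos hε)
  have h2 := Metric.tendsto_nhds.1 (hu x₀ hx₀ t₀ ht₀).continuousWithinAt (ε / 2) (half_pos hε)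
  rw [nhdsWithin_prod_eq]
  filter_upwards [h2.prod_mk h1, (eventually_mem_nhdsWithin (a := t₀)
    (s := Icc 0 T)).prod_inl (𝓝[C] x₀)] with p hp hpt
  have h3 := hp.2 p.1 hpt
  rw [← dist_eq_norm] at h3
  calc _ ≤ dist (u (p.1, p.2)) (u (p.1, x₀)) + dist (u (p.1, x₀)) (u (t₀, x₀)) :=
        dist_triangle _ _ _
    _ < ε := by linarith [hp.1]

/-- The partial derivative in the parameter. -/
def paramDeriv (T : ℝ) (C : Set E) (h : ℝ × E → F) (p : ℝ × E) : E →L[ℝ] F :=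
  (fderivWithin ℝ h (Icc 0 T ×ˢ C) p).comp (ContinuousLinearMap.inr ℝ ℝ E)

theorem hasFDerivWithinAt_param {T : ℝ} {C : Set E} {h : ℝ × E → F}
    (hh : DifferentiableOn ℝ h (Icc 0 T ×ˢ C)) {t : ℝ} (ht : t ∈ Icc 0 T) {x : E} (hx : x ∈ C) :
    HasFDerivWithinAt (fun y => h (t, y)) (paramDeriv T C h (t, x)) C x :=
  (hh (t, x) ⟨ht, hx⟩).hasFDerivWithinAt.comp x (hasFDerivAt_prodMk_right t x).hasFDerivWithinAt
    fun _ hy => ⟨ht, hy⟩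

theorem contDiffOn_paramDeriv {T : ℝ} {C : Set E} {h : ℝ × E → F} {k m : WithTop ℕ∞}
    (hC : UniqueDiffOn ℝ (Icc 0 T ×ˢ C))
    (hh : ContDiffOn ℝ k h (Icc 0 T ×ˢ C)) (hk : m + 1 ≤ k) :
    ContDiffOn ℝ m (paramDeriv T C h) (Icc 0 T ×ˢ C) :=
  (hh.fderivWithin hC hk).clm_comp contDiffOn_const

/-- Differentiability in the parameter is uniform over a compact time interval. -/
theorem eventually_forall_norm_sub_sub_le {T : ℝ} {C : Set E} (hC : Convex ℝ C) {h : ℝ × E → F}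
    (hh : DifferentiableOn ℝ h (Icc 0 T ×ˢ C))
    (hh' : ContinuousOn (paramDeriv T C h) (Icc 0 T ×ˢ C))
    {x₀ : E} (hx₀ : x₀ ∈ C) {ε : ℝ} (hε : 0 < ε) :
    ∀ᶠ x in 𝓝[C] x₀, ∀ t ∈ Icc 0 T,
      ‖h (t, x) - h (t, x₀) - paramDeriv T C h (t, x₀) (x - x₀)‖ ≤ ε * ‖x - x₀‖ := by
  have h1 := eventually_forall_norm_sub_le hh' hx₀ hε
  obtain ⟨r, hr, hr'⟩ := Metric.mem_nhdsWithin_iff.1 h1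
  -- Convexity survives intersection with a ball, so the mean value inequality applies to every `h
  -- (t, ·)` with one neighbourhood for all `t`.
  have hconv : Convex ℝ (Metric.ball x₀ r ∩ C) := (convex_ball x₀ r).inter hC
  filter_upwards [inter_mem (nhdsWithin_le_nhds (Metric.ball_mem_nhds x₀ hr))
    self_mem_nhdsWithin] with x hx t ht
  exact hconv.norm_image_sub_le_of_norm_hasFDerivWithin_le'
    (fun y hy => (hasFDerivWithinAt_param hh ht hy.2).mono inter_subset_right)
    (fun y hy => hr' hy t ht) ⟨Metric.mem_ball_self hr, hx₀⟩ hx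

set_option synthInstance.maxHeartbeats 400000 in
/-- Solutions of a linear equation are differentiable in the parameter, uniformly in time. -/
theorem eventually_forall_norm_sub_sub_le_of_linear_ode {T : ℝ} {L : ℝ × E → F →L[ℝ] F}
    {g u : ℝ × E → F} {v : ℝ × E → E →L[ℝ] F} {C : Set E} (hC : Convex ℝ C)
    (hL : DifferentiableOn ℝ L (Icc 0 T ×ˢ C))
    (hL' : ContinuousOn (paramDeriv T C L) (Icc 0 T ×ˢ C))
    (hg : DifferentiableOn ℝ g (Icc 0 T ×ˢ C))
    (hg' : ContinuousOn (paramDeriv T C g) (Icc 0 T ×ˢ C))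
    (hu0 : ∀ x ∈ C, u (0, x) = 0)
    (hu : ∀ x ∈ C, ∀ t ∈ Icc 0 T, HasDerivWithinAt (fun s => u (s, x))
      (L (t, x) (u (t, x)) + g (t, x)) (Icc 0 T) t) {x₀ : E} (hx₀ : x₀ ∈ C)
    (hv0 : v (0, x₀) = 0)
    (hv : ∀ t ∈ Icc 0 T, HasDerivWithinAt (fun s => v (s, x₀))
      ((L (t, x₀)).comp (v (t, x₀)) + ((paramDeriv T C L (t, x₀)).flip (u (t, x₀)) +
        paramDeriv T C g (t, x₀))) (Icc 0 T) t)
    {ε : ℝ} (hε : 0 < ε) :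
    ∀ᶠ x in 𝓝[C] x₀, ∀ t ∈ Icc 0 T,
      ‖u (t, x) - u (t, x₀) - v (t, x₀) (x - x₀)‖ ≤ ε * ‖x - x₀‖ := by
  obtain ⟨M, hM0, hM⟩ := exists_nonneg_bound_of_continuousOn_Icc
    (continuousOn_slice hL.continuousOn hx₀)
  obtain ⟨D, hD0, hD⟩ := exists_nonneg_bound_of_continuousOn_Icc (continuousOn_slice hL' hx₀)
  obtain ⟨B, hB0, hB⟩ := exists_nonneg_bound_of_continuousOn_Icc (T := T) (h := fun t => u (t, x₀))
    fun t ht => (hu x₀ hx₀ t ht).continuousWithinAt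
  set K := Real.exp ((M + 1) * T)
  have hK : 0 < K := Real.exp_pos _
  -- The three forcing terms below contribute `η * (D + 1)`, `η * B` and `η`, each times `‖x - x₀‖`.
  set η := min 1 (ε / (K * (D + B + 2))) with hη
  have hη0 : 0 < η := by positivity
  have hη1 : η ≤ 1 := min_le_left _ _
  have hηε : η * (D + B + 2) * K ≤ ε := by
    have := min_le_right 1 (ε / (K * (D + B + 2)))
    rw [← hη, le_div_iff₀ (by positivity)] at this
    linarith
  filter_upwards [eventually_forall_norm_sub_sub_le hC hL hL' hx₀ hη0,
    eventually_forall_norm_sub_sub_le hC hg hg' hx₀ hη0,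
    eventually_forall_norm_sub_le_of_linear_ode hL.continuousOn hg.continuousOn hu0 hu hx₀ hη0,
    self_mem_nhdsWithin] with x h1 h2 h3 hx t ht
  have hn := norm_nonneg (x - x₀)
  -- The linearization error of `u` solves the equation frozen at `x₀`. Its forcing is a product of
  -- two increments plus the linearization errors of `L` and `g`, hence `o(‖x - x₀‖)` uniformly in
  -- time.
  refine (norm_le_of_linear_ode (u := fun t => u (t, x) - u (t, x₀) - v (t, x₀) (x - x₀))
    (L := fun t => L (t, x₀)) (M := M)
    (f := fun t => (L (t, x) - L (t, x₀)) (u (t, x) - u (t, x₀)) +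
      (L (t, x) - L (t, x₀) - paramDeriv T C L (t, x₀) (x - x₀)) (u (t, x₀)) +
      (g (t, x) - g (t, x₀) - paramDeriv T C g (t, x₀) (x - x₀)))
    (ε := η * (D + B + 2) * ‖x - x₀‖) hM0
    (by simp [hu0 x hx, hu0 x₀ hx₀, hv0])
    (fun t ht => ?_) hM (fun t ht => ?_) t ht).trans ?_
  · have hv' := (ContinuousLinearMap.apply ℝ F (x - x₀)).hasFDerivAt.comp_hasDerivWithinAt t
      (hv t ht)
    refine ((hasDerivWithinAt_sub_param hu hx hx₀ t ht).fun_sub hv').congr_deriv ?_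
    rw [ContinuousLinearMap.apply_apply, add_apply, add_apply, ContinuousLinearMap.comp_apply,
      ContinuousLinearMap.flip_apply, sub_apply, sub_apply, (L (t, x₀)).map_sub,
      (L (t, x₀)).map_sub, sub_apply, (L (t, x)).map_sub, (L (t, x₀)).map_sub, sub_apply]
    abel
  · have a1 : ‖L (t, x) - L (t, x₀)‖ ≤ (D + 1) * ‖x - x₀‖ := by
      have := norm_le_norm_add_norm_sub' (L (t, x) - L (t, x₀))
        (paramDeriv T C L (t, x₀) (x - x₀))
      have h4 := ((paramDeriv T C L (t, x₀)).le_opNorm (x - x₀)).trans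
        (mul_le_mul_of_nonneg_right (hD t ht) hn)
      nlinarith [h1 t ht]
    have b1 := ((L (t, x) - L (t, x₀)).le_opNorm (u (t, x) - u (t, x₀))).trans
      (mul_le_mul a1 (h3 t ht) (norm_nonneg _) (by positivity))
    have b2 := ((L (t, x) - L (t, x₀) - paramDeriv T C L (t, x₀) (x - x₀)).le_opNorm
      (u (t, x₀))).trans (mul_le_mul (h1 t ht) (hB t ht) (norm_nonneg _) (by positivity))
    refine (norm_add₃_le).trans ?_
    linarith [h2 t ht]
  · rw [mul_right_comm]
    exact mul_le_mul_of_nonneg_right hηε hn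

/-- The equation provides the time part of the derivative and `v` the parameter part. The increment
is split at `(t, x₀)`, and moving `v` from time `t` to `t₀` gives the third error. -/
theorem hasFDerivWithinAt_of_linear_ode {T : ℝ} {L : ℝ × E → F →L[ℝ] F}
    {g u : ℝ × E → F} {v : ℝ × E → E →L[ℝ] F} {C : Set E}
    (hu : ∀ x ∈ C, ∀ t ∈ Icc 0 T, HasDerivWithinAt (fun s => u (s, x))
      (L (t, x) (u (t, x)) + g (t, x)) (Icc 0 T) t)
    {x₀ : E} (hx₀ : x₀ ∈ C) {t₀ : ℝ} (ht₀ : t₀ ∈ Icc 0 T)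
    (hv : ContinuousWithinAt (fun s => v (s, x₀)) (Icc 0 T) t₀)
    (huv : ∀ ε > 0, ∀ᶠ x in 𝓝[C] x₀, ∀ t ∈ Icc 0 T,
      ‖u (t, x) - u (t, x₀) - v (t, x₀) (x - x₀)‖ ≤ ε * ‖x - x₀‖) :
    HasFDerivWithinAt u
      ((ContinuousLinearMap.toSpanSingleton ℝ (L (t₀, x₀) (u (t₀, x₀)) + g (t₀, x₀))).coprod
        (v (t₀, x₀))) (Icc 0 T ×ˢ C) (t₀, x₀) := by
  rw [hasFDerivWithinAt_iff_isLittleO, Asymptotics.isLittleO_iff]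
  intro ε hε
  have hε3 : 0 < ε / 3 := by positivity
  have h1 := huv _ hε3
  have h2 := Asymptotics.isLittleO_iff.1
    (hasDerivWithinAt_iff_isLittleO.1 (hu x₀ hx₀ t₀ ht₀)) hε3
  have h3 := Metric.tendsto_nhds.1 hv _ hε3
  rw [nhdsWithin_prod_eq]
  filter_upwards [(h2.and h3).prod_mk h1, (eventually_mem_nhdsWithin (a := t₀)
    (s := Icc 0 T)).prod_inl (𝓝[C] x₀)] with p hp hpt
  obtain ⟨t, x⟩ := p
  obtain ⟨⟨hp1, hp2⟩, hp3⟩ := hp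
  simp only at hp1 hp2 hp3 hpt
  have hp3 := hp3 t hpt
  rw [dist_eq_norm] at hp2
  have e1 : ‖x - x₀‖ ≤ ‖(t, x) - (t₀, x₀)‖ := by
    rw [Prod.mk_sub_mk]; exact norm_snd_le (t - t₀, x - x₀)
  have e2 : ‖t - t₀‖ ≤ ‖(t, x) - (t₀, x₀)‖ := by
    rw [Prod.mk_sub_mk]; exact norm_fst_le (t - t₀, x - x₀)
  have e3 := ((v (t, x₀) - v (t₀, x₀)).le_opNorm (x - x₀)).trans
    (mul_le_mul_of_nonneg_right hp2.le (norm_nonneg _))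
  have e4 : u (t, x) - u (t₀, x₀) -
      ((ContinuousLinearMap.toSpanSingleton ℝ (L (t₀, x₀) (u (t₀, x₀)) + g (t₀, x₀))).coprod
        (v (t₀, x₀))) ((t, x) - (t₀, x₀)) =
      (u (t, x) - u (t, x₀) - v (t, x₀) (x - x₀)) +
      (u (t, x₀) - u (t₀, x₀) - (t - t₀) • (L (t₀, x₀) (u (t₀, x₀)) + g (t₀, x₀))) +
      (v (t, x₀) - v (t₀, x₀)) (x - x₀) := by
    simp only [Prod.mk_sub_mk, ContinuousLinearMap.coprod_apply,
      ContinuousLinearMap.toSpanSingleton_apply, sub_apply]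
    abel
  rw [e4]
  refine norm_add₃_le.trans ?_
  nlinarith

theorem contDiffOn_flip_apply {A B X Y : Type*} [NormedAddCommGroup A] [NormedSpace ℝ A]
    [NormedAddCommGroup B] [NormedSpace ℝ B] [NormedAddCommGroup X] [NormedSpace ℝ X]
    [NormedAddCommGroup Y] [NormedSpace ℝ Y] {k : WithTop ℕ∞} {f : X → A →L[ℝ] B →L[ℝ] Y}
    {g : X → B} {s : Set X} (hf : ContDiffOn ℝ k f s) (hg : ContDiffOn ℝ k g s) :
    ContDiffOn ℝ k (fun p => (f p).flip (g p)) s := by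
  have h : ContDiffOn ℝ k (fun p => ContinuousLinearMap.apply ℝ Y (g p)) s :=
    contDiffOn_const.clm_apply hg
  exact h.clm_comp hf

set_option synthInstance.maxHeartbeats 400000 in
set_option maxHeartbeats 1000000 in
/-- Solutions of a linear equation depend smoothly on time and the parameter. -/
theorem contDiffOn_of_linear_ode {T : ℝ} (hT : 0 < T) {C : Set E} (hC : Convex ℝ C)
    (hC' : UniqueDiffOn ℝ C) (k : ℕ) :
    ∀ {F : Type} [NormedAddCommGroup F] [NormedSpace ℝ F] [CompleteSpace F]
      {L : ℝ × E → F →L[ℝ] F} {g u : ℝ × E → F},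
      ContDiffOn ℝ k L (Icc 0 T ×ˢ C) → ContDiffOn ℝ k g (Icc 0 T ×ˢ C) →
      (∀ x ∈ C, u (0, x) = 0) →
      (∀ x ∈ C, ∀ t ∈ Icc 0 T, HasDerivWithinAt (fun s => u (s, x))
        (L (t, x) (u (t, x)) + g (t, x)) (Icc 0 T) t) →
      ContDiffOn ℝ k u (Icc 0 T ×ˢ C) := by
  have hU : UniqueDiffOn ℝ (Icc 0 T ×ˢ C) := (uniqueDiffOn_Icc hT).prod hC'
  -- `F` is quantified inside the induction because the parameter derivative solves a linear
  -- equation in `E →L[ℝ] F`, to which the induction hypothesis is applied.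
  induction k with
  | zero =>
    intro F _ _ _ L g u hL hg hu0 hu
    exact contDiffOn_zero.2 (continuousOn_of_linear_ode hL.continuousOn hg.continuousOn hu0 hu)
  | succ k ih =>
    intro F _ _ _ L g u hL hg hu0 hu
    have hk : (k : WithTop ℕ∞) + 1 ≤ (k + 1 : ℕ) := by norm_cast
    have hk' : (k : WithTop ℕ∞) ≤ (k + 1 : ℕ) := by norm_cast; omega
    have hk1 : ((k + 1 : ℕ) : WithTop ℕ∞) ≠ 0 := by norm_cast
    have huk := ih (hL.of_le hk') (hg.of_le hk') hu0 hu
    have hL' := contDiffOn_paramDeriv hU hL hk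
    have hg' := contDiffOn_paramDeriv hU hg hk
    -- The equation linearized in the parameter has operator `A` (composition with `L`) and forcing
    -- `b`. Both are only `C^k`, and `b` contains `u`, which is `C^k` by induction.
    set A : ℝ × E → (E →L[ℝ] F) →L[ℝ] (E →L[ℝ] F) :=
      fun p => ContinuousLinearMap.compL ℝ E F F (L p) with hA
    set b : ℝ × E → E →L[ℝ] F := fun p =>
      (paramDeriv T C L p).flip (u p) + paramDeriv T C g p with hb
    have hAk : ContDiffOn ℝ k A (Icc 0 T ×ˢ C) :=
      contDiffOn_const.clm_apply (hL.of_le hk')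
    have hbk : ContDiffOn ℝ k b (Icc 0 T ×ˢ C) :=
      (contDiffOn_flip_apply hL' huk).add hg'
    have hex : ∀ x : E, ∃ w : ℝ → E →L[ℝ] F, x ∈ C → w 0 = 0 ∧
        ∀ t ∈ Icc 0 T, HasDerivWithinAt w (A (t, x) (w t) + b (t, x)) (Icc 0 T) t := by
      intro x
      by_cases hx : x ∈ C
      · obtain ⟨w, hw⟩ := exists_linear_ode hT.le (continuousOn_slice hAk.continuousOn hx)
          (continuousOn_slice hbk.continuousOn hx)
        exact ⟨w, fun _ => hw⟩
      · exact ⟨0, fun h => absurd h hx⟩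
    choose w hw using hex
    set v : ℝ × E → E →L[ℝ] F := fun p => w p.2 p.1 with hv
    have hvk : ContDiffOn ℝ k v (Icc 0 T ×ˢ C) :=
      ih hAk hbk (fun x hx => (hw x hx).1) fun x hx => (hw x hx).2
    -- The total derivative `(L u + g) dt + v dx` is of class `C^k`, hence `u` is `C^(k+1)`.
    rw [Nat.cast_succ, contDiffOn_succ_iff_hasFDerivWithinAt_of_uniqueDiffOn hU]
    refine ⟨by simp, fun p => (ContinuousLinearMap.toSpanSingleton ℝ (L p (u p) + g p)).coprod
      (v p), ?_, ?_⟩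
    · have h1 : ContDiffOn ℝ k (fun p => L p (u p) + g p) (Icc 0 T ×ˢ C) :=
        ((hL.of_le hk').clm_apply huk).add (hg.of_le hk')
      have h2 : ContDiffOn ℝ k (fun p => (ContinuousLinearMap.toSpanSingleton ℝ
          (L p (u p) + g p)).comp (ContinuousLinearMap.fst ℝ ℝ E) +
            (v p).comp (ContinuousLinearMap.snd ℝ ℝ E)) (Icc 0 T ×ˢ C) :=
        (((ContinuousLinearMap.toSpanSingletonCLE (𝕜 := ℝ) (E := F)).contDiff.comp_contDiffOn
          h1).clm_comp
          contDiffOn_const).add (hvk.clm_comp contDiffOn_const)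
      refine h2.congr fun p _ => ?_
      ext <;> simp
    · rintro ⟨t, x⟩ ⟨ht, hx⟩
      exact hasFDerivWithinAt_of_linear_ode hu hx ht (continuousOn_slice hvk.continuousOn hx t ht)
        fun ε hε => eventually_forall_norm_sub_sub_le_of_linear_ode hC
          (hL.differentiableOn hk1) hL'.continuousOn (hg.differentiableOn hk1) hg'.continuousOn
          hu0 hu hx (hw x hx).1 (hw x hx).2 hε

end LinearODE

/-! ### Smooth functions on `[0,T] × U` -/

section SmoothTime

open Filter Topology

variable {E : Type} [NormedAddCommGroup E] [NormedSpace ℝ E] {H : Type*} [TopologicalSpace H]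
  {I : ModelWithCorners ℝ E H} {M : Type*} [TopologicalSpace M] [ChartedSpace H M]
  {T : ℝ} {U : Set M}

/-- A convex neighbourhood in the chart at `x₀`. -/
structure IsChartBox (I : ModelWithCorners ℝ E H) (U : Set M) (x₀ : M) (C : Set E) : Prop where
  convex : Convex ℝ C
  uniqueDiffOn : UniqueDiffOn ℝ C
  subset_closure_interior : C ⊆ closure (interior C)
  mem : extChartAt I x₀ x₀ ∈ C
  mem_nhdsWithin : C ∈ 𝓝[range I] (extChartAt I x₀ x₀)
  subset_target : C ⊆ (extChartAt I x₀).target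
  mapsTo : MapsTo (extChartAt I x₀).symm C U

/-- The box is a ball intersected with the range of the model, which is convex with dense interior.
Hence it has unique derivatives up to the corners and lies in the closure of its interior, as the
symmetry of second derivatives requires. -/
theorem exists_isChartBox (I : ModelWithCorners ℝ E H) (hU : IsOpen U) {x₀ : M} (hx₀ : x₀ ∈ U) :
    ∃ C, IsChartBox I U x₀ C := by
  have h1 : (extChartAt I x₀).target ∩ (extChartAt I x₀).symm ⁻¹' U ∈
      𝓝[range I] (extChartAt I x₀ x₀) := by
    refine inter_mem (extChartAt_target_mem_nhdsWithin x₀) (mem_nhdsWithin_of_mem_nhds ?_)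
    refine (continuousAt_extChartAt_symm x₀).preimage_mem_nhds ?_
    rw [extChartAt_to_inv]
    exact hU.mem_nhds hx₀
  obtain ⟨r, hr, hr'⟩ := Metric.mem_nhdsWithin_iff.1 h1
  set y₀ := extChartAt I x₀ x₀
  have hy₀ : y₀ ∈ range I := mem_range_self _
  have hconv : Convex ℝ (Metric.ball y₀ r ∩ range I) := (convex_ball _ _).inter I.convex_range
  have hint : (interior (Metric.ball y₀ r ∩ range I)).Nonempty := by
    rw [interior_inter, Metric.isOpen_ball.interior_eq]
    exact mem_closure_iff.1 (I.range_subset_closure_interior hy₀) _ Metric.isOpen_ball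
      (Metric.mem_ball_self hr)
  refine ⟨Metric.ball y₀ r ∩ range I, hconv, uniqueDiffOn_convex hconv hint, ?_,
    ⟨Metric.mem_ball_self hr, hy₀⟩, ?_, fun y hy => (hr' hy).1,
    fun y hy => (hr' hy).2⟩
  · rw [hconv.closure_interior_eq_closure_of_nonempty_interior hint]
    exact subset_closure
  · exact inter_mem (mem_nhdsWithin_of_mem_nhds (Metric.ball_mem_nhds _ hr)) self_mem_nhdsWithin

variable [IsManifold I ∞ M]

theorem IsChartBox.contDiffOn {x₀ : M} {C : Set E} (hC : IsChartBox I U x₀ C) {h : ℝ × M → ℝ}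
    (hh : ContMDiffOn (𝓘(ℝ, ℝ).prod I) 𝓘(ℝ, ℝ) ∞ h (Icc 0 T ×ˢ U)) :
    ContDiffOn ℝ ∞ (fun p : ℝ × E => h (p.1, (extChartAt I x₀).symm p.2)) (Icc 0 T ×ˢ C) := by
  rw [← contMDiffOn_iff_contDiffOn]
  exact hh.comp (contDiff_fst.contMDiff.contMDiffOn.prodMk (((contMDiffOn_extChartAt_symm x₀).mono
    hC.subset_target).comp contDiff_snd.contMDiff.contMDiffOn fun p hp => hp.2))
    fun p hp => ⟨hp.1, hC.mapsTo hp.2⟩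

theorem IsChartBox.contMDiffWithinAt {x₀ : M} {C : Set E} (hC : IsChartBox I U x₀ C)
    {h : ℝ × M → ℝ}
    (hh : ContDiffOn ℝ ∞ (fun p : ℝ × E => h (p.1, (extChartAt I x₀).symm p.2)) (Icc 0 T ×ˢ C))
    {t : ℝ} (ht : t ∈ Icc 0 T) :
    ContMDiffWithinAt (𝓘(ℝ, ℝ).prod I) 𝓘(ℝ, ℝ) ∞ h (Icc 0 T ×ˢ U) (t, x₀) := by
  rw [← contMDiffOn_iff_contDiffOn] at hh
  set W : Set M := (extChartAt I x₀).source ∩ extChartAt I x₀ ⁻¹' C with hW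
  have hWn : W ∈ 𝓝 x₀ := by
    refine inter_mem (extChartAt_source_mem_nhds x₀) ?_
    rw [← mem_map, map_extChartAt_nhds]
    exact hC.mem_nhdsWithin
  have h1 : ContMDiffOn (𝓘(ℝ, ℝ).prod I) 𝓘(ℝ, ℝ) ∞
      (fun p : ℝ × M => h (p.1, (extChartAt I x₀).symm (extChartAt I x₀ p.2))) (Icc 0 T ×ˢ W) := by
    refine hh.comp (g := fun p : ℝ × E => h (p.1, (extChartAt I x₀).symm p.2))
      (f := fun p : ℝ × M => (p.1, extChartAt I x₀ p.2)) (contMDiffOn_fst.prodMk_space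
      (((contMDiffOn_extChartAt (x := x₀)).mono ?_).comp contMDiffOn_snd fun p hp => hp.2))
      fun p hp => ⟨hp.1, hp.2.2⟩
    rw [← extChartAt_source I]
    exact inter_subset_left
  have h2 : ContMDiffOn (𝓘(ℝ, ℝ).prod I) 𝓘(ℝ, ℝ) ∞ h (Icc 0 T ×ˢ W) :=
    h1.congr fun p hp => by rw [(extChartAt I x₀).left_inv hp.2.1]
  refine (h2 (t, x₀) ⟨ht, mem_of_mem_nhds hWn⟩).mono_of_mem_nhdsWithin ?_
  rw [nhdsWithin_prod_eq]
  exact prod_mem_prod self_mem_nhdsWithin (mem_nhdsWithin_of_mem_nhds hWn)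

omit [IsManifold I ∞ M] in
theorem contDiffOn_time {h : ℝ × M → ℝ}
    (hh : ContMDiffOn (𝓘(ℝ, ℝ).prod I) 𝓘(ℝ, ℝ) ∞ h (Icc 0 T ×ˢ U)) {x : M} (hx : x ∈ U) :
    ContDiffOn ℝ ∞ (fun t => h (t, x)) (Icc 0 T) := by
  rw [← contMDiffOn_iff_contDiffOn]
  exact hh.comp (contMDiffOn_id.prodMk contMDiffOn_const) fun t ht => ⟨ht, hx⟩

omit [IsManifold I ∞ M] in
theorem contMDiffOn_space {h : ℝ × M → ℝ}
    (hh : ContMDiffOn (𝓘(ℝ, ℝ).prod I) 𝓘(ℝ, ℝ) ∞ h (Icc 0 T ×ˢ U)) {t : ℝ} (ht : t ∈ Icc 0 T) :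
    ContMDiffOn I 𝓘(ℝ, ℝ) ∞ (fun x => h (t, x)) U :=
  hh.comp (contMDiffOn_const.prodMk contMDiffOn_id) fun _ hx => ⟨ht, hx⟩

omit [IsManifold I ∞ M] in
theorem hasDerivWithinAt_time {h : ℝ × M → ℝ}
    (hh : ContMDiffOn (𝓘(ℝ, ℝ).prod I) 𝓘(ℝ, ℝ) ∞ h (Icc 0 T ×ˢ U)) {x : M} (hx : x ∈ U)
    {t : ℝ} (ht : t ∈ Icc 0 T) :
    HasDerivWithinAt (fun s => h (s, x)) (derivWithin (fun s => h (s, x)) (Icc 0 T) t)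
      (Icc 0 T) t :=
  (((contDiffOn_time hh hx).differentiableOn (by simp)) t ht).hasDerivWithinAt

omit [IsManifold I ∞ M] in
theorem mdifferentiableAt_space {h : ℝ × M → ℝ}
    (hh : ContMDiffOn (𝓘(ℝ, ℝ).prod I) 𝓘(ℝ, ℝ) ∞ h (Icc 0 T ×ˢ U)) (hU : IsOpen U)
    {x : M} (hx : x ∈ U) {t : ℝ} (ht : t ∈ Icc 0 T) :
    MDifferentiableAt I 𝓘(ℝ, ℝ) (fun x => h (t, x)) x :=
  ((contMDiffOn_space hh ht).contMDiffAt (hU.mem_nhds hx)).mdifferentiableAt (by simp)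

theorem hasDerivWithinAt_slice {C : Set E} {g : ℝ × E → ℝ}
    (hg : DifferentiableOn ℝ g (Icc 0 T ×ˢ C)) {t : ℝ} (ht : t ∈ Icc 0 T) {y : E} (hy : y ∈ C) :
    HasDerivWithinAt (fun s => g (s, y)) (fderivWithin ℝ g (Icc 0 T ×ˢ C) (t, y) (1, 0))
      (Icc 0 T) t := by
  have h1 : HasDerivWithinAt (fun s : ℝ => (s, y)) ((1 : ℝ), (0 : E)) (Icc 0 T) t :=
    (hasDerivWithinAt_id t _).prodMk (hasDerivWithinAt_const t _ y)
  have h2 : MapsTo (fun s : ℝ => (s, y)) (Icc 0 T) (Icc 0 T ×ˢ C) := fun s hs => ⟨hs, hy⟩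
  exact (hg (t, y) ⟨ht, hy⟩).hasFDerivWithinAt.comp_hasDerivWithinAt t h1 h2

theorem derivWithin_slice (hT : 0 < T) {C : Set E} {g : ℝ × E → ℝ}
    (hg : DifferentiableOn ℝ g (Icc 0 T ×ˢ C)) {t : ℝ} (ht : t ∈ Icc 0 T) {y : E} (hy : y ∈ C) :
    derivWithin (fun s => g (s, y)) (Icc 0 T) t =
      fderivWithin ℝ g (Icc 0 T ×ˢ C) (t, y) (1, 0) :=
  (hasDerivWithinAt_slice hg ht hy).derivWithin (uniqueDiffOn_Icc hT t ht)

/-- The time derivative of a smooth function is smooth. -/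
theorem contMDiffOn_derivWithin_time (hT : 0 < T) (hU : IsOpen U) {h : ℝ × M → ℝ}
    (hh : ContMDiffOn (𝓘(ℝ, ℝ).prod I) 𝓘(ℝ, ℝ) ∞ h (Icc 0 T ×ˢ U)) :
    ContMDiffOn (𝓘(ℝ, ℝ).prod I) 𝓘(ℝ, ℝ) ∞
      (fun p => derivWithin (fun s => h (s, p.2)) (Icc 0 T) p.1) (Icc 0 T ×ˢ U) := by
  rintro ⟨t, x₀⟩ ⟨ht, hx₀⟩
  obtain ⟨C, hC⟩ := exists_isChartBox I hU hx₀
  have hg := hC.contDiffOn hh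
  refine hC.contMDiffWithinAt (ContDiffOn.congr (f := fun p =>
    fderivWithin ℝ (fun p : ℝ × E => h (p.1, (extChartAt I x₀).symm p.2)) (Icc 0 T ×ˢ C) p (1, 0))
    ?_ ?_) ht
  · exact (hg.fderivWithin ((uniqueDiffOn_Icc hT).prod hC.uniqueDiffOn) (by simp)).clm_apply
      contDiffOn_const
  · rintro ⟨s, y⟩ ⟨hs, hy⟩
    exact derivWithin_slice (g := fun p : ℝ × E => h (p.1, (extChartAt I x₀).symm p.2)) hT
      (hg.differentiableOn (by simp)) hs hy

/-- This is confined to the centre of the box because `mfderiv` at `x₀` is computed in the chart at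
`x₀`. -/
theorem IsChartBox.mfderiv_eq (hU : IsOpen U) {x₀ : M} (hx₀ : x₀ ∈ U) {C : Set E}
    (hC : IsChartBox I U x₀ C) {h : ℝ × M → ℝ}
    (hh : ContMDiffOn (𝓘(ℝ, ℝ).prod I) 𝓘(ℝ, ℝ) ∞ h (Icc 0 T ×ˢ U)) {t : ℝ} (ht : t ∈ Icc 0 T)
    (v : E) :
    mfderiv I 𝓘(ℝ, ℝ) (fun y => h (t, y)) x₀ v =
      fderivWithin ℝ (fun p : ℝ × E => h (p.1, (extChartAt I x₀).symm p.2)) (Icc 0 T ×ˢ C)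
        (t, extChartAt I x₀ x₀) (0, v) := by
  have hd := (hC.contDiffOn hh).differentiableOn (by simp)
  have h1 := hasFDerivWithinAt_param hd ht hC.mem
  have h2 : HasFDerivWithinAt (writtenInExtChartAt I 𝓘(ℝ, ℝ) x₀ fun y => h (t, y))
      (paramDeriv T C (fun p : ℝ × E => h (p.1, (extChartAt I x₀).symm p.2))
        (t, extChartAt I x₀ x₀)) (range I) (extChartAt I x₀ x₀) :=
    h1.mono_of_mem_nhdsWithin hC.mem_nhdsWithin
  have h3 := h2.fderivWithin (I.uniqueDiffOn _ (mem_range_self _))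
  rw [(mdifferentiableAt_space hh hU hx₀ ht).mfderiv]
  change (fderivWithin ℝ (writtenInExtChartAt I 𝓘(ℝ, ℝ) x₀ fun y => h (t, y)) (range I)
    (extChartAt I x₀ x₀)) v = _
  rw [h3]
  rfl

/-- Mixed derivatives of a smooth function commute. -/
theorem hasDerivWithinAt_mfderiv_apply (hT : 0 < T) (hU : IsOpen U) {x₀ : M} (hx₀ : x₀ ∈ U)
    {h : ℝ × M → ℝ} (hh : ContMDiffOn (𝓘(ℝ, ℝ).prod I) 𝓘(ℝ, ℝ) ∞ h (Icc 0 T ×ˢ U))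
    {t : ℝ} (ht : t ∈ Icc 0 T) (v : E) :
    HasDerivWithinAt (fun s => (mfderiv I 𝓘(ℝ, ℝ) (fun y => h (s, y)) x₀ v : ℝ))
      (mfderiv I 𝓘(ℝ, ℝ) (fun y => derivWithin (fun s => h (s, y)) (Icc 0 T) t) x₀ v)
      (Icc 0 T) t := by
  obtain ⟨C, hC⟩ := exists_isChartBox I hU hx₀
  have hg := hC.contDiffOn hh
  set g : ℝ × E → ℝ := fun p => h (p.1, (extChartAt I x₀).symm p.2) with hgdef
  set S := Icc 0 T ×ˢ C with hS
  set y₀ := extChartAt I x₀ x₀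
  have hSu : UniqueDiffOn ℝ S := (uniqueDiffOn_Icc hT).prod hC.uniqueDiffOn
  have hty : (t, y₀) ∈ S := ⟨ht, hC.mem⟩
  have hDg : ContDiffOn ℝ ∞ (fderivWithin ℝ g S) S := hg.fderivWithin hSu (by simp)
  have hDgd := (hDg.differentiableOn (by simp) (t, y₀) hty).hasFDerivWithinAt
  have hcl : (t, y₀) ∈ closure (interior S) := by
    rw [hS, interior_prod_eq, closure_prod_eq, interior_Icc, closure_Ioo hT.ne]
    exact ⟨ht, hC.subset_closure_interior hC.mem⟩
  -- Second derivatives are symmetric also at the faces of the box and at `t = 0`, `t = T`, as these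
  -- points are limits of interior points.
  have hsymm := ((hg (t, y₀) hty).isSymmSndFDerivWithinAt
    (by rw [minSmoothness_of_isRCLikeNormedField]; exact WithTop.coe_le_coe.2 le_top)
    hSu hcl hty) (1, 0) (0, v)
  have h1 : HasDerivWithinAt (fun s => fderivWithin ℝ g S (s, y₀) (0, v))
      (fderivWithin ℝ (fderivWithin ℝ g S) S (t, y₀) (1, 0) (0, v)) (Icc 0 T) t := by
    have h2 : HasDerivWithinAt (fun s : ℝ => (s, y₀)) ((1 : ℝ), (0 : E)) (Icc 0 T) t :=
      (hasDerivWithinAt_id t _).prodMk (hasDerivWithinAt_const t _ y₀)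
    have h2' : MapsTo (fun s : ℝ => (s, y₀)) (Icc 0 T) S := fun s hs => ⟨hs, hC.mem⟩
    have h3 := hDgd.comp_hasDerivWithinAt t h2 h2'
    exact (ContinuousLinearMap.apply ℝ ℝ ((0 : ℝ), v)).hasFDerivAt.comp_hasDerivWithinAt t h3
  rw [hsymm] at h1
  refine (h1.congr_of_mem (fun s hs => hC.mfderiv_eq hU hx₀ hh hs v) ht).congr_deriv ?_
  have h4 := hC.mfderiv_eq hU hx₀ (contMDiffOn_derivWithin_time hT hU hh) ht v
  refine Eq.trans ?_ h4.symm
  have h5 : EqOn (fun p : ℝ × E => derivWithin (fun s => h (s, (extChartAt I x₀).symm p.2))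
      (Icc 0 T) p.1) (fun p => fderivWithin ℝ g S p (1, 0)) S := by
    rintro ⟨s, y⟩ ⟨hs, hy⟩
    exact derivWithin_slice (g := g) hT (hg.differentiableOn (by simp)) hs hy
  have h6 : HasFDerivWithinAt (fun p => fderivWithin ℝ g S p (1, 0))
      ((ContinuousLinearMap.apply ℝ ℝ ((1 : ℝ), (0 : E))).comp
        (fderivWithin ℝ (fderivWithin ℝ g S) S (t, y₀))) S (t, y₀) :=
    (ContinuousLinearMap.apply ℝ ℝ ((1 : ℝ), (0 : E))).hasFDerivAt.comp_hasFDerivWithinAt _ hDgd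
  have h7 := (h6.congr h5 (h5 hty)).fderivWithin (hSu _ hty)
  exact (DFunLike.congr_fun h7 ((0 : ℝ), v)).symm

/-- The derivative of a smooth function along a smooth vector field on `M` is smooth. -/
theorem contMDiffOn_mfderiv_apply (hU : IsOpen U) {h : ℝ × M → ℝ}
    (hh : ContMDiffOn (𝓘(ℝ, ℝ).prod I) 𝓘(ℝ, ℝ) ∞ h (Icc 0 T ×ˢ U))
    {V : ∀ x : M, TangentSpace I x}
    (hV : ContMDiff I I.tangent ∞ (fun x => (⟨x, V x⟩ : TangentBundle I M))) :
    ContMDiffOn (𝓘(ℝ, ℝ).prod I) 𝓘(ℝ, ℝ) ∞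
      (fun p : ℝ × M => (mfderiv I 𝓘(ℝ, ℝ) (fun y => h (p.1, y)) p.2 (V p.2) : ℝ))
      (Icc 0 T ×ˢ U) := by
  have : IsManifold I 1 M := IsManifold.of_le (n := ∞) (by simp)
  rintro p₀ hp₀
  have hm : MapsTo (fun q : (ℝ × M) × M => (q.1.1, q.2)) ((Icc 0 T ×ˢ U) ×ˢ U) (Icc 0 T ×ˢ U) :=
    fun q hq => ⟨hq.1.1, hq.2⟩
  -- `h` is read as a family of functions of `y` with parameter `p`, so that smoothness of the
  -- derivative in `y` with respect to the parameter applies.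
  have hf : ContMDiffWithinAt ((𝓘(ℝ, ℝ).prod I).prod I) 𝓘(ℝ, ℝ) ∞
      (Function.uncurry fun (p : ℝ × M) (y : M) => h (p.1, y)) ((Icc 0 T ×ˢ U) ×ˢ U)
      (p₀, p₀.2) :=
    (hh p₀ hp₀).comp (p₀, p₀.2)
      ((contMDiffWithinAt_fst.comp (I' := 𝓘(ℝ, ℝ).prod I) (t := univ) _ contMDiffWithinAt_fst
        (mapsTo_univ _ _)).prodMk contMDiffWithinAt_snd) hm
  have hφ := ContMDiffWithinAt.mfderivWithin (m := ∞) hf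
    (contMDiffWithinAt_snd (s := Icc 0 T ×ˢ U)) hp₀
    (fun p hp => hp.2) (by simp) hU.uniqueMDiffOn
  have hv : ContMDiffWithinAt (𝓘(ℝ, ℝ).prod I) I.tangent ∞
      (fun p : ℝ × M => (⟨p.2, V p.2⟩ : TangentBundle I M)) (Icc 0 T ×ˢ U) p₀ :=
    (hV.contMDiffAt (x := p₀.2)).comp_contMDiffWithinAt p₀ contMDiffWithinAt_snd
  have hb : ContMDiffWithinAt (𝓘(ℝ, ℝ).prod I) 𝓘(ℝ, ℝ) ∞ (fun p : ℝ × M => h (p.1, p.2))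
      (Icc 0 T ×ˢ U) p₀ := hh p₀ hp₀
  have key := ContMDiffWithinAt.clm_apply_of_inCoordinates hφ hv hb
  have key2 := ((contMDiff_snd_tangentBundle_modelSpace ℝ 𝓘(ℝ, ℝ) (n := ∞)).contMDiffAt).comp_contMDiffWithinAt
    p₀ key
  refine key2.congr_of_mem (fun p hp => ?_) hp₀
  simp only [Function.comp]
  rw [mfderivWithin_of_isOpen hU hp.2]

/-! ### Linear systems on `[0,T] × U` -/

/-- The family `u` solves the linear system `∂_t u = l u + f`, `u|_{t=0} = 0`, on `[0,T] × U`. -/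
def SolvesSystem {X ι : Type*} [Fintype ι] (T : ℝ) (U : Set X) (l : ι → ι → ℝ × X → ℝ)
    (f u : ι → ℝ × X → ℝ) : Prop :=
  ∀ x ∈ U, ∀ i, u i (0, x) = 0 ∧ ∀ t ∈ Icc 0 T,
    HasDerivWithinAt (fun s => u i (s, x)) (∑ j, l i j (t, x) * u j (t, x) + f i (t, x)) (Icc 0 T) t

/-- The endomorphism of `ι → ℝ` with the given matrix. -/
def matrixCLM {ι : Type*} [Fintype ι] [DecidableEq ι] (A : ι → ι → ℝ) : (ι → ℝ) →L[ℝ] (ι → ℝ) :=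
  ∑ i, ∑ j, A i j • (ContinuousLinearMap.single ℝ (fun _ : ι => ℝ) i).comp
    (ContinuousLinearMap.proj j)

theorem matrixCLM_apply {ι : Type*} [Fintype ι] [DecidableEq ι] (A : ι → ι → ℝ) (v : ι → ℝ)
    (i : ι) : matrixCLM A v i = ∑ j, A i j * v j := by
  simp [matrixCLM, Finset.sum_apply, Pi.single_apply]

theorem contDiffOn_matrixCLM {ι X : Type*} [Fintype ι] [DecidableEq ι] [NormedAddCommGroup X]
    [NormedSpace ℝ X] {k : WithTop ℕ∞} {s : Set X} {A : ι → ι → X → ℝ}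
    (hA : ∀ i j, ContDiffOn ℝ k (A i j) s) :
    ContDiffOn ℝ k (fun p => matrixCLM fun i j => A i j p) s :=
  ContDiffOn.sum fun i _ => ContDiffOn.sum fun j _ => (hA i j).smul contDiffOn_const

theorem continuousOn_matrixCLM {ι X : Type*} [Fintype ι] [DecidableEq ι] [TopologicalSpace X]
    {s : Set X} {A : ι → ι → X → ℝ} (hA : ∀ i j, ContinuousOn (A i j) s) :
    ContinuousOn (fun p => matrixCLM fun i j => A i j p) s :=
  continuousOn_finsetSum _ fun i _ => continuousOn_finsetSum _ fun j _ =>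
    (hA i j).smul continuousOn_const

section System

variable {ι : Type} [Fintype ι] {X : Type*}

theorem hasDerivWithinAt_matrixCLM [DecidableEq ι] {A : ι → ι → ℝ} {b : ι → ℝ} {v : ℝ → ι → ℝ}
    {s : Set ℝ} {t : ℝ} :
    HasDerivWithinAt v (matrixCLM A (v t) + b) s t ↔
      ∀ i, HasDerivWithinAt (fun s => v s i) (∑ j, A i j * v t j + b i) s t := by
  rw [hasDerivWithinAt_pi]
  simp [matrixCLM_apply]

/-- The system is solved separately for each `x`, with no regularity in `x`; uniqueness makes these
choices harmless and regularity is proved afterwards. -/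
theorem exists_solvesSystem (hT : 0 < T) {U : Set X} {l : ι → ι → ℝ × X → ℝ} {f : ι → ℝ × X → ℝ}
    (hl : ∀ x ∈ U, ∀ i j, ContinuousOn (fun t => l i j (t, x)) (Icc 0 T))
    (hf : ∀ x ∈ U, ∀ i, ContinuousOn (fun t => f i (t, x)) (Icc 0 T)) :
    ∃ u, SolvesSystem T U l f u := by
  classical
  have hex : ∀ x : X, ∃ w : ℝ → ι → ℝ, x ∈ U → w 0 = 0 ∧ ∀ t ∈ Icc 0 T,
      HasDerivWithinAt w (matrixCLM (fun i j => l i j (t, x)) (w t) + fun i => f i (t, x))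
        (Icc 0 T) t := by
    intro x
    by_cases hx : x ∈ U
    · obtain ⟨w, hw⟩ := exists_linear_ode hT.le (continuousOn_matrixCLM (hl x hx))
        (continuousOn_pi.2 (hf x hx))
      exact ⟨w, fun _ => hw⟩
    · exact ⟨0, fun h => absurd h hx⟩
  choose w hw using hex
  refine ⟨fun i p => w p.2 p.1 i, fun x hx i => ⟨congrFun (hw x hx).1 i, fun t ht => ?_⟩⟩
  exact hasDerivWithinAt_matrixCLM.1 ((hw x hx).2 t ht) i

theorem SolvesSystem.eqOn {U : Set X} {l : ι → ι → ℝ × X → ℝ} {f u v : ι → ℝ × X → ℝ}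
    (hl : ∀ x ∈ U, ∀ i j, ContinuousOn (fun t => l i j (t, x)) (Icc 0 T))
    (hu : SolvesSystem T U l f u) (hv : SolvesSystem T U l f v) (i : ι) :
    EqOn (u i) (v i) (Icc 0 T ×ˢ U) := by
  classical
  rintro ⟨t, x⟩ ⟨ht, hx⟩
  have := eqOn_of_linear_ode (T := T) (u := fun t i => u i (t, x)) (v := fun t i => v i (t, x))
    (L := fun t => matrixCLM fun i j => l i j (t, x)) (f := fun t i => f i (t, x))
    (by ext i; simp only [(hu x hx i).1, (hv x hx i).1])
    (continuousOn_matrixCLM (hl x hx))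
    (fun t ht => (hasDerivWithinAt_matrixCLM (v := fun t i => u i (t, x))).2
      fun i => (hu x hx i).2 t ht)
    (fun t ht => (hasDerivWithinAt_matrixCLM (v := fun t i => v i (t, x))).2
      fun i => (hv x hx i).2 t ht) ht
  exact congrFun this i

/-- The Grönwall constant depends only on `T` and on the bounds of the data, not on `x`. -/
theorem SolvesSystem.bounded {U : Set X} {l : ι → ι → ℝ × X → ℝ} {f u : ι → ℝ × X → ℝ}
    (hl : ∀ i j, ∃ C, ∀ p ∈ Icc 0 T ×ˢ U, |l i j p| ≤ C)
    (hf : ∀ i, ∃ C, ∀ p ∈ Icc 0 T ×ˢ U, |f i p| ≤ C)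
    (hu : SolvesSystem T U l f u) (i : ι) :
    ∃ C, ∀ p ∈ Icc 0 T ×ˢ U, |u i p| ≤ C := by
  classical
  choose Cl hCl using hl
  choose Cf hCf using hf
  set e : ι → ι → (ι → ℝ) →L[ℝ] (ι → ℝ) := fun i j =>
    (ContinuousLinearMap.single ℝ (fun _ : ι => ℝ) i).comp (ContinuousLinearMap.proj j) with he
  set M := ∑ i, ∑ j, |Cl i j| * ‖e i j‖
  refine ⟨(∑ i, |Cf i|) * Real.exp ((M + 1) * T), ?_⟩
  rintro ⟨t, x⟩ ⟨ht, hx⟩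
  have := norm_le_of_linear_ode (T := T) (M := M) (ε := ∑ i, |Cf i|) (u := fun t i => u i (t, x))
    (L := fun t => matrixCLM fun i j => l i j (t, x)) (f := fun t i => f i (t, x))
    (by positivity) (by ext i; exact (hu x hx i).1)
    (fun t ht => (hasDerivWithinAt_matrixCLM (v := fun t i => u i (t, x))).2
      fun i => (hu x hx i).2 t ht)
    (fun t ht => ?_) (fun t ht => ?_) t ht
  · exact (norm_le_pi_norm (fun i => u i (t, x)) i).trans this
  · refine (norm_sum_le _ _).trans (Finset.sum_le_sum fun i _ => (norm_sum_le _ _).trans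
      (Finset.sum_le_sum fun j _ => ?_))
    rw [norm_smul]
    exact mul_le_mul_of_nonneg_right ((hCl i j (t, x) ⟨ht, hx⟩).trans (le_abs_self _))
      (norm_nonneg _)
  · rw [pi_norm_le_iff_of_nonneg (by positivity)]
    exact fun i => ((hCf i (t, x) ⟨ht, hx⟩).trans (le_abs_self _)).trans
      (Finset.single_le_sum (f := fun i => |Cf i|) (fun _ _ => abs_nonneg _) (Finset.mem_univ i))

/-- Solutions of smooth linear systems are smooth. -/
theorem SolvesSystem.contMDiffOn (hT : 0 < T) (hU : IsOpen U) {l : ι → ι → ℝ × M → ℝ}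
    {f u : ι → ℝ × M → ℝ}
    (hl : ∀ i j, ContMDiffOn (𝓘(ℝ, ℝ).prod I) 𝓘(ℝ, ℝ) ∞ (l i j) (Icc 0 T ×ˢ U))
    (hf : ∀ i, ContMDiffOn (𝓘(ℝ, ℝ).prod I) 𝓘(ℝ, ℝ) ∞ (f i) (Icc 0 T ×ˢ U))
    (hu : SolvesSystem T U l f u) (i : ι) :
    ContMDiffOn (𝓘(ℝ, ℝ).prod I) 𝓘(ℝ, ℝ) ∞ (u i) (Icc 0 T ×ˢ U) := by
  classical
  rintro ⟨t, x₀⟩ ⟨ht, hx₀⟩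
  obtain ⟨C, hC⟩ := exists_isChartBox I hU hx₀
  refine hC.contMDiffWithinAt (contDiffOn_infty.2 fun k => ?_) ht
  have hL := contDiffOn_matrixCLM fun i j => hC.contDiffOn (hl i j)
  have hg := contDiffOn_pi.2 fun i => hC.contDiffOn (hf i)
  have key := contDiffOn_of_linear_ode hT hC.convex hC.uniqueDiffOn k
    (hL.of_le (by exact_mod_cast le_top)) (hg.of_le (by exact_mod_cast le_top))
    (u := fun p i => u i (p.1, (extChartAt I x₀).symm p.2))
    (fun y hy => by ext i; exact (hu _ (hC.mapsTo hy) i).1)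
    (fun y hy t ht => (hasDerivWithinAt_matrixCLM
      (v := fun s i => u i (s, (extChartAt I x₀).symm y))).2
      fun i => (hu _ (hC.mapsTo hy) i).2 t ht)
  exact contDiffOn_pi.1 key i

end System

end SmoothTime

/-! ### Conormal functions on `[0,T] × M` -/

section Conormal

open Filter Topology

variable {n : ℕ} {M : Type*} [TopologicalSpace M] [ChartedSpace (EuclideanQuadrant n) M]

/-- Hypersurfaces are closed, being closures of components; finiteness of `S` makes their union
closed. -/
theorem isOpen_awayFrom {S : Set (BoundaryHypersurface n M)} (hS : S.Finite) :
    IsOpen (awayFrom S) := by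
  have : awayFrom S = ⋂ H ∈ S, (H.1)ᶜ := by ext; simp [awayFrom]
  rw [this]
  refine hS.isOpen_biInter fun H _ => IsClosed.isOpen_compl (self := ?_)
  obtain ⟨x, _, hx⟩ := H.2
  rw [hx]
  exact isClosed_closure

theorem awayFrom_anti {S S' : Set (BoundaryHypersurface n M)} (h : S' ⊆ S) :
    awayFrom S ⊆ awayFrom S' := fun _ hx H hH => hx H (h hH)

theorem awayFrom_empty : awayFrom (∅ : Set (BoundaryHypersurface n M)) = univ := by
  ext; simp [awayFrom]

/-- Smoothness on `[0,T] × (M \ ⋃ S)`. -/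
def SmoothAway (T : ℝ) (S : Set (BoundaryHypersurface n M)) (f : ℝ × M → ℝ) : Prop :=
  ContMDiffOn (𝓘(ℝ, ℝ).prod (modelWithCornersEuclideanQuadrant n)) 𝓘(ℝ, ℝ) ∞ f
    (Icc 0 T ×ˢ awayFrom S)

variable {T : ℝ} {S S' : Set (BoundaryHypersurface n M)} {f g : ℝ × M → ℝ}

theorem SmoothAway.anti (h : S' ⊆ S) (hf : SmoothAway T S' f) : SmoothAway T S f :=
  ContMDiffOn.mono hf (prod_mono_right (awayFrom_anti h))

theorem SmoothAway.congr (hf : SmoothAway T S f) (h : EqOn g f (Icc 0 T ×ˢ awayFrom S)) :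
    SmoothAway T S g := ContMDiffOn.congr hf h

theorem SmoothAway.add (hf : SmoothAway T S f) (hg : SmoothAway T S g) :
    SmoothAway T S (fun p => f p + g p) := ContMDiffOn.add hf hg

theorem SmoothAway.mul (hf : SmoothAway T S f) (hg : SmoothAway T S g) :
    SmoothAway T S (fun p => f p * g p) := ContMDiffOn.mul hf hg

theorem SmoothAway.const (c : ℝ) : SmoothAway T S (fun _ => c) := contMDiffOn_const

theorem SmoothAway.sum {ι : Type*} (s : Finset ι) {f : ι → ℝ × M → ℝ}
    (hf : ∀ i ∈ s, SmoothAway T S (f i)) : SmoothAway T S (fun p => ∑ i ∈ s, f i p) := by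
  classical
  induction s using Finset.induction_on with
  | empty => simpa using SmoothAway.const 0
  | insert a s ha ih =>
    simp only [Finset.sum_insert ha]
    exact (hf a (Finset.mem_insert_self a s)).add
      (ih fun i hi => hf i (Finset.mem_insert_of_mem hi))

variable [IsManifold (modelWithCornersEuclideanQuadrant n) ∞ M]
  {ρ : BoundaryHypersurface n M → M → ℝ}

theorem bVectorFields_anti (h : S' ⊆ S) : bVectorFields ρ S ⊆ bVectorFields ρ S' :=
  fun _ hV => ⟨hV.1, fun H hH => hV.2 H (h hH)⟩

theorem timeBOperators_anti (h : S' ⊆ S) : timeBOperators T ρ S ⊆ timeBOperators T ρ S' := by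
  rintro P (rfl | ⟨V, hV, rfl⟩)
  · exact Or.inl rfl
  · exact Or.inr ⟨V, bVectorFields_anti h hV, rfl⟩

/-! ### Differentiation rules for the operators that test conormality -/

section Operators

variable {P : (ℝ × M → ℝ) → ℝ × M → ℝ}

theorem smoothAway_of_mem (hT : 0 < T) (hS : S.Finite) (hP : P ∈ timeBOperators T ρ S)
    (hf : SmoothAway T S f) : SmoothAway T S (P f) := by
  rcases hP with rfl | ⟨V, hV, rfl⟩
  · exact contMDiffOn_derivWithin_time hT (isOpen_awayFrom hS) hf
  · exact contMDiffOn_mfderiv_apply (isOpen_awayFrom hS) hf hV.1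

theorem operator_congr (hS : S.Finite) (hP : P ∈ timeBOperators T ρ S)
    (h : EqOn f g (Icc 0 T ×ˢ awayFrom S)) : EqOn (P f) (P g) (Icc 0 T ×ˢ awayFrom S) := by
  rintro ⟨t, x⟩ ⟨ht, hx⟩
  rcases hP with rfl | ⟨V, hV, rfl⟩
  · exact derivWithin_congr (fun s hs => h ⟨hs, hx⟩) (h ⟨ht, hx⟩)
  · have : (fun y => f (t, y)) =ᶠ[𝓝 x] fun y => g (t, y) := by
      filter_upwards [(isOpen_awayFrom hS).mem_nhds hx] with y hy using h ⟨ht, hy⟩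
    simp only [derivAlong]
    rw [this.mfderiv_eq]
    rfl

theorem operator_add (hT : 0 < T) (hS : S.Finite) (hP : P ∈ timeBOperators T ρ S)
    (hf : SmoothAway T S f) (hg : SmoothAway T S g) :
    EqOn (P fun p => f p + g p) (fun p => P f p + P g p) (Icc 0 T ×ˢ awayFrom S) := by
  rintro ⟨t, x⟩ ⟨ht, hx⟩
  rcases hP with rfl | ⟨V, hV, rfl⟩
  · exact ((hasDerivWithinAt_time hf hx ht).add (hasDerivWithinAt_time hg hx ht)).derivWithin
      (uniqueDiffOn_Icc hT t ht)
  · have h1 := (mdifferentiableAt_space hf (isOpen_awayFrom hS) hx ht).hasMFDerivAt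
    have h2 := (mdifferentiableAt_space hg (isOpen_awayFrom hS) hx ht).hasMFDerivAt
    exact DFunLike.congr_fun (h1.add h2).mfderiv (V x)

theorem operator_mul (hT : 0 < T) (hS : S.Finite) (hP : P ∈ timeBOperators T ρ S)
    (hf : SmoothAway T S f) (hg : SmoothAway T S g) :
    EqOn (P fun p => f p * g p) (fun p => P f p * g p + f p * P g p) (Icc 0 T ×ˢ awayFrom S) := by
  rintro ⟨t, x⟩ ⟨ht, hx⟩
  rcases hP with rfl | ⟨V, hV, rfl⟩
  · exact ((hasDerivWithinAt_time hf hx ht).mul (hasDerivWithinAt_time hg hx ht)).derivWithin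
      (uniqueDiffOn_Icc hT t ht)
  · have h1 := (mdifferentiableAt_space hf (isOpen_awayFrom hS) hx ht).hasMFDerivAt
    have h2 := (mdifferentiableAt_space hg (isOpen_awayFrom hS) hx ht).hasMFDerivAt
    refine (DFunLike.congr_fun (h1.mul h2).mfderiv (V x)).trans ?_
    change f (t, x) * derivAlong V (fun y => g (t, y)) x +
      g (t, x) * derivAlong V (fun y => f (t, y)) x = _
    ring

theorem operator_const (hP : P ∈ timeBOperators T ρ S) (c : ℝ) :
    P (fun _ => c) = fun _ => 0 := by
  rcases hP with rfl | ⟨V, hV, rfl⟩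
  · ext p; simp
  · ext p
    simp only [derivAlong, mfderiv_const]
    rfl

theorem operator_sum (hT : 0 < T) (hS : S.Finite) (hP : P ∈ timeBOperators T ρ S) {ι : Type*}
    (s : Finset ι) {f : ι → ℝ × M → ℝ} (hf : ∀ i ∈ s, SmoothAway T S (f i)) :
    EqOn (P fun p => ∑ i ∈ s, f i p) (fun p => ∑ i ∈ s, P (f i) p) (Icc 0 T ×ˢ awayFrom S) := by
  classical
  induction s using Finset.induction_on with
  | empty => exact fun p _ => by simp [operator_const hP 0]
  | insert a s ha ih =>
    simp only [Finset.sum_insert ha]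
    have h1 : ∀ i ∈ s, SmoothAway T S (f i) := fun i hi => hf i (Finset.mem_insert_of_mem hi)
    refine (operator_add hT hS hP (hf a (Finset.mem_insert_self a s))
      (SmoothAway.sum s h1)).trans fun p hp => ?_
    simp only [ih h1 hp]

end Operators

/-- The functions that are smooth and stay bounded under `k` of the operators that
test conormality. -/
def BoundedUpTo (T : ℝ) (ρ : BoundaryHypersurface n M → M → ℝ)
    (S : Set (BoundaryHypersurface n M)) : ℕ → (ℝ × M → ℝ) → Prop
  | 0, f => SmoothAway T S f ∧ ∃ C : ℝ, ∀ p ∈ Icc 0 T ×ˢ awayFrom S, |f p| ≤ C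
  | k + 1, f => BoundedUpTo T ρ S 0 f ∧ ∀ P ∈ timeBOperators T ρ S, BoundedUpTo T ρ S k (P f)

/-- Conormal functions on `[0,T] × M`, for the hypersurfaces in `S`. -/
def ConormalAway (T : ℝ) (ρ : BoundaryHypersurface n M → M → ℝ)
    (S : Set (BoundaryHypersurface n M)) (f : ℝ × M → ℝ) : Prop :=
  ∀ k, BoundedUpTo T ρ S k f

theorem boundedUpTo_zero : BoundedUpTo T ρ S 0 f ↔
    SmoothAway T S f ∧ ∃ C : ℝ, ∀ p ∈ Icc 0 T ×ˢ awayFrom S, |f p| ≤ C := by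
  rw [BoundedUpTo]

theorem boundedUpTo_succ {k : ℕ} : BoundedUpTo T ρ S (k + 1) f ↔
    BoundedUpTo T ρ S 0 f ∧ ∀ P ∈ timeBOperators T ρ S, BoundedUpTo T ρ S k (P f) := by
  conv_lhs => rw [BoundedUpTo]

theorem BoundedUpTo.zero {k : ℕ} (hf : BoundedUpTo T ρ S k f) : BoundedUpTo T ρ S 0 f := by
  cases k with
  | zero => exact hf
  | succ k => exact (boundedUpTo_succ.1 hf).1

theorem BoundedUpTo.smooth {k : ℕ} (hf : BoundedUpTo T ρ S k f) : SmoothAway T S f :=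
  (boundedUpTo_zero.1 hf.zero).1

theorem BoundedUpTo.bound {k : ℕ} (hf : BoundedUpTo T ρ S k f) :
    ∃ C : ℝ, ∀ p ∈ Icc 0 T ×ˢ awayFrom S, |f p| ≤ C :=
  (boundedUpTo_zero.1 hf.zero).2

theorem BoundedUpTo.operator {k : ℕ} (hf : BoundedUpTo T ρ S (k + 1) f)
    {P : (ℝ × M → ℝ) → ℝ × M → ℝ} (hP : P ∈ timeBOperators T ρ S) :
    BoundedUpTo T ρ S k (P f) := (boundedUpTo_succ.1 hf).2 P hP

theorem BoundedUpTo.of_succ {k : ℕ} :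
    ∀ {f : ℝ × M → ℝ}, BoundedUpTo T ρ S (k + 1) f → BoundedUpTo T ρ S k f := by
  induction k with
  | zero => exact fun hf => hf.zero
  | succ k ih => exact fun hf => boundedUpTo_succ.2 ⟨hf.zero, fun P hP => ih (hf.operator hP)⟩

/-- `List.foldr` applies the last operator of a list first, whereas `BoundedUpTo` peels off the
operator applied first; lists are therefore extended at their end. -/
theorem isConormal_iff (hT : 0 < T) (hS : S.Finite) :
    IsConormal (𝓘(ℝ, ℝ).prod (modelWithCornersEuclideanQuadrant n)) (Icc 0 T ×ˢ awayFrom S)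
      (timeBOperators T ρ S) f ↔ ConormalAway T ρ S f := by
  constructor
  · intro h k
    induction k generalizing f with
    | zero => exact boundedUpTo_zero.2 ⟨h.1, by simpa using h.2 [] (by simp)⟩
    | succ k ih =>
      refine boundedUpTo_succ.2 ⟨boundedUpTo_zero.2 ⟨h.1, by simpa using h.2 [] (by simp)⟩,
        fun P hP => ih
        ⟨smoothAway_of_mem hT hS hP h.1, fun L hL => ?_⟩⟩
      have := h.2 (L ++ [P]) (by simpa [or_imp, forall_and] using ⟨hL, hP⟩)
      simpa using this
  · intro h
    refine ⟨(h 0).smooth, fun L => ?_⟩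
    induction L using List.reverseRecOn generalizing f with
    | nil => exact fun _ => by simpa using (h 0).bound
    | append_singleton L P ih =>
      intro hL
      have := ih (f := P f) (fun k => (h (k + 1)).operator (hL P (by simp)))
        (fun Q hQ => hL Q (by simp [hQ]))
      simpa using this

theorem BoundedUpTo.congr (hS : S.Finite) {k : ℕ} (hf : BoundedUpTo T ρ S k f)
    (h : EqOn g f (Icc 0 T ×ˢ awayFrom S)) : BoundedUpTo T ρ S k g := by
  induction k generalizing f g with
  | zero =>
    obtain ⟨C, hC⟩ := hf.bound
    exact boundedUpTo_zero.2 ⟨hf.smooth.congr h, C, fun p hp => by rw [h hp]; exact hC p hp⟩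
  | succ k ih =>
    obtain ⟨C, hC⟩ := hf.bound
    exact boundedUpTo_succ.2 ⟨boundedUpTo_zero.2 ⟨hf.smooth.congr h, C,
      fun p hp => by rw [h hp]; exact hC p hp⟩,
      fun P hP => ih (hf.operator hP) (operator_congr hS hP h)⟩

theorem BoundedUpTo.add (hT : 0 < T) (hS : S.Finite) {k : ℕ} (hf : BoundedUpTo T ρ S k f)
    (hg : BoundedUpTo T ρ S k g) : BoundedUpTo T ρ S k (fun p => f p + g p) := by
  have h0 : ∀ {f g : ℝ × M → ℝ}, BoundedUpTo T ρ S 0 f → BoundedUpTo T ρ S 0 g →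
      BoundedUpTo T ρ S 0 (fun p => f p + g p) := by
    intro f g hf hg
    obtain ⟨C, hC⟩ := hf.bound
    obtain ⟨D, hD⟩ := hg.bound
    exact boundedUpTo_zero.2 ⟨hf.smooth.add hg.smooth, C + D, fun p hp =>
      (abs_add_le _ _).trans (add_le_add (hC p hp) (hD p hp))⟩
  induction k generalizing f g with
  | zero => exact h0 hf hg
  | succ k ih => exact boundedUpTo_succ.2 ⟨h0 hf.zero hg.zero, fun P hP =>
      (ih (hf.operator hP) (hg.operator hP)).congr hS
      (operator_add hT hS hP hf.smooth hg.smooth)⟩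

theorem BoundedUpTo.mul (hT : 0 < T) (hS : S.Finite) {k : ℕ} (hf : BoundedUpTo T ρ S k f)
    (hg : BoundedUpTo T ρ S k g) : BoundedUpTo T ρ S k (fun p => f p * g p) := by
  have h0 : ∀ {f g : ℝ × M → ℝ}, BoundedUpTo T ρ S 0 f → BoundedUpTo T ρ S 0 g →
      BoundedUpTo T ρ S 0 (fun p => f p * g p) := by
    intro f g hf hg
    obtain ⟨C, hC⟩ := hf.bound
    obtain ⟨D, hD⟩ := hg.bound
    refine boundedUpTo_zero.2 ⟨hf.smooth.mul hg.smooth, C * D, fun p hp => ?_⟩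
    rw [abs_mul]
    exact mul_le_mul (hC p hp) (hD p hp) (abs_nonneg _) ((abs_nonneg _).trans (hC p hp))
  induction k generalizing f g with
  | zero => exact h0 hf hg
  | succ k ih => exact boundedUpTo_succ.2 ⟨h0 hf.zero hg.zero, fun P hP =>
      ((ih (hf.operator hP) hg.of_succ).add hT hS (ih hf.of_succ (hg.operator hP))).congr hS
      (operator_mul hT hS hP hf.smooth hg.smooth)⟩

theorem BoundedUpTo.const (c : ℝ) (k : ℕ) :
    BoundedUpTo T ρ S k (fun _ => c) := by
  induction k generalizing c with
  | zero => exact boundedUpTo_zero.2 ⟨SmoothAway.const c, |c|, fun p _ => le_rfl⟩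
  | succ k ih =>
    refine boundedUpTo_succ.2 ⟨boundedUpTo_zero.2 ⟨SmoothAway.const c, |c|, fun p _ => le_rfl⟩,
      fun P hP => ?_⟩
    rw [operator_const hP]
    exact ih 0

theorem BoundedUpTo.sum (hT : 0 < T) (hS : S.Finite) {k : ℕ} {ι : Type*} (s : Finset ι)
    {f : ι → ℝ × M → ℝ} (hf : ∀ i ∈ s, BoundedUpTo T ρ S k (f i)) :
    BoundedUpTo T ρ S k (fun p => ∑ i ∈ s, f i p) := by
  classical
  induction s using Finset.induction_on with
  | empty => simpa using BoundedUpTo.const 0 k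
  | insert a s ha ih =>
    simp only [Finset.sum_insert ha]
    exact (hf a (Finset.mem_insert_self a s)).add hT hS
      (ih fun i hi => hf i (Finset.mem_insert_of_mem hi))

theorem BoundedUpTo.anti {k : ℕ} (h : S' ⊆ S) (hf : BoundedUpTo T ρ S' k f) :
    BoundedUpTo T ρ S k f := by
  induction k generalizing f with
  | zero =>
    obtain ⟨C, hC⟩ := hf.bound
    exact boundedUpTo_zero.2 ⟨hf.smooth.anti h, C, fun p hp =>
      hC p (prod_mono_right (awayFrom_anti h) hp)⟩
  | succ k ih =>
    obtain ⟨C, hC⟩ := hf.bound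
    exact boundedUpTo_succ.2 ⟨boundedUpTo_zero.2 ⟨hf.smooth.anti h, C,
      fun p hp => hC p (prod_mono_right (awayFrom_anti h) hp)⟩,
      fun P hP => ih (hf.operator (timeBOperators_anti h hP))⟩

theorem ConormalAway.congr (hS : S.Finite) (hf : ConormalAway T ρ S f)
    (h : EqOn g f (Icc 0 T ×ˢ awayFrom S)) : ConormalAway T ρ S g := fun k => (hf k).congr hS h

theorem ConormalAway.const (c : ℝ) : ConormalAway T ρ S (fun _ => c) := BoundedUpTo.const c

theorem ConormalAway.add (hT : 0 < T) (hS : S.Finite) (hf : ConormalAway T ρ S f)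
    (hg : ConormalAway T ρ S g) : ConormalAway T ρ S (fun p => f p + g p) :=
  fun k => (hf k).add hT hS (hg k)

theorem ConormalAway.mul (hT : 0 < T) (hS : S.Finite) (hf : ConormalAway T ρ S f)
    (hg : ConormalAway T ρ S g) : ConormalAway T ρ S (fun p => f p * g p) :=
  fun k => (hf k).mul hT hS (hg k)

theorem ConormalAway.sum (hT : 0 < T) (hS : S.Finite) {ι : Type*} (s : Finset ι)
    {f : ι → ℝ × M → ℝ} (hf : ∀ i ∈ s, ConormalAway T ρ S (f i)) :
    ConormalAway T ρ S (fun p => ∑ i ∈ s, f i p) :=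
  fun k => BoundedUpTo.sum hT hS s fun i hi => hf i hi k

theorem ConormalAway.anti (h : S' ⊆ S) (hf : ConormalAway T ρ S' f) : ConormalAway T ρ S f :=
  fun k => (hf k).anti h

/-- For `S = ∅` the operators preserve smoothness on the compact `[0,T] × M`, where continuity gives
bounds. Enlarging `S` only shrinks the domain and the set of operators. -/
theorem conormalAway_of_smooth [CompactSpace M] (hT : 0 < T) 
    (hf : SmoothAway T (∅ : Set (BoundaryHypersurface n M)) f) :
    ConormalAway T ρ S f := by
  refine ConormalAway.anti (S' := ∅) (empty_subset S) fun k => ?_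
  have h0 : ∀ {f : ℝ × M → ℝ}, SmoothAway T (∅ : Set (BoundaryHypersurface n M)) f →
      BoundedUpTo T ρ ∅ 0 f := by
    intro f hf
    have hc : ContinuousOn f (Icc 0 T ×ˢ awayFrom (∅ : Set (BoundaryHypersurface n M))) :=
      ContMDiffOn.continuousOn hf
    rw [awayFrom_empty] at hc
    obtain ⟨C, hC⟩ := (isCompact_Icc.prod isCompact_univ).exists_bound_of_continuousOn hc
    exact boundedUpTo_zero.2 ⟨hf, C, fun p hp => hC p ⟨hp.1, mem_univ _⟩⟩
  induction k generalizing f with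
  | zero => exact h0 hf
  | succ k ih => exact boundedUpTo_succ.2 ⟨h0 hf, fun P hP =>
      ih (smoothAway_of_mem hT finite_empty hP hf)⟩

/-! ### Conormality of solutions of linear systems -/

/-- `V` is independent of `t`, so it commutes with `∂_t` and preserves the zero initial value. The
Leibniz term `(V l) u` goes into the forcing, and the matrix stays `l`. -/
theorem SolvesSystem.operator_space (hT : 0 < T) (hS : S.Finite) {ι : Type} [Fintype ι]
    {l : ι → ι → ℝ × M → ℝ} {f u : ι → ℝ × M → ℝ}
    (hl : ∀ i j, SmoothAway T S (l i j)) (hf : ∀ i, SmoothAway T S (f i))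
    (hu : ∀ i, SmoothAway T S (u i)) (h : SolvesSystem T (awayFrom S) l f u)
    {V : ∀ x : M, TangentSpace (modelWithCornersEuclideanQuadrant n) x}
    (hV : V ∈ bVectorFields ρ S) {P : (ℝ × M → ℝ) → ℝ × M → ℝ}
    (hP : P = fun f p => derivAlong V (fun y => f (p.1, y)) p.2) :
    SolvesSystem T (awayFrom S) l (fun i p => ∑ j, P (l i j) p * u j p + P (f i) p)
      (fun i => P (u i)) := by
  have hPm : P ∈ timeBOperators T ρ S := Or.inr ⟨V, hV, hP⟩
  refine fun x hx i => ⟨?_, fun t ht => ?_⟩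
  · have h0 : (fun y => u i (0, y)) =ᶠ[𝓝 x] fun _ => 0 := by
      filter_upwards [(isOpen_awayFrom hS).mem_nhds hx] with y hy using (h y hy i).1
    rw [hP]
    simp only [derivAlong]
    rw [h0.mfderiv_eq, mfderiv_const]
    rfl
  · have hDt : EqOn (fun p => derivWithin (fun s => u i (s, p.2)) (Icc 0 T) p.1)
        (fun p => ∑ j, l i j p * u j p + f i p) (Icc 0 T ×ˢ awayFrom S) := fun p hp =>
      ((h p.2 hp.2 i).2 p.1 hp.1).derivWithin (uniqueDiffOn_Icc hT p.1 hp.1)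
    have h1 : HasDerivWithinAt (fun s => P (u i) (s, x))
        (P (fun p => derivWithin (fun s => u i (s, p.2)) (Icc 0 T) p.1) (t, x)) (Icc 0 T) t := by
      rw [hP]
      exact hasDerivWithinAt_mfderiv_apply hT (isOpen_awayFrom hS) hx (hu i) ht (V x)
    refine h1.congr_deriv ?_
    have hp : (t, x) ∈ Icc 0 T ×ˢ awayFrom S := ⟨ht, hx⟩
    rw [operator_congr hS hPm hDt hp, operator_add hT hS hPm
      (SmoothAway.sum _ fun j _ => (hl i j).mul (hu j)) (hf i) hp]
    simp only
    rw [operator_sum hT hS hPm _ (fun j _ => (hl i j).mul (hu j)) hp, ← add_assoc,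
      ← Finset.sum_add_distrib]
    congr 1
    refine Finset.sum_congr rfl fun j _ => ?_
    rw [operator_mul hT hS hPm (hl i j) (hu j) hp]
    ring

/-- For `∂_t` the equation itself expresses `∂_t u` by functions already controlled. For `V` the
induction hypothesis is used twice: it bounds `u` in the new forcing, and then `V u` as a solution.
-/
theorem SolvesSystem.boundedUpTo (hT : 0 < T) (hS : S.Finite) {ι : Type} [Fintype ι] (k : ℕ) :
    ∀ {l : ι → ι → ℝ × M → ℝ} {f u : ι → ℝ × M → ℝ},
      (∀ i j, BoundedUpTo T ρ S k (l i j)) → (∀ i, BoundedUpTo T ρ S k (f i)) →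
      SolvesSystem T (awayFrom S) l f u → ∀ i, BoundedUpTo T ρ S k (u i) := by
  have h0 : ∀ {l : ι → ι → ℝ × M → ℝ} {f u : ι → ℝ × M → ℝ},
      (∀ i j, BoundedUpTo T ρ S 0 (l i j)) → (∀ i, BoundedUpTo T ρ S 0 (f i)) →
      SolvesSystem T (awayFrom S) l f u → ∀ i, BoundedUpTo T ρ S 0 (u i) := fun hl hf h i =>
    boundedUpTo_zero.2 ⟨h.contMDiffOn hT (isOpen_awayFrom hS) (fun i j => (hl i j).smooth)
      (fun i => (hf i).smooth) i, h.bounded (fun i j => (hl i j).bound) (fun i => (hf i).bound) i⟩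
  induction k with
  | zero => exact h0
  | succ k ih =>
    intro l f u hl hf h i
    have hu0 := h0 (fun i j => (hl i j).zero) (fun i => (hf i).zero) h
    have hu := ih (fun i j => (hl i j).of_succ) (fun i => (hf i).of_succ) h
    refine boundedUpTo_succ.2 ⟨hu0 i, fun P hP => ?_⟩
    rcases hP with rfl | ⟨V, hV, hPV⟩
    · refine ((BoundedUpTo.sum hT hS Finset.univ fun j _ => ((hl i j).of_succ).mul hT hS (hu j)).add
        hT hS (hf i).of_succ).congr hS fun p hp => ?_
      exact ((h p.2 hp.2 i).2 p.1 hp.1).derivWithin (uniqueDiffOn_Icc hT p.1 hp.1)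
    · have hPm : P ∈ timeBOperators T ρ S := Or.inr ⟨V, hV, hPV⟩
      exact ih (fun i j => (hl i j).of_succ) (fun i =>
        (BoundedUpTo.sum hT hS Finset.univ fun j _ => ((hl i j).operator hPm).mul hT hS (hu j)).add
          hT hS ((hf i).operator hPm))
        (h.operator_space hT hS (fun i j => (hl i j).smooth) (fun i => (hf i).smooth)
          (fun i => (hu0 i).smooth) hV hPV) i

theorem SolvesSystem.conormalAway (hT : 0 < T) (hS : S.Finite) {ι : Type} [Fintype ι]
    {l : ι → ι → ℝ × M → ℝ} {f u : ι → ℝ × M → ℝ}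
    (hl : ∀ i j, ConormalAway T ρ S (l i j)) (hf : ∀ i, ConormalAway T ρ S (f i))
    (h : SolvesSystem T (awayFrom S) l f u) (i : ι) : ConormalAway T ρ S (u i) :=
  fun k => h.boundedUpTo hT hS k (fun i j => hl i j k) (fun i => hf i k) i

end Conormal

/-! ### Powers and logarithms of defining functions -/

/-- The function `r^s (log r)^k`. -/
def logTerm (s : ℝ) (k : ℕ) (r : ℝ) : ℝ := r ^ s * Real.log r ^ k

theorem logTerm_zero_zero (r : ℝ) : logTerm 0 0 r = 1 := by simp [logTerm]

theorem logTerm_add {r : ℝ} (hr : 0 < r) (s s' : ℝ) (k k' : ℕ) :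
    logTerm (s + s') (k + k') r = logTerm s k r * logTerm s' k' r := by
  simp only [logTerm, Real.rpow_add hr, pow_add]
  ring

theorem logTerm_sub_nat {r : ℝ} (hr : 0 < r) (s : ℝ) (N k : ℕ) :
    logTerm s k r = r ^ N * logTerm (s - N) k r := by
  simp only [logTerm, Real.rpow_sub hr, Real.rpow_natCast]
  field_simp

/-- The factor `r⁻¹` is isolated so that it cancels against `V ρ_H = a ρ_H`. For `k = 0` the
truncated exponent `k - 1` has coefficient zero. -/
theorem hasDerivAt_logTerm {r : ℝ} (hr : 0 < r) (s : ℝ) (k : ℕ) :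
    HasDerivAt (logTerm s k) ((s * logTerm s k r + k * logTerm s (k - 1) r) * r⁻¹) r := by
  have h := (Real.hasDerivAt_rpow_const (x := r) (p := s) (Or.inl hr.ne')).mul
    ((Real.hasDerivAt_log hr.ne').pow k)
  refine h.congr_deriv ?_
  simp only [logTerm, Real.rpow_sub_one hr.ne', Pi.pow_apply]
  field_simp

theorem exists_bound_logTerm {s : ℝ} (hs : 0 < s) (k : ℕ) (R : ℝ) :
    ∃ C, ∀ r, 0 < r → r ≤ R → |logTerm s k r| ≤ C := by
  -- This exponent satisfies `a * k ≤ s`, so for `r ≤ 1` each logarithm is absorbed by one factor `r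
  -- ^ a`; the `k + 1` covers `k = 0`.
  set a := s / (k + 1) with ha
  have ha0 : 0 < a := by positivity
  refine ⟨max ((1 / a) ^ k) (R ^ s * Real.log R ^ k), fun r hr hR => ?_⟩
  rw [logTerm, abs_mul, abs_pow, abs_of_pos (Real.rpow_pos_of_pos hr s)]
  rcases le_total r 1 with h1 | h1
  · refine le_max_of_le_left ?_
    have h2 := (Real.abs_log_mul_self_rpow_lt r a hr h1 ha0).le
    have h3 : r ^ s ≤ (r ^ a) ^ k := by
      rw [← Real.rpow_natCast (r ^ a) k, ← Real.rpow_mul hr.le]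
      refine Real.rpow_le_rpow_of_exponent_ge hr h1 ?_
      rw [ha, div_mul_eq_mul_div, div_le_iff₀ (by positivity)]
      nlinarith
    calc r ^ s * |Real.log r| ^ k ≤ (r ^ a) ^ k * |Real.log r| ^ k := by gcongr
      _ = |Real.log r * r ^ a| ^ k := by
        rw [abs_mul, abs_of_pos (Real.rpow_pos_of_pos hr a), ← mul_pow, mul_comm]
      _ ≤ _ := by gcongr
  · refine le_max_of_le_right ?_
    rw [abs_of_nonneg (Real.log_nonneg h1)]
    have := Real.log_nonneg h1
    have hR0 : 0 ≤ R := by linarith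
    gcongr

section Powers

variable {n : ℕ} {M : Type*} [TopologicalSpace M]
  [ChartedSpace (EuclideanQuadrant n) M]
  [IsManifold (modelWithCornersEuclideanQuadrant n) ∞ M]
  {ρ : BoundaryHypersurface n M → M → ℝ} {T : ℝ} {S : Set (BoundaryHypersurface n M)}
  {H : BoundaryHypersurface n M}

omit [IsManifold (modelWithCornersEuclideanQuadrant n) ∞ M] in
theorem IsDefiningFunction.pos {r : M → ℝ} (h : IsDefiningFunction H r)
    (hH : H ∈ S) {x : M} (hx : x ∈ awayFrom S) : 0 < r x :=
  lt_of_le_of_ne (h.nonneg x) fun h0 => hx H hH ((h.eq_zero_iff x).1 h0.symm)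

omit [IsManifold (modelWithCornersEuclideanQuadrant n) ∞ M] in
theorem smoothAway_snd {a : M → ℝ}
    (ha : ContMDiff (modelWithCornersEuclideanQuadrant n) 𝓘(ℝ, ℝ) ∞ a) :
    SmoothAway T S (fun p => a p.2) :=
  (ha.comp contMDiff_snd).contMDiffOn

theorem conormalAway_snd [CompactSpace M] (hT : 0 < T) {a : M → ℝ}
    (ha : ContMDiff (modelWithCornersEuclideanQuadrant n) 𝓘(ℝ, ℝ) ∞ a) :
    ConormalAway T ρ S (fun p => a p.2) :=
  conormalAway_of_smooth hT (smoothAway_snd ha)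

omit [IsManifold (modelWithCornersEuclideanQuadrant n) ∞ M] in
theorem smoothAway_logTerm (hρ : IsDefiningFunction H (ρ H)) (hH : H ∈ S) (s : ℝ) (k : ℕ) :
    SmoothAway T S (fun p => logTerm s k (ρ H p.2)) := by
  have h1 : ContDiffOn ℝ ∞ (logTerm s k) (Ioi 0) := fun r hr =>
    ((Real.contDiffAt_rpow_const_of_ne (ne_of_gt hr)).mul
      ((Real.contDiffAt_log.2 (ne_of_gt hr)).pow k)).contDiffWithinAt
  exact h1.contMDiffOn.comp (smoothAway_snd hρ.smooth) fun p hp => hρ.pos hH hp.2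

/-- Since `V ρ_H = a ρ_H`, a tangent vector field maps log terms to combinations of log terms with
the same exponent `s`, which are bounded because `s > 0`. -/
theorem conormalAway_logTerm [CompactSpace M] (hT : 0 < T) (hS : S.Finite)
    (hρ : IsDefiningFunction H (ρ H)) (hH : H ∈ S) {s : ℝ} (hs : 0 < s) (k : ℕ) :
    ConormalAway T ρ S (fun p => logTerm s k (ρ H p.2)) := by
  intro j
  have h0 : ∀ k, BoundedUpTo T ρ S 0 (fun p => logTerm s k (ρ H p.2)) := fun k => by
    obtain ⟨R, hR⟩ := isCompact_univ.exists_bound_of_continuousOn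
      hρ.smooth.continuous.continuousOn
    obtain ⟨C, hC⟩ := exists_bound_logTerm hs k R
    exact boundedUpTo_zero.2 ⟨smoothAway_logTerm hρ hH s k, C, fun p hp =>
      hC _ (hρ.pos hH hp.2) ((le_abs_self _).trans (hR _ (mem_univ _)))⟩
  induction j generalizing k with
  | zero => exact h0 k
  | succ j ih =>
    refine boundedUpTo_succ.2 ⟨h0 k, fun P hP => ?_⟩
    rcases hP with rfl | ⟨V, hV, rfl⟩
    · simpa using BoundedUpTo.const 0 j
    · obtain ⟨a, ha, ha'⟩ := hV.2 H hH
      have h1 : BoundedUpTo T ρ S j (fun p => a p.2 *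
          (s * logTerm s k (ρ H p.2) + k * logTerm s (k - 1) (ρ H p.2))) :=
        (conormalAway_snd hT ha j).mul hT hS
          (((BoundedUpTo.const s j).mul hT hS (ih k)).add hT hS
            ((BoundedUpTo.const (k : ℝ) j).mul hT hS (ih (k - 1))))
      refine h1.congr hS fun p hp => ?_
      have hpos := hρ.pos hH hp.2
      have h2 := (hρ.smooth.mdifferentiableAt (x := p.2) (by simp)).hasMFDerivAt
      have h3 := (hasDerivAt_logTerm hpos s k).hasFDerivAt.hasMFDerivAt.comp p.2 h2
      have h4 := DFunLike.congr_fun h3.mfderiv (V p.2)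
      refine h4.trans ?_
      change (ContinuousLinearMap.toSpanSingleton ℝ
        ((s * logTerm s k (ρ H p.2) + k * logTerm s (k - 1) (ρ H p.2)) * (ρ H p.2)⁻¹))
        (mfderiv _ 𝓘(ℝ, ℝ) (ρ H) p.2 (V p.2) : ℝ) = _
      rw [ha' p.2, ContinuousLinearMap.toSpanSingleton_apply, smul_eq_mul]
      field_simp

/-! ### Remainders -/

/-- The functions in `ρ_H^N C_b^∞`. -/
def IsRemainder (T : ℝ) (ρ : BoundaryHypersurface n M → M → ℝ)
    (S : Set (BoundaryHypersurface n M)) (H : BoundaryHypersurface n M) (N : ℕ)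
    (f : ℝ × M → ℝ) : Prop :=
  ∃ r, ConormalAway T ρ S r ∧ ∀ p ∈ Icc 0 T ×ˢ awayFrom S, f p = ρ H p.2 ^ N * r p

variable {N : ℕ} {f g : ℝ × M → ℝ}

theorem IsRemainder.congr (hf : IsRemainder T ρ S H N f)
    (h : EqOn g f (Icc 0 T ×ˢ awayFrom S)) : IsRemainder T ρ S H N g := by
  obtain ⟨r, hr, hr'⟩ := hf
  exact ⟨r, hr, fun p hp => (h hp).trans (hr' p hp)⟩

theorem IsRemainder.add (hT : 0 < T) (hS : S.Finite) (hf : IsRemainder T ρ S H N f)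
    (hg : IsRemainder T ρ S H N g) : IsRemainder T ρ S H N (fun p => f p + g p) := by
  obtain ⟨r, hr, hr'⟩ := hf
  obtain ⟨q, hq, hq'⟩ := hg
  exact ⟨_, hr.add hT hS hq, fun p hp => by simp only [hr' p hp, hq' p hp]; ring⟩

theorem IsRemainder.mul (hT : 0 < T) (hS : S.Finite) (hf : IsRemainder T ρ S H N f)
    (hg : ConormalAway T ρ S g) : IsRemainder T ρ S H N (fun p => f p * g p) := by
  obtain ⟨r, hr, hr'⟩ := hf
  exact ⟨_, hr.mul hT hS hg, fun p hp => by simp only [hr' p hp]; ring⟩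

theorem IsRemainder.zero : IsRemainder T ρ S H N (fun _ => 0) :=
  ⟨_, ConormalAway.const 0, fun p _ => by simp⟩

theorem IsRemainder.sum (hT : 0 < T) (hS : S.Finite) {ι : Type*} (s : Finset ι)
    {f : ι → ℝ × M → ℝ} (hf : ∀ i ∈ s, IsRemainder T ρ S H N (f i)) :
    IsRemainder T ρ S H N (fun p => ∑ i ∈ s, f i p) := by
  classical
  induction s using Finset.induction_on with
  | empty => simpa using IsRemainder.zero
  | insert a s ha ih =>
    simp only [Finset.sum_insert ha]
    exact (hf a (Finset.mem_insert_self a s)).add hT hS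
      (ih fun i hi => hf i (Finset.mem_insert_of_mem hi))

theorem IsRemainder.conormalAway [CompactSpace M] (hT : 0 < T) (hS : S.Finite)
    (hρ : IsDefiningFunction H (ρ H))
    (hf : IsRemainder T ρ S H N f) : ConormalAway T ρ S f := by
  obtain ⟨r, hr, hr'⟩ := hf
  exact ((conormalAway_snd hT (hρ.smooth.pow N)).mul hT hS hr).congr hS fun p hp => hr' p hp

/-- The strict inequality leaves a positive power of `ρ_H` to absorb the logarithms. -/
theorem isRemainder_mul_logTerm [CompactSpace M] (hT : 0 < T) (hS : S.Finite)
    (hρ : IsDefiningFunction H (ρ H)) (hH : H ∈ S) {s : ℝ} (hs : N < s) (k : ℕ) (hf : ConormalAway T ρ S f) :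
    IsRemainder T ρ S H N (fun p => f p * logTerm s k (ρ H p.2)) :=
  ⟨_, hf.mul hT hS (conormalAway_logTerm hT hS hρ hH (sub_pos.2 hs) k), fun p hp => by
    simp only [logTerm_sub_nat (hρ.pos hH hp.2) s N k]; ring⟩

/-! ### Partial sums of expansions -/

/-- The part of an index set in the half plane `Re z ≤ r`. -/
def truncation (G : Set (ℂ × ℕ)) (r : ℝ) : Set (ℂ × ℕ) := {p ∈ G | p.1.re ≤ r}

/-- The sum of the terms with `Re z ≤ N` of an expansion at `H`. -/
def partialSum (ρ : BoundaryHypersurface n M → M → ℝ) (H : BoundaryHypersurface n M)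
    (G : Set (ℂ × ℕ)) (N : ℕ) (a : ℂ × ℕ → ℝ × M → ℝ) (x : ℝ × M) : ℝ :=
  ∑ᶠ p ∈ truncation G N, a p x * logTerm p.1.re p.2 (ρ H x.2)

theorem finite_truncation {G : Set (ℂ × ℕ)} (hG : IsPositiveIndexSet G) (r : ℝ) :
    (truncation G r).Finite := hG.finite_re_le r

/-- The part of a positive index set in the half plane `Re z ≤ r`, as a finite set. -/
def truncationFinset {G : Set (ℂ × ℕ)} (hG : IsPositiveIndexSet G) (r : ℝ) : Finset (ℂ × ℕ) :=
  (finite_truncation hG r).toFinset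

theorem mem_truncationFinset {G : Set (ℂ × ℕ)} {hG : IsPositiveIndexSet G} {r : ℝ} {p : ℂ × ℕ} :
    p ∈ truncationFinset hG r ↔ p ∈ G ∧ p.1.re ≤ r := by
  simp [truncationFinset, truncation]

/-- Here positivity enters: every term other than the constant one decays at `H`. -/
theorem eq_zero_of_re_le_zero {G : Set (ℂ × ℕ)} (hG : IsPositiveIndexSet G) {p : ℂ × ℕ}
    (hp : p ∈ G) (h : p.1.re ≤ 0) : p = (0, 0) := by
  have h1 : p.1 = 0 := Complex.ext (le_antisymm h (hG.re_nonneg p hp)) (hG.im_eq_zero p hp)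
  have h2 : p.2 = 0 := hG.no_log_at_zero p.2 (h1 ▸ hp)
  exact Prod.ext h1 h2

theorem zero_mem {G : Set (ℂ × ℕ)} (hG : IsPositiveIndexSet G) : ((0 : ℂ), 0) ∈ G := by
  simpa using hG.nat_mem 0

omit [IsManifold (modelWithCornersEuclideanQuadrant n) ∞ M] in
theorem partialSum_eq {G : Set (ℂ × ℕ)} (hG : IsPositiveIndexSet G) (a : ℂ × ℕ → ℝ × M → ℝ)
    (x : ℝ × M) : partialSum ρ H G N a x =
      ∑ p ∈ truncationFinset hG N, a p x * logTerm p.1.re p.2 (ρ H x.2) :=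
  finsum_mem_eq_finite_toFinset_sum _ _

/-- The products of pairs of terms in the index sets that contribute to the term with index `p`
of a product. -/
def productPairs {G K : Set (ℂ × ℕ)} (hG : IsPositiveIndexSet G) (hK : IsPositiveIndexSet K)
    (p : ℂ × ℕ) : Finset ((ℂ × ℕ) × (ℂ × ℕ)) :=
  {q ∈ truncationFinset hG p.1.re ×ˢ truncationFinset hK p.1.re | q.1 + q.2 = p}

theorem mem_productPairs {G K : Set (ℂ × ℕ)} {hG : IsPositiveIndexSet G}
    {hK : IsPositiveIndexSet K} {p : ℂ × ℕ} {q : (ℂ × ℕ) × (ℂ × ℕ)} :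
    q ∈ productPairs hG hK p ↔ q.1 ∈ G ∧ q.2 ∈ K ∧ q.1 + q.2 = p := by
  simp only [productPairs, Finset.mem_filter, Finset.mem_product, mem_truncationFinset]
  constructor
  · tauto
  · rintro ⟨h1, h2, h3⟩
    have e1 := hG.re_nonneg _ h1
    have e2 := hK.re_nonneg _ h2
    have e3 : q.1.1.re + q.2.1.re = p.1.re := by rw [← h3]; simp
    exact ⟨⟨⟨h1, by linarith⟩, h2, by linarith⟩, h3⟩

/-- The coefficients of the product of two expansions. -/
def productCoeff {G K : Set (ℂ × ℕ)} (hG : IsPositiveIndexSet G) (hK : IsPositiveIndexSet K)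
    (a b : ℂ × ℕ → ℝ × M → ℝ) (p : ℂ × ℕ) (x : ℝ × M) : ℝ :=
  ∑ q ∈ productPairs hG hK p, a q.1 x * b q.2 x

/-- The product of two expansions. -/
theorem isRemainder_mul_sub_partialSum [CompactSpace M] (hT : 0 < T) (hS : S.Finite)
    (hρ : IsDefiningFunction H (ρ H)) (hH : H ∈ S) {G K : Set (ℂ × ℕ)}
    (hG : IsPositiveIndexSet G) (hK : IsPositiveIndexSet K) (hGK : G + K ⊆ K)
    {a b : ℂ × ℕ → ℝ × M → ℝ} (ha : ∀ p ∈ G, ConormalAway T ρ S (a p))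
    (hb : ∀ p ∈ K, ConormalAway T ρ S (b p))
    (hf : ConormalAway T ρ S f) (hg : ConormalAway T ρ S g)
    (hfa : IsRemainder T ρ S H N (fun x => f x - partialSum ρ H G N a x))
    (hgb : IsRemainder T ρ S H N (fun x => g x - partialSum ρ H K N b x)) :
    IsRemainder T ρ S H N
      (fun x => f x * g x - partialSum ρ H K N (productCoeff hG hK a b) x) := by
  classical
  set A := truncationFinset hG N
  set B := truncationFinset hK N
  set Q := A ×ˢ B with hQ
  set F : (ℂ × ℕ) × (ℂ × ℕ) → ℝ × M → ℝ := fun q x =>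
    a q.1 x * b q.2 x * logTerm (q.1 + q.2).1.re (q.1 + q.2).2 (ρ H x.2) with hF
  -- Pairs of exponents up to `N` whose sum exceeds `N` are absent from the partial sum of the
  -- product and go into the remainder.
  have h1 : IsRemainder T ρ S H N (fun x => ∑ q ∈ Q with ¬ (q.1 + q.2).1.re ≤ (N : ℝ), F q x) := by
    refine IsRemainder.sum hT hS _ fun q hq => ?_
    simp only [hQ, Finset.mem_filter, Finset.mem_product, A, B, mem_truncationFinset, not_le] at hq
    exact isRemainder_mul_logTerm hT hS hρ hH hq.2 _ ((ha _ hq.1.1.1).mul hT hS (hb _ hq.1.2.1))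
  -- With partial sums `A`, `B` the identity is `fg - AB = (f - A) g + (g - B) f - (f - A)(g - B)`.
  have h2 : IsRemainder T ρ S H N (fun x => -1 * ((f x - partialSum ρ H G N a x) *
      (g x - partialSum ρ H K N b x))) := by
    have := (hfa.mul hT hS (hgb.conormalAway hT hS hρ)).mul hT hS (ConormalAway.const (-1))
    exact this.congr fun x _ => by simp only; ring
  refine (((hfa.mul hT hS hg).add hT hS ((hgb.mul hT hS hf).add hT hS h2)).add hT hS h1).congr
    fun x hx => ?_
  have hpos := hρ.pos hH hx.2
  have h3 : partialSum ρ H G N a x * partialSum ρ H K N b x = ∑ q ∈ Q, F q x := by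
    rw [partialSum_eq hG, partialSum_eq hK, Finset.sum_mul_sum, ← Finset.sum_product']
    refine Finset.sum_congr rfl fun q _ => ?_
    simp only [hF, Prod.fst_add, Prod.snd_add, Complex.add_re, logTerm_add hpos]
    ring
  -- The products are regrouped by their total index, which lies in `K` because `G + K ⊆ K`.
  have h4 : partialSum ρ H K N (productCoeff hG hK a b) x =
      ∑ q ∈ Q with (q.1 + q.2).1.re ≤ (N : ℝ), F q x := by
    have hmaps : ∀ q ∈ Q.filter (fun q => (q.1 + q.2).1.re ≤ (N : ℝ)), q.1 + q.2 ∈ B := by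
      intro q hq
      simp only [hQ, Finset.mem_filter, Finset.mem_product, A, B, mem_truncationFinset] at hq ⊢
      exact ⟨hGK (Set.add_mem_add hq.1.1.1 hq.1.2.1), hq.2⟩
    rw [partialSum_eq hK, ← Finset.sum_fiberwise_of_maps_to hmaps]
    refine Finset.sum_congr rfl fun p hp => ?_
    rw [mem_truncationFinset] at hp
    rw [productCoeff, Finset.sum_mul]
    refine Finset.sum_congr ?_ fun q hq => ?_
    · ext q
      simp only [mem_productPairs, hQ, Finset.mem_filter, Finset.mem_product, A, B,
        mem_truncationFinset]
      constructor
      · rintro ⟨e1, e2, e3⟩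
        have e4 := hG.re_nonneg _ e1
        have e5 := hK.re_nonneg _ e2
        have e6 : q.1.1.re + q.2.1.re = p.1.re := by rw [← e3]; simp
        exact ⟨⟨⟨⟨e1, by linarith⟩, e2, by linarith⟩, by rw [e3]; exact hp.2⟩, e3⟩
      · rintro ⟨⟨⟨⟨e1, _⟩, e2, _⟩, _⟩, e3⟩
        exact ⟨e1, e2, e3⟩
    · rw [← (Finset.mem_filter.1 hq).2]
  have h5 := Finset.sum_filter_add_sum_filter_not Q (fun q => (q.1 + q.2).1.re ≤ (N : ℝ))
    (fun q => F q x)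
  linear_combination h3 - h4 - h5

/-! ### Polyhomogeneous functions on `[0,T] × M` -/

/-- Polyhomogeneous functions on `[0,T] × M`. -/
abbrev IsPhgTime (T : ℝ) (ρ : BoundaryHypersurface n M → M → ℝ)
    (G : BoundaryHypersurface n M → Set (ℂ × ℕ)) (S : Set (BoundaryHypersurface n M))
    (f : ℝ × M → ℝ) : Prop :=
  IsPhg (𝓘(ℝ, ℝ).prod (modelWithCornersEuclideanQuadrant n)) Prod.snd (Icc 0 T ×ˢ univ)
    (timeBOperators T ρ) ρ G S f

variable {G K : BoundaryHypersurface n M → Set (ℂ × ℕ)}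

omit [IsManifold (modelWithCornersEuclideanQuadrant n) ∞ M] in
theorem time_domain_eq : (Icc 0 T ×ˢ (univ : Set M)) ∩ Prod.snd ⁻¹' awayFrom S =
    Icc 0 T ×ˢ awayFrom S := by
  ext; simp

-- The definition is an inductive predicate, so its recursion terminates. Each step removes one
-- hypersurface, and a coefficient to descend to exists since `(0, 0)` is in every index set; hence
-- `S` is finite.
omit [IsManifold (modelWithCornersEuclideanQuadrant n) ∞ M] in
theorem IsPhg.finite {EX HX X : Type*} [NormedAddCommGroup EX] [NormedSpace ℝ EX]
    [TopologicalSpace HX] [TopologicalSpace X] [ChartedSpace HX X]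
    {J : ModelWithCorners ℝ EX HX} {pr : X → M} {D : Set X}
    {Op : Set (BoundaryHypersurface n M) → Set ((X → ℝ) → X → ℝ)} {f : X → ℝ}
    (hG : ∀ H, IsPositiveIndexSet (G H)) (hf : IsPhg J pr D Op ρ G S f) : S.Finite := by
  induction hf with
  | intro S f a _ _ _ ih =>
    rcases S.eq_empty_or_nonempty with rfl | ⟨H, hH⟩
    · exact finite_empty
    · exact ((ih H hH _ (zero_mem (hG H))).union (finite_singleton H)).subset (by simp)

theorem isPhgTime_iff (hT : 0 < T) (hS : S.Finite) : IsPhgTime T ρ G S f ↔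
    SmoothAway T S f ∧ ∃ a : BoundaryHypersurface n M → ℂ × ℕ → ℝ × M → ℝ,
      (∀ H ∈ S, ∀ p ∈ G H, IsPhgTime T ρ G (S \ {H}) (a H p)) ∧
      ∀ H ∈ S, ∀ N : ℕ,
        IsRemainder T ρ S H N (fun x => f x - partialSum ρ H (G H) N (a H) x) := by
  constructor
  · rintro ⟨_, _, a, h1, h2, h3⟩
    rw [time_domain_eq] at h1
    refine ⟨h1, a, h2, fun H hH N => ?_⟩
    obtain ⟨r, hr, hr'⟩ := h3 H hH N
    rw [time_domain_eq] at hr hr'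
    exact ⟨r, (isConormal_iff hT hS).1 hr, hr'⟩
  · rintro ⟨h1, a, h2, h3⟩
    refine ⟨S, f, a, by rwa [time_domain_eq], h2, fun H hH N => ?_⟩
    obtain ⟨r, hr, hr'⟩ := h3 H hH N
    refine ⟨r, ?_, ?_⟩
    · rw [time_domain_eq]; exact (isConormal_iff hT hS).2 hr
    · rw [time_domain_eq]; exact hr'

theorem IsPhgTime.smooth (hf : IsPhgTime T ρ G S f) : SmoothAway T S f := by
  obtain ⟨_, _, a, h1, h2, h3⟩ := hf
  rwa [time_domain_eq] at h1

theorem IsPhgTime.congr (hT : 0 < T) (hS : S.Finite) (hf : IsPhgTime T ρ G S f)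
    (h : EqOn g f (Icc 0 T ×ˢ awayFrom S)) : IsPhgTime T ρ G S g := by
  obtain ⟨h1, a, h2, h3⟩ := (isPhgTime_iff hT hS).1 hf
  refine (isPhgTime_iff hT hS).2 ⟨h1.congr h, a, h2, fun H hH N => (h3 H hH N).congr fun x hx => ?_⟩
  simp only [h hx]

/-- In the expansion with `N = 0` at any one `H`, the only term is the coefficient at `(0, 0)`,
which is polyhomogeneous at fewer hypersurfaces and so conormal by induction. -/
theorem IsPhgTime.conormalAway [CompactSpace M] (hT : 0 < T) (hG : ∀ H, IsPositiveIndexSet (G H))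
    (hρ : ∀ H, IsDefiningFunction H (ρ H)) (hf : IsPhgTime T ρ G S f) :
    ConormalAway T ρ S f := by
  induction hS : S.ncard using Nat.strong_induction_on generalizing S f with
  | _ m ih =>
  have hfin := IsPhg.finite hG hf
  obtain ⟨h1, a, h2, h3⟩ := (isPhgTime_iff hT hfin).1 hf
  rcases S.eq_empty_or_nonempty with rfl | ⟨H, hH⟩
  · exact conormalAway_of_smooth hT h1
  · have h4 := (h3 H hH 0).conormalAway hT hfin (hρ H)
    have h5 : ConormalAway T ρ S (fun x => ∑ p ∈ truncationFinset (hG H) 0, a H p x) :=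
      ConormalAway.sum hT hfin _ fun p hp => (ih _ (hS ▸ ncard_sdiff_singleton_lt_of_mem hH hfin)
        (h2 H hH p (mem_truncationFinset.1 hp).1) rfl).anti sdiff_subset
    refine (h4.add hT hfin h5).congr hfin fun x hx => ?_
    have h6 : ∑ p ∈ truncationFinset (hG H) 0, a H p x = partialSum ρ H (G H) 0 (a H) x := by
      rw [partialSum_eq (hG H), Nat.cast_zero]
      refine Finset.sum_congr rfl fun p hp => ?_
      rw [mem_truncationFinset] at hp
      rw [eq_zero_of_re_le_zero (hG H) hp.1 hp.2]
      simp [logTerm_zero_zero]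
    simp only [h6]
    ring

theorem IsPhgTime.zero (hT : 0 < T) (hS : S.Finite) : IsPhgTime T ρ G S (fun _ => 0) := by
  induction hm : S.ncard using Nat.strong_induction_on generalizing S with
  | _ m ih =>
  refine (isPhgTime_iff hT hS).2 ⟨SmoothAway.const 0, fun _ _ _ => 0, fun H hH p _ =>
    ih _ (hm ▸ ncard_sdiff_singleton_lt_of_mem hH hS) (hS.sdiff) rfl, fun H hH N => ?_⟩
  exact IsRemainder.zero.congr fun x _ => by simp [partialSum]

theorem IsPhgTime.add (hT : 0 < T) (hG : ∀ H, IsPositiveIndexSet (G H))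
    (hf : IsPhgTime T ρ G S f) (hg : IsPhgTime T ρ G S g) :
    IsPhgTime T ρ G S (fun x => f x + g x) := by
  induction hm : S.ncard using Nat.strong_induction_on generalizing S f g with
  | _ m ih =>
  have hS := IsPhg.finite hG hf
  obtain ⟨f1, a, f2, f3⟩ := (isPhgTime_iff hT hS).1 hf
  obtain ⟨g1, b, g2, g3⟩ := (isPhgTime_iff hT hS).1 hg
  refine (isPhgTime_iff hT hS).2 ⟨f1.add g1, fun H p x => a H p x + b H p x, fun H hH p hp =>
    ih _ (hm ▸ ncard_sdiff_singleton_lt_of_mem hH hS) (f2 H hH p hp) (g2 H hH p hp) rfl,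
    fun H hH N => ((f3 H hH N).add hT hS (g3 H hH N)).congr fun x _ => ?_⟩
  simp only [partialSum_eq (hG H), add_mul, Finset.sum_add_distrib]
  ring

theorem IsPhgTime.sum (hT : 0 < T) (hG : ∀ H, IsPositiveIndexSet (G H)) (hS : S.Finite)
    {ι : Type*} (s : Finset ι) {f : ι → ℝ × M → ℝ} (hf : ∀ i ∈ s, IsPhgTime T ρ G S (f i)) :
    IsPhgTime T ρ G S (fun x => ∑ i ∈ s, f i x) := by
  classical
  induction s using Finset.induction_on with
  | empty => simpa using IsPhgTime.zero hT hS
  | insert a s ha ih =>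
    simp only [Finset.sum_insert ha]
    exact IsPhgTime.add hT hG (hf a (Finset.mem_insert_self a s))
      (ih fun i hi => hf i (Finset.mem_insert_of_mem hi))

theorem IsPhgTime.mono (hT : 0 < T) (hG : ∀ H, IsPositiveIndexSet (G H))
    (hK : ∀ H, IsPositiveIndexSet (K H)) (hGK : ∀ H, G H ⊆ K H)
    (hf : IsPhgTime T ρ G S f) : IsPhgTime T ρ K S f := by
  classical
  induction hm : S.ncard using Nat.strong_induction_on generalizing S f with
  | _ m ih =>
  have hS := IsPhg.finite hG hf
  obtain ⟨f1, a, f2, f3⟩ := (isPhgTime_iff hT hS).1 hf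
  refine (isPhgTime_iff hT hS).2 ⟨f1, fun H p => if p ∈ G H then a H p else fun _ => 0,
    fun H hH p hp => ?_, fun H hH N => (f3 H hH N).congr fun x _ => ?_⟩
  · beta_reduce
    split_ifs with h
    · exact ih _ (hm ▸ ncard_sdiff_singleton_lt_of_mem hH hS) (f2 H hH p h) rfl
    · exact IsPhgTime.zero hT hS.sdiff
  · simp only [partialSum_eq (hG H), partialSum_eq (hK H)]
    congr 1
    symm
    refine Finset.sum_subset_zero_on_sdiff (fun p hp => ?_) (fun p hp => ?_) fun p hp => ?_
    · rw [mem_truncationFinset] at hp ⊢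
      exact ⟨hGK H hp.1, hp.2⟩
    · rw [Finset.mem_sdiff, mem_truncationFinset, mem_truncationFinset] at hp
      rw [if_neg fun h => hp.2 ⟨h, hp.1.2⟩, zero_mul]
    · rw [mem_truncationFinset] at hp
      rw [if_pos hp.1]

/-- Coefficients live on the whole domain, so `f` itself serves as the coefficient at `(0, 0)`, with
all other coefficients and all remainders zero. -/
theorem isPhgTime_of_smooth (hT : 0 < T) (hG : ∀ H, IsPositiveIndexSet (G H)) (hS : S.Finite)
    (hf : SmoothAway T (∅ : Set (BoundaryHypersurface n M)) f) : IsPhgTime T ρ G S f := by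
  classical
  induction hm : S.ncard using Nat.strong_induction_on generalizing S with
  | _ m ih =>
  refine (isPhgTime_iff hT hS).2 ⟨hf.anti (empty_subset S), fun H p => if p = (0, 0) then f else
    fun _ => 0, fun H hH p _ => ?_, fun H hH N => IsRemainder.zero.congr fun x _ => ?_⟩
  · beta_reduce
    split_ifs
    · exact ih _ (hm ▸ ncard_sdiff_singleton_lt_of_mem hH hS) hS.sdiff rfl
    · exact IsPhgTime.zero hT hS.sdiff
  · simp only [partialSum_eq (hG H)]
    rw [Finset.sum_eq_single_of_mem (0, 0)
      (mem_truncationFinset.2 ⟨zero_mem (hG H), by simp⟩) fun p _ hp => by simp [hp]]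
    simp [logTerm_zero_zero]

theorem IsPhgTime.mul [CompactSpace M] (hT : 0 < T) (hG : ∀ H, IsPositiveIndexSet (G H))
    (hK : ∀ H, IsPositiveIndexSet (K H)) (hGK : ∀ H, G H + K H ⊆ K H)
    (hρ : ∀ H, IsDefiningFunction H (ρ H))
    (hf : IsPhgTime T ρ G S f) (hg : IsPhgTime T ρ K S g) :
    IsPhgTime T ρ K S (fun x => f x * g x) := by
  induction hm : S.ncard using Nat.strong_induction_on generalizing S f g with
  | _ m ih =>
  have hS := IsPhg.finite hG hf
  obtain ⟨f1, a, f2, f3⟩ := (isPhgTime_iff hT hS).1 hf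
  obtain ⟨g1, b, g2, g3⟩ := (isPhgTime_iff hT hS).1 hg
  refine (isPhgTime_iff hT hS).2 ⟨f1.mul g1, fun H => productCoeff (hG H) (hK H) (a H) (b H),
    fun H hH p hp => ?_, fun H hH N => ?_⟩
  · refine IsPhgTime.sum hT hK hS.sdiff _ fun q hq => ?_
    rw [mem_productPairs] at hq
    exact ih _ (hm ▸ ncard_sdiff_singleton_lt_of_mem hH hS) (f2 H hH _ hq.1) (g2 H hH _ hq.2.1) rfl
  · exact isRemainder_mul_sub_partialSum hT hS (hρ H) hH (hG H) (hK H) (hGK H)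
      (fun p hp => ((f2 H hH p hp).conormalAway hT hG hρ).anti sdiff_subset)
      (fun p hp => ((g2 H hH p hp).conormalAway hT hK hρ).anti sdiff_subset)
      (hf.conormalAway hT hG hρ) (hg.conormalAway hT hK hρ) (f3 H hH N) (g3 H hH N)

end Powers

/-! ### Linear systems with polyhomogeneous coefficients -/

section Systems

variable {n : ℕ} {M : Type*} [TopologicalSpace M]
  [ChartedSpace (EuclideanQuadrant n) M]
  {ρ : BoundaryHypersurface n M → M → ℝ} {T : ℝ} {S : Set (BoundaryHypersurface n M)}
  {H : BoundaryHypersurface n M} {ι : Type} [Fintype ι]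

/-- Any cutoff above `Re p` yields the same pairs, so all equations of a truncated coefficient
system can share one finite index set. -/
theorem productPairs_eq_filter {G K : Set (ℂ × ℕ)} (hG : IsPositiveIndexSet G)
    (hK : IsPositiveIndexSet K) {r : ℝ} {p : ℂ × ℕ} (hp : p.1.re ≤ r) : productPairs hG hK p =
      {q ∈ truncationFinset hG r ×ˢ truncationFinset hK r | q.1 + q.2 = p} := by
  ext q
  simp only [mem_productPairs, Finset.mem_filter, Finset.mem_product, mem_truncationFinset]
  constructor
  · rintro ⟨h1, h2, h3⟩
    have e1 := hG.re_nonneg _ h1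
    have e2 := hK.re_nonneg _ h2
    have e3 : q.1.1.re + q.2.1.re = p.1.re := by rw [← h3]; simp
    exact ⟨⟨⟨h1, by linarith⟩, h2, by linarith⟩, h3⟩
  · rintro ⟨⟨⟨h1, _⟩, h2, _⟩, h3⟩
    exact ⟨h1, h2, h3⟩

omit [TopologicalSpace M] in
theorem productCoeff_congr {G K : Set (ℂ × ℕ)} (hG : IsPositiveIndexSet G)
    (hK : IsPositiveIndexSet K) {a b b' : ℂ × ℕ → ℝ × M → ℝ} {p : ℂ × ℕ} {x : ℝ × M}
    (h : ∀ q ∈ K, q.1.re ≤ p.1.re → b q x = b' q x) :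
    productCoeff hG hK a b p x = productCoeff hG hK a b' p x := by
  refine Finset.sum_congr rfl fun q hq => ?_
  rw [productPairs_eq_filter hG hK le_rfl, Finset.mem_filter, Finset.mem_product,
    mem_truncationFinset, mem_truncationFinset] at hq
  rw [h _ hq.1.2.1 hq.1.2.2]

/-- The equations satisfied by the coefficients `a i p`, `Re p ≤ r`, of the expansion of a
solution. -/
def SolvesCoeffSystem {G K : Set (ℂ × ℕ)} (hG : IsPositiveIndexSet G) (hK : IsPositiveIndexSet K)
    (T : ℝ) (U : Set M) (l : ι → ι → ℂ × ℕ → ℝ × M → ℝ) (f : ι → ℂ × ℕ → ℝ × M → ℝ) (r : ℝ)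
    (a : ι → ℂ × ℕ → ℝ × M → ℝ) : Prop :=
  ∀ p ∈ K, p.1.re ≤ r → ∀ x ∈ U, ∀ i, a i p (0, x) = 0 ∧ ∀ t ∈ Icc 0 T,
    HasDerivWithinAt (fun s => a i p (s, x))
      (∑ j, productCoeff hG hK (l i j) (a j) p (t, x) + f i p (t, x)) (Icc 0 T) t

/-- The matrix of the system for the coefficients of the expansion of a solution. -/
def coeffMatrix {G K : Set (ℂ × ℕ)} (hG : IsPositiveIndexSet G) (hK : IsPositiveIndexSet K) (r : ℝ)
    (l : ι → ι → ℂ × ℕ → ℝ × M → ℝ) (y z : truncationFinset hK r × ι) (x : ℝ × M) : ℝ :=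
  ∑ p ∈ truncationFinset hG r with p + z.1.1 = y.1.1, l y.2 z.2 p x

-- The convolution over `q + q' = p` becomes a matrix product, so the coefficient equations form an
-- ordinary linear system.
omit [TopologicalSpace M] in
theorem sum_coeffMatrix_mul {G K : Set (ℂ × ℕ)} (hG : IsPositiveIndexSet G)
    (hK : IsPositiveIndexSet K) (r : ℝ) (l : ι → ι → ℂ × ℕ → ℝ × M → ℝ)
    (a : ι → ℂ × ℕ → ℝ × M → ℝ) (y : truncationFinset hK r × ι) (x : ℝ × M) :
    ∑ z, coeffMatrix hG hK r l y z x * a z.2 z.1.1 x =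
      ∑ j, productCoeff hG hK (l y.2 j) (a j) y.1.1 x := by
  rw [Fintype.sum_prod_type_right]
  refine Finset.sum_congr rfl fun j _ => ?_
  rw [productCoeff, productPairs_eq_filter hG hK (mem_truncationFinset.1 y.1.2).2,
    Finset.sum_filter, Finset.sum_product_right, ← Finset.sum_coe_sort (truncationFinset hK r)]
  refine Finset.sum_congr rfl fun q _ => ?_
  rw [coeffMatrix, Finset.sum_mul, Finset.sum_filter]

omit [TopologicalSpace M] in
theorem solvesCoeffSystem_iff {G K : Set (ℂ × ℕ)} {hG : IsPositiveIndexSet G}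
    {hK : IsPositiveIndexSet K} {U : Set M} {l : ι → ι → ℂ × ℕ → ℝ × M → ℝ}
    {f : ι → ℂ × ℕ → ℝ × M → ℝ} {r : ℝ} {a : ι → ℂ × ℕ → ℝ × M → ℝ} :
    SolvesCoeffSystem hG hK T U l f r a ↔
      SolvesSystem T U (coeffMatrix hG hK r l) (fun y => f y.2 y.1.1) (fun y => a y.2 y.1.1) := by
  simp only [SolvesSystem, sum_coeffMatrix_mul]
  constructor
  · intro h x hx y
    have := mem_truncationFinset.1 y.1.2
    exact h y.1.1 this.1 this.2 x hx y.2
  · intro h p hp hr x hx i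
    exact h x hx (⟨p, mem_truncationFinset.2 ⟨hp, hr⟩⟩, i)

variable [IsManifold (modelWithCornersEuclideanQuadrant n) ∞ M]

omit [IsManifold (modelWithCornersEuclideanQuadrant n) ∞ M] in
theorem SmoothAway.continuousOn_time {h : ℝ × M → ℝ} (hh : SmoothAway T S h) {x : M}
    (hx : x ∈ awayFrom S) : ContinuousOn (fun t => h (t, x)) (Icc 0 T) :=
  hh.continuousOn.comp (by fun_prop) fun _ ht => ⟨ht, hx⟩

omit [IsManifold (modelWithCornersEuclideanQuadrant n) ∞ M] in
theorem SolvesCoeffSystem.eqOn {G K : Set (ℂ × ℕ)} {hG : IsPositiveIndexSet G}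
    {hK : IsPositiveIndexSet K} {l : ι → ι → ℂ × ℕ → ℝ × M → ℝ}
    {f : ι → ℂ × ℕ → ℝ × M → ℝ} {r : ℝ} {a b : ι → ℂ × ℕ → ℝ × M → ℝ}
    (hl : ∀ i j, ∀ p ∈ G, SmoothAway T S (l i j p))
    (ha : SolvesCoeffSystem hG hK T (awayFrom S) l f r a)
    (hb : SolvesCoeffSystem hG hK T (awayFrom S) l f r b) (i : ι) {p : ℂ × ℕ} (hp : p ∈ K)
    (hr : p.1.re ≤ r) : EqOn (a i p) (b i p) (Icc 0 T ×ˢ awayFrom S) := by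
  refine SolvesSystem.eqOn (fun x hx y z => ?_) (solvesCoeffSystem_iff.1 ha)
    (solvesCoeffSystem_iff.1 hb) (⟨p, mem_truncationFinset.2 ⟨hp, hr⟩⟩, i)
  refine continuousOn_finsetSum _ fun q hq => ?_
  exact (hl _ _ q (mem_truncationFinset.1 (Finset.mem_filter.1 hq).1).1).continuousOn_time hx

variable {G K : BoundaryHypersurface n M → Set (ℂ × ℕ)}

/-- Systems on `[0,T] × M` with polyhomogeneous coefficients have polyhomogeneous solutions. -/
def HasPhgSolutions (T : ℝ) (ρ : BoundaryHypersurface n M → M → ℝ)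
    (G K : BoundaryHypersurface n M → Set (ℂ × ℕ)) (S : Set (BoundaryHypersurface n M)) : Prop :=
  ∀ (ι : Type) [Fintype ι] (l : ι → ι → ℝ × M → ℝ) (f : ι → ℝ × M → ℝ),
    (∀ i j, IsPhgTime T ρ G S (l i j)) → (∀ i, IsPhgTime T ρ K S (f i)) →
    ∃ u : ι → ℝ × M → ℝ, (∀ i, IsPhgTime T ρ K S (u i)) ∧ SolvesSystem T (awayFrom S) l f u

/-- The truncation at `r` is a system indexed by `truncationFinset (hK H) r × ι`, which is why
`HasPhgSolutions` allows every finite index type. The equation for `p` involves only indices with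
real part at most `Re p`, so truncations agree by uniqueness. -/
theorem exists_solvesCoeffSystem (hT : 0 < T) (hG : ∀ H, IsPositiveIndexSet (G H))
    (hK : ∀ H, IsPositiveIndexSet (K H)) (hS : S.Finite) (ih : HasPhgSolutions T ρ G K S)
    {l : ι → ι → ℂ × ℕ → ℝ × M → ℝ} {f : ι → ℂ × ℕ → ℝ × M → ℝ}
    (hl : ∀ i j, ∀ p ∈ G H, IsPhgTime T ρ G S (l i j p))
    (hf : ∀ i, ∀ p ∈ K H, IsPhgTime T ρ K S (f i p)) :
    ∃ a : ι → ℂ × ℕ → ℝ × M → ℝ, (∀ i, ∀ p ∈ K H, IsPhgTime T ρ K S (a i p)) ∧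
      ∀ r, SolvesCoeffSystem (hG H) (hK H) T (awayFrom S) l f r a := by
  classical
  have h1 : ∀ r : ℝ, ∃ b : ι → ℂ × ℕ → ℝ × M → ℝ,
      (∀ i, ∀ p ∈ K H, p.1.re ≤ r → IsPhgTime T ρ K S (b i p)) ∧
      SolvesCoeffSystem (hG H) (hK H) T (awayFrom S) l f r b := by
    intro r
    obtain ⟨v, hv, hv'⟩ := ih (truncationFinset (hK H) r × ι) (coeffMatrix (hG H) (hK H) r l)
      (fun y => f y.2 y.1.1)
      (fun y z => IsPhgTime.sum hT hG hS _ fun q hq =>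
        hl _ _ q (mem_truncationFinset.1 (Finset.mem_filter.1 hq).1).1)
      (fun y => hf _ _ (mem_truncationFinset.1 y.1.2).1)
    refine ⟨fun i p => if h : p ∈ truncationFinset (hK H) r then v (⟨p, h⟩, i) else fun _ => 0,
      fun i p hp hr => ?_, solvesCoeffSystem_iff.2 ?_⟩
    · beta_reduce
      rw [dif_pos (mem_truncationFinset.2 ⟨hp, hr⟩)]
      exact hv _
    · convert hv' using 2 with y
      exact dif_pos y.1.2
  choose b hb hb' using h1
  have hsm : ∀ i j, ∀ p ∈ G H, SmoothAway T S (l i j p) := fun i j p hp => (hl i j p hp).smooth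
  have heq : ∀ r r', r ≤ r' → ∀ i, ∀ p ∈ K H, p.1.re ≤ r →
      EqOn (b r i p) (b r' i p) (Icc 0 T ×ˢ awayFrom S) := fun r r' hr i p hp hpr =>
    (hb' r).eqOn hsm (fun q hq hqr => hb' r' q hq (hqr.trans hr)) i hp hpr
  -- The coefficient at `p` comes from the truncation at `Re p`; `heq` identifies the lower
  -- coefficients with those of that truncation.
  refine ⟨fun i p => b p.1.re i p, fun i p hp => hb _ i p hp le_rfl, fun r p hp _ x hx i => ?_⟩
  refine ⟨(hb' _ p hp le_rfl x hx i).1, fun t ht => ?_⟩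
  refine ((hb' _ p hp le_rfl x hx i).2 t ht).congr_deriv ?_
  congr 1
  refine Finset.sum_congr rfl fun j _ => productCoeff_congr _ _ fun q hq hqp => ?_
  exact (heq q.1.re p.1.re hqp j q hq le_rfl ⟨ht, hx⟩).symm

/-- `ρ_H ^ N` is a scalar independent of time and nonzero on the domain, so `w / ρ_H ^ N` solves the
same system with conormal forcing. -/
theorem SolvesSystem.isRemainder [CompactSpace M] (hT : 0 < T) (hS : S.Finite)
    (hρ : IsDefiningFunction H (ρ H)) (hH : H ∈ S) {N : ℕ}
    {l : ι → ι → ℝ × M → ℝ} {g w : ι → ℝ × M → ℝ}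
    (hl : ∀ i j, ConormalAway T ρ S (l i j)) (hg : ∀ i, IsRemainder T ρ S H N (g i))
    (hw : SolvesSystem T (awayFrom S) l g w) (i : ι) : IsRemainder T ρ S H N (w i) := by
  choose h hh hgh using hg
  have hpos : ∀ x ∈ awayFrom S, ρ H x ^ N ≠ 0 := fun x hx => (pow_pos (hρ.pos hH hx) N).ne'
  have key : SolvesSystem T (awayFrom S) l h (fun i x => (ρ H x.2 ^ N)⁻¹ * w i x) := by
    refine fun x hx i => ⟨by simp [(hw x hx i).1], fun t ht => ?_⟩
    refine (((hw x hx i).2 t ht).const_mul (ρ H x ^ N)⁻¹).congr_deriv ?_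
    rw [hgh i (t, x) ⟨ht, hx⟩, mul_add, inv_mul_cancel_left₀ (hpos x hx), Finset.mul_sum]
    congr 1
    exact Finset.sum_congr rfl fun j _ => by ring
  refine ⟨_, key.conormalAway hT hS hl hh i, fun x hx => ?_⟩
  rw [mul_inv_cancel_left₀ (hpos x.2 hx.2)]

theorem conormalAway_partialSum [CompactSpace M] (hT : 0 < T) (hS : S.Finite)
    (hρ : IsDefiningFunction H (ρ H)) (hH : H ∈ S) {K : Set (ℂ × ℕ)} (hK : IsPositiveIndexSet K)
    {a : ℂ × ℕ → ℝ × M → ℝ} (ha : ∀ p ∈ K, ConormalAway T ρ S (a p)) (N : ℕ) :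
    ConormalAway T ρ S (partialSum ρ H K N a) := by
  have h : ConormalAway T ρ S (fun x => ∑ p ∈ truncationFinset hK N,
      a p x * logTerm p.1.re p.2 (ρ H x.2)) := by
    refine ConormalAway.sum hT hS _ fun p hp => ?_
    have hp := (mem_truncationFinset.1 hp).1
    refine (ha p hp).mul hT hS ?_
    rcases lt_or_ge 0 p.1.re with h0 | h0
    · exact conormalAway_logTerm hT hS hρ hH h0 p.2
    · rw [eq_zero_of_re_le_zero hK hp h0]
      simpa only [Complex.zero_re, logTerm_zero_zero] using ConormalAway.const 1
  exact h.congr hS fun x _ => partialSum_eq hK a x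

/-- The coefficient equations cancel all terms up to order `N`. The forcing left over is the
truncation error of the products of `l` with the partial sum of `a`, plus that of `f`. In the
product estimate the second factor is its own partial sum, with remainder zero. -/
theorem SolvesSystem.isRemainder_sub_partialSum [CompactSpace M] (hT : 0 < T) (hS : S.Finite)
    (hρ : IsDefiningFunction H (ρ H)) (hH : H ∈ S) {G K : Set (ℂ × ℕ)}
    (hG : IsPositiveIndexSet G) (hK : IsPositiveIndexSet K) (hGK : G + K ⊆ K) {N : ℕ}
    {l : ι → ι → ℝ × M → ℝ} {f u : ι → ℝ × M → ℝ} {lc : ι → ι → ℂ × ℕ → ℝ × M → ℝ}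
    {fc a : ι → ℂ × ℕ → ℝ × M → ℝ} (hl : ∀ i j, ConormalAway T ρ S (l i j))
    (hlc : ∀ i j, ∀ p ∈ G, ConormalAway T ρ S (lc i j p))
    (ha : ∀ i, ∀ p ∈ K, ConormalAway T ρ S (a i p))
    (hlr : ∀ i j, IsRemainder T ρ S H N (fun x => l i j x - partialSum ρ H G N (lc i j) x))
    (hfr : ∀ i, IsRemainder T ρ S H N (fun x => f i x - partialSum ρ H K N (fc i) x))
    (hu : SolvesSystem T (awayFrom S) l f u)
    (hac : SolvesCoeffSystem hG hK T (awayFrom S) lc fc N a) (i : ι) :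
    IsRemainder T ρ S H N (fun x => u i x - partialSum ρ H K N (a i) x) := by
  have hp : ∀ j, ConormalAway T ρ S (partialSum ρ H K N (a j)) := fun j =>
    conormalAway_partialSum hT hS hρ hH hK (ha j) N
  have hg : ∀ i, IsRemainder T ρ S H N (fun x =>
      (∑ j, (l i j x * partialSum ρ H K N (a j) x -
        partialSum ρ H K N (productCoeff hG hK (lc i j) (a j)) x)) +
      (f i x - partialSum ρ H K N (fc i) x)) := fun i =>
    (IsRemainder.sum hT hS _ fun j _ => isRemainder_mul_sub_partialSum hT hS hρ hH hG hK hGK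
      (hlc i j) (ha j) (hl i j) (hp j) (hlr i j)
      (IsRemainder.zero.congr fun x _ => sub_self _)).add hT hS (hfr i)
  refine SolvesSystem.isRemainder hT hS hρ hH hl hg
    (w := fun i x => u i x - partialSum ρ H K N (a i) x) (fun x hx i => ⟨?_, fun t ht => ?_⟩) i
  · simp only [(hu x hx i).1, partialSum_eq hK]
    rw [Finset.sum_eq_zero fun p hp => ?_, sub_zero]
    rw [mem_truncationFinset] at hp
    rw [(hac p hp.1 hp.2 x hx i).1, zero_mul]
  · have h1 : HasDerivWithinAt (fun s => partialSum ρ H K N (a i) (s, x))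
        (∑ p ∈ truncationFinset hK N,
          (∑ j, productCoeff hG hK (lc i j) (a j) p (t, x) + fc i p (t, x)) *
            logTerm p.1.re p.2 (ρ H x)) (Icc 0 T) t := by
      simp only [partialSum_eq hK]
      refine HasDerivWithinAt.fun_sum fun p hp => ?_
      rw [mem_truncationFinset] at hp
      exact ((hac p hp.1 hp.2 x hx i).2 t ht).mul_const _
    refine (((hu x hx i).2 t ht).fun_sub h1).congr_deriv ?_
    simp only [mul_sub, Finset.sum_sub_distrib]
    have h2 : ∑ p ∈ truncationFinset hK N,
        (∑ j, productCoeff hG hK (lc i j) (a j) p (t, x) + fc i p (t, x)) *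
          logTerm p.1.re p.2 (ρ H x) =
        ∑ j, partialSum ρ H K N (productCoeff hG hK (lc i j) (a j)) (t, x) +
          partialSum ρ H K N (fc i) (t, x) := by
      simp only [partialSum_eq hK, add_mul, Finset.sum_mul, Finset.sum_add_distrib]
      rw [Finset.sum_comm]
    rw [h2]
    ring

/-- Induction on the number of hypersurfaces: `u` is solved for pointwise, and its coefficients at
`H` come from the systems on `S \ {H}`. -/
theorem hasPhgSolutions [CompactSpace M] (hT : 0 < T) (hρ : ∀ H, IsDefiningFunction H (ρ H))
    (hG : ∀ H, IsPositiveIndexSet (G H)) (hK : ∀ H, IsPositiveIndexSet (K H))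
    (hGK : ∀ H, G H + K H ⊆ K H) (hS : S.Finite) : HasPhgSolutions T ρ G K S := by
  induction hm : S.ncard using Nat.strong_induction_on generalizing S with
  | _ m ih =>
  intro ι _ l f hl hf
  have hlc := fun i j => (isPhgTime_iff hT hS).1 (hl i j)
  have hfc := fun i => (isPhgTime_iff hT hS).1 (hf i)
  choose hl1 lc hlc hlr using hlc
  choose hf1 fc hfc hfr using hfc
  obtain ⟨u, hu⟩ := exists_solvesSystem hT (U := awayFrom S) (l := l) (f := f)
    (fun x hx i j => (hl1 i j).continuousOn_time hx) (fun x hx i => (hf1 i).continuousOn_time hx)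
  have hus := fun i => hu.contMDiffOn hT (isOpen_awayFrom hS) hl1 hf1 i
  have hex : ∀ H, ∃ a : ι → ℂ × ℕ → ℝ × M → ℝ, H ∈ S →
      (∀ i, ∀ p ∈ K H, IsPhgTime T ρ K (S \ {H}) (a i p)) ∧
      ∀ r, SolvesCoeffSystem (hG H) (hK H) T (awayFrom (S \ {H})) (fun i j => lc i j H)
        (fun i => fc i H) r a := by
    intro H
    by_cases hH : H ∈ S
    · obtain ⟨a, ha⟩ := exists_solvesCoeffSystem (H := H) hT hG hK hS.sdiff
        (ih _ (hm ▸ ncard_sdiff_singleton_lt_of_mem hH hS) hS.sdiff rfl)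
        (l := fun i j => lc i j H) (f := fun i => fc i H)
        (fun i j => hlc i j H hH) (fun i => hfc i H hH)
      exact ⟨a, fun _ => ha⟩
    · exact ⟨fun _ _ _ => 0, fun h => absurd h hH⟩
  choose a ha using hex
  refine ⟨u, fun i => (isPhgTime_iff hT hS).2 ⟨hus i, fun H => a H i, fun H hH => (ha H hH).1 i,
    fun H hH N => ?_⟩, hu⟩
  exact hu.isRemainder_sub_partialSum hT hS (hρ H) hH (hG H) (hK H) (hGK H)
    (fun i j => (hl i j).conormalAway hT hG hρ)
    (fun i j p hp => ((hlc i j H hH p hp).conormalAway hT hG hρ).anti sdiff_subset)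
    (fun i p hp => (((ha H hH).1 i p hp).conormalAway hT hK hρ).anti sdiff_subset)
    (fun i j => hlr i j H hH N) (fun i => hfr i H hH N)
    (fun p hp hr x hx => (ha H hH).2 N p hp hr x (awayFrom_anti sdiff_subset hx)) i

end Systems

/-! ### Operations on index sets -/

section IndexSets

variable {G K : Set (ℂ × ℕ)}

theorem IsPositiveIndexSet.add (hG : IsPositiveIndexSet G) (hK : IsPositiveIndexSet K) :
    IsPositiveIndexSet (G + K) where
  finite_re_le r := by
    refine ((hG.finite_re_le r).add (hK.finite_re_le r)).subset ?_
    rintro _ ⟨⟨p, hp, q, hq, rfl⟩, hr⟩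
    have h1 := hG.re_nonneg p hp
    have h2 := hK.re_nonneg q hq
    have h3 : p.1.re + q.1.re ≤ r := by simpa using hr
    exact Set.add_mem_add ⟨hp, by linarith⟩ ⟨hq, by linarith⟩
  add_nat_mem := by
    rintro z k ⟨p, hp, q, hq, h⟩ m
    refine ⟨(p.1 + m, p.2), hG.add_nat_mem _ _ hp m, q, hq, ?_⟩
    rw [Prod.ext_iff] at h ⊢
    have h1 : p.1 + q.1 = z := h.1
    exact ⟨by rw [← h1]; exact add_right_comm _ _ _, h.2⟩
  log_le_mem := by
    rintro z k ⟨p, hp, q, hq, h⟩ m hm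
    rw [Prod.ext_iff] at h
    have h2 : p.2 + q.2 = k := h.2
    refine ⟨(p.1, min m p.2), hG.log_le_mem _ _ hp _ (min_le_right _ _), (q.1, m - min m p.2),
      hK.log_le_mem _ _ hq _ (by omega), Prod.ext h.1 ?_⟩
    simp only [Prod.mk_add_mk]
    omega
  nat_mem m := ⟨_, hG.nat_mem m, _, hK.nat_mem 0, by simp⟩
  im_eq_zero := by
    rintro _ ⟨p, hp, q, hq, rfl⟩
    simp [hG.im_eq_zero p hp, hK.im_eq_zero q hq]
  re_nonneg := by
    rintro _ ⟨p, hp, q, hq, rfl⟩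
    simpa using add_nonneg (hG.re_nonneg p hp) (hK.re_nonneg q hq)
  no_log_at_zero := by
    rintro k ⟨p, hp, q, hq, h⟩
    rw [Prod.ext_iff] at h
    have h1 : p.1.re + q.1.re = 0 := by simpa using congrArg Complex.re h.1
    have hp0 := hG.re_nonneg p hp
    have hq0 := hK.re_nonneg q hq
    have h2 : p.2 + q.2 = k := h.2
    rw [← h2, eq_zero_of_re_le_zero hG hp (by linarith), eq_zero_of_re_le_zero hK hq (by linarith)]
    rfl

theorem IsPositiveIndexSet.union (hG : IsPositiveIndexSet G) (hK : IsPositiveIndexSet K) :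
    IsPositiveIndexSet (G ∪ K) where
  finite_re_le r := ((hG.finite_re_le r).union (hK.finite_re_le r)).subset fun _ hp =>
    hp.1.imp (fun h => ⟨h, hp.2⟩) fun h => ⟨h, hp.2⟩
  add_nat_mem z k h m := h.imp (fun h => hG.add_nat_mem z k h m) fun h => hK.add_nat_mem z k h m
  log_le_mem z k h m hm :=
    h.imp (fun h => hG.log_le_mem z k h m hm) fun h => hK.log_le_mem z k h m hm
  nat_mem m := Or.inl (hG.nat_mem m)
  im_eq_zero p h := h.elim (hG.im_eq_zero p) (hK.im_eq_zero p)
  re_nonneg p h := h.elim (hG.re_nonneg p) (hK.re_nonneg p)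
  no_log_at_zero k h := h.elim (hG.no_log_at_zero k) (hK.no_log_at_zero k)

theorem isPositiveIndexSet_sumCopies (hG : IsPositiveIndexSet G) (j : ℕ) :
    IsPositiveIndexSet (sumCopies G j) := by
  induction j with
  | zero => exact hG
  | succ j ih => exact ih.add hG

theorem monotone_sumCopies (hG : IsPositiveIndexSet G) : Monotone (sumCopies G) :=
  monotone_nat_of_le_succ fun _ p hp => ⟨p, hp, _, zero_mem hG, add_zero p⟩

theorem sumCopies_add_sumCopies_subset (i j : ℕ) :
    sumCopies G i + sumCopies G j ⊆ sumCopies G (i + j + 1) := by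
  induction j with
  | zero => exact subset_rfl
  | succ j ih =>
    change _ + (sumCopies G j + G) ⊆ sumCopies G (i + j + 1) + G
    rw [← add_assoc]
    exact Set.add_subset_add_right ih

/-- Only finitely many elements have real part at most `1`, and the nonzero ones among them have
positive real part. -/
theorem exists_re_lower_bound (hG : IsPositiveIndexSet G) :
    ∃ ε > 0, ∀ p ∈ G, p ≠ 0 → ε ≤ p.1.re := by
  classical
  have hpos : ∀ p ∈ G, p ≠ 0 → 0 < p.1.re := fun p hp h0 =>
    lt_of_not_ge fun h => h0 (eq_zero_of_re_le_zero hG hp h)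
  set A := (truncationFinset hG 1).erase 0 with hA
  rcases A.eq_empty_or_nonempty with h | h
  · refine ⟨1, one_pos, fun p hp h0 => le_of_not_ge fun h1 => ?_⟩
    have : p ∈ A := Finset.mem_erase.2 ⟨h0, mem_truncationFinset.2 ⟨hp, h1⟩⟩
    simp [h] at this
  · obtain ⟨q, hq, hq'⟩ := A.exists_min_image (fun p => p.1.re) h
    rw [hA, Finset.mem_erase, mem_truncationFinset] at hq
    refine ⟨q.1.re, hpos q hq.2.1 hq.1, fun p hp h0 => ?_⟩
    rcases le_total p.1.re 1 with h1 | h1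
    · exact hq' p (Finset.mem_erase.2 ⟨h0, mem_truncationFinset.2 ⟨hp, h1⟩⟩)
    · exact hq.2.2.trans h1

/-- Each nonzero summand costs at least `ε`, so at most `m` summands are nonzero; `sumCopies G m`
has room for `m + 1`. Hence a half plane meets `G_∞` inside a single `sumCopies G m`, a set with
finite truncations. -/
theorem mem_sumCopies_of_re_lt (hG : IsPositiveIndexSet G) {ε : ℝ}
    (hε : ∀ p ∈ G, p ≠ 0 → ε ≤ p.1.re) (j : ℕ) : ∀ p ∈ sumCopies G j, ∀ m : ℕ,
      p.1.re < (m + 1) * ε → p ∈ sumCopies G m := by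
  induction j with
  | zero => exact fun p hp m _ => monotone_sumCopies hG (Nat.zero_le m) hp
  | succ j ih =>
    rintro _ ⟨p, hp, q, hq, rfl⟩ m hm
    have hm' : p.1.re + q.1.re < (m + 1) * ε := by simpa using hm
    by_cases hq0 : q = 0
    · subst hq0
      simpa using ih p hp m (by simpa using hm')
    · have h1 := hε q hq hq0
      rcases m with _ | m
      · have h2 := (isPositiveIndexSet_sumCopies hG j).re_nonneg p hp
        simp only [Nat.cast_zero, zero_add, one_mul] at hm'
        linarith
      · refine ⟨p, ih p hp m ?_, q, hq, rfl⟩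
        push_cast at hm'
        linarith

theorem sumCopies_subset_indexInfinity (j : ℕ) : sumCopies G j ⊆ indexInfinity G :=
  subset_iUnion _ j

theorem subset_indexInfinity : G ⊆ indexInfinity G := sumCopies_subset_indexInfinity 0

theorem indexInfinity_add_subset : indexInfinity G + indexInfinity G ⊆ indexInfinity G := by
  rintro _ ⟨p, hp, q, hq, rfl⟩
  obtain ⟨i, hi⟩ := mem_iUnion.1 hp
  obtain ⟨j, hj⟩ := mem_iUnion.1 hq
  exact sumCopies_subset_indexInfinity _
    (sumCopies_add_sumCopies_subset i j (Set.add_mem_add hi hj))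

theorem IsPositiveIndexSet.indexInfinity (hG : IsPositiveIndexSet G) :
    IsPositiveIndexSet (indexInfinity G) where
  finite_re_le r := by
    obtain ⟨ε, hε, h⟩ := exists_re_lower_bound hG
    obtain ⟨m, hm⟩ := exists_nat_gt (r / ε)
    refine ((isPositiveIndexSet_sumCopies hG m).finite_re_le r).subset fun p hp => ⟨?_, hp.2⟩
    obtain ⟨j, hj⟩ := mem_iUnion.1 hp.1
    refine mem_sumCopies_of_re_lt hG h j p hj m (hp.2.trans_lt ?_)
    rw [div_lt_iff₀ hε] at hm
    linarith
  add_nat_mem z k h m := by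
    obtain ⟨j, hj⟩ := mem_iUnion.1 h
    exact sumCopies_subset_indexInfinity j
      ((isPositiveIndexSet_sumCopies hG j).add_nat_mem z k hj m)
  log_le_mem z k h m hm := by
    obtain ⟨j, hj⟩ := mem_iUnion.1 h
    exact sumCopies_subset_indexInfinity j
      ((isPositiveIndexSet_sumCopies hG j).log_le_mem z k hj m hm)
  nat_mem m := subset_indexInfinity (hG.nat_mem m)
  im_eq_zero p h := by
    obtain ⟨j, hj⟩ := mem_iUnion.1 h
    exact (isPositiveIndexSet_sumCopies hG j).im_eq_zero p hj
  re_nonneg p h := by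
    obtain ⟨j, hj⟩ := mem_iUnion.1 h
    exact (isPositiveIndexSet_sumCopies hG j).re_nonneg p hj
  no_log_at_zero k h := by
    obtain ⟨j, hj⟩ := mem_iUnion.1 h
    exact (isPositiveIndexSet_sumCopies hG j).no_log_at_zero k hj

/-- The index set of the smooth functions. -/
def smoothIndexSet : Set (ℂ × ℕ) := range fun m : ℕ => ((m : ℂ), 0)

theorem isPositiveIndexSet_smoothIndexSet : IsPositiveIndexSet smoothIndexSet where
  finite_re_le r := by
    obtain ⟨m, hm⟩ := exists_nat_ge r
    refine ((finite_Iic m).image fun m : ℕ => ((m : ℂ), 0)).subset ?_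
    rintro _ ⟨⟨k, rfl⟩, hk⟩
    refine ⟨k, ?_, rfl⟩
    have : (k : ℝ) ≤ r := by simpa using hk
    exact mem_Iic.2 (by exact_mod_cast this.trans hm)
  add_nat_mem := by
    rintro z k ⟨m, hm⟩ p
    obtain ⟨rfl, rfl⟩ := Prod.ext_iff.1 hm
    exact ⟨m + p, by simp⟩
  log_le_mem := by
    rintro z k ⟨m, hm⟩ p hp
    obtain ⟨rfl, rfl⟩ := Prod.ext_iff.1 hm
    exact ⟨m, by simpa using (Nat.le_zero.1 hp).symm⟩
  nat_mem m := ⟨m, rfl⟩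
  im_eq_zero := by rintro _ ⟨m, rfl⟩; simp
  re_nonneg := by rintro _ ⟨m, rfl⟩; simp
  no_log_at_zero := by
    rintro k ⟨m, hm⟩
    exact (Prod.ext_iff.1 hm).2.symm

/-- This lets `IsPhgTime.mul` multiply by a smooth function without enlarging the index set. -/
theorem smoothIndexSet_add_subset (hK : IsPositiveIndexSet K) : smoothIndexSet + K ⊆ K := by
  rintro _ ⟨_, ⟨m, rfl⟩, q, hq, rfl⟩
  have := hK.add_nat_mem q.1 q.2 hq m
  simpa [Prod.ext_iff, add_comm, Prod.add_def] using this

variable {ι : Type*} {G G₁ G₂ : ι → Set (ℂ × ℕ)}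

theorem isPositiveIndexSet_solutionIndexFamily (hG : ∀ H, IsPositiveIndexSet (G H))
    (hG₁ : ∀ H, IsPositiveIndexSet (G₁ H)) (hG₂ : ∀ H, IsPositiveIndexSet (G₂ H)) (H : ι) :
    IsPositiveIndexSet (solutionIndexFamily G G₁ G₂ H) :=
  ((hG₁ H).union ((hG H).indexInfinity.add (hG₂ H))).add (hG H).indexInfinity

/-- The final summand `G_∞` of `K` absorbs `G`, as it is closed under addition. -/
theorem add_solutionIndexFamily_subset (H : ι) :
    G H + solutionIndexFamily G G₁ G₂ H ⊆ solutionIndexFamily G G₁ G₂ H := by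
  rw [solutionIndexFamily, add_left_comm]
  exact Set.add_subset_add_left
    ((Set.add_subset_add_right subset_indexInfinity).trans indexInfinity_add_subset)

theorem subset_solutionIndexFamily_left (hG : ∀ H, IsPositiveIndexSet (G H)) (H : ι) :
    G₁ H ⊆ solutionIndexFamily G G₁ G₂ H := fun p hp =>
  ⟨p, Or.inl hp, _, zero_mem (hG H).indexInfinity, add_zero p⟩

theorem subset_solutionIndexFamily_right (hG : ∀ H, IsPositiveIndexSet (G H)) (H : ι) :
    G₂ H ⊆ solutionIndexFamily G G₁ G₂ H := fun p hp =>
  ⟨p, Or.inr ⟨_, zero_mem (hG H).indexInfinity, p, hp, zero_add p⟩, _,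
    zero_mem (hG H).indexInfinity, add_zero p⟩

end IndexSets

/-! ### Pulling back polyhomogeneous functions from `M` to `[0,T] × M` -/

section Pullback

variable {n : ℕ} {M : Type*} [TopologicalSpace M]
  [ChartedSpace (EuclideanQuadrant n) M]
  [IsManifold (modelWithCornersEuclideanQuadrant n) ∞ M]
  {ρ : BoundaryHypersurface n M → M → ℝ} {T : ℝ} {S : Set (BoundaryHypersurface n M)}
  {G : BoundaryHypersurface n M → Set (ℂ × ℕ)}

omit [IsManifold (modelWithCornersEuclideanQuadrant n) ∞ M] in
theorem smoothAway_comp_snd {U : Set M} {r : M → ℝ} (hU : awayFrom S ⊆ U)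
    (hr : ContMDiffOn (modelWithCornersEuclideanQuadrant n) 𝓘(ℝ, ℝ) ∞ r U) :
    SmoothAway T S (fun p => r p.2) :=
  ContMDiffOn.comp hr contMDiffOn_snd fun _ hp => hU hp.2

/-- The statement on `[0,1] × M` is applied to the pullback of `r` and restricted to `t = 0`. -/
theorem contMDiffOn_derivAlong (hS : S.Finite)
    {V : ∀ x : M, TangentSpace (modelWithCornersEuclideanQuadrant n) x}
    (hV : V ∈ bVectorFields ρ S) {r : M → ℝ}
    (hr : ContMDiffOn (modelWithCornersEuclideanQuadrant n) 𝓘(ℝ, ℝ) ∞ r (awayFrom S)) :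
    ContMDiffOn (modelWithCornersEuclideanQuadrant n) 𝓘(ℝ, ℝ) ∞ (derivAlong V r) (awayFrom S) :=
  contMDiffOn_space (T := 1) (smoothAway_of_mem one_pos hS (Or.inr ⟨V, hV, rfl⟩)
    (smoothAway_comp_snd subset_rfl hr)) (left_mem_Icc.2 zero_le_one)

theorem conormalAway_comp_snd (hS : S.Finite) {r : M → ℝ}
    (hr : IsConormal (modelWithCornersEuclideanQuadrant n) (awayFrom S) (bOperators ρ S) r) :
    ConormalAway T ρ S (fun p => r p.2) := by
  intro k
  have h0 : ∀ r : M → ℝ,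
      IsConormal (modelWithCornersEuclideanQuadrant n) (awayFrom S) (bOperators ρ S) r →
      BoundedUpTo T ρ S 0 (fun p => r p.2) := fun r hr => by
    obtain ⟨C, hC⟩ := hr.2 [] (by simp)
    exact boundedUpTo_zero.2 ⟨smoothAway_comp_snd subset_rfl hr.1, C, fun p hp => hC p.2 hp.2⟩
  induction k generalizing r with
  | zero => exact h0 r hr
  | succ k ih =>
    refine boundedUpTo_succ.2 ⟨h0 r hr, fun P hP => ?_⟩
    rcases hP with rfl | ⟨V, hV, rfl⟩
    · simpa using BoundedUpTo.const 0 k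
    · refine ih ⟨contMDiffOn_derivAlong hS hV hr.1, fun L hL => ?_⟩
      obtain ⟨C, hC⟩ := hr.2 (L ++ [derivAlong V]) fun P hP => by
        rcases List.mem_append.1 hP with h | h
        · exact hL P h
        · exact ⟨V, hV, List.mem_singleton.1 h⟩
      exact ⟨C, by simpa using hC⟩

theorem IsPhg.comp_snd (hT : 0 < T) (hG : ∀ H, IsPositiveIndexSet (G H)) {f : M → ℝ}
    (hf : IsPhg (modelWithCornersEuclideanQuadrant n) id univ (bOperators ρ) ρ G S f) :
    IsPhgTime T ρ G S (fun p => f p.2) := by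
  induction hf with
  | intro S f a h1 h2 h3 ih =>
    have hS := IsPhg.finite hG (IsPhg.intro S f a h1 h2 h3)
    rw [preimage_id, univ_inter] at h1
    refine (isPhgTime_iff hT hS).2 ⟨smoothAway_comp_snd subset_rfl h1, fun H p x => a H p x.2, ih,
      fun H hH N => ?_⟩
    obtain ⟨r, hr, hr'⟩ := h3 H hH N
    rw [preimage_id, univ_inter] at hr hr'
    exact ⟨fun p => r p.2, conormalAway_comp_snd hS hr, fun p hp => hr' p.2 hp.2⟩

end Pullback

/-! ### Derivatives in topological vector spaces -/

/-- The fibers of `E` are only topological vector spaces, so the chain rule is needed without norms.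
-/
theorem HasDerivWithinAt.clm_comp {V W : Type*} [AddCommGroup V] [Module ℝ V] [TopologicalSpace V]
    [ContinuousSMul ℝ V] [AddCommGroup W] [Module ℝ W] [TopologicalSpace W] [ContinuousSMul ℝ W]
    (A : V →L[ℝ] W) {f : ℝ → V} {f' : V} {s : Set ℝ} {t : ℝ} (hf : HasDerivWithinAt f f' s t) :
    HasDerivWithinAt (fun τ => A (f τ)) (A f') s t := by
  refine ⟨((A.isBigOTVS_comp).trans_isLittleOTVS hf.1).congr_left fun p => ?_⟩
  simp

/-! ### Finite frames of vector bundles -/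

section Frames

open scoped Topology

variable {n : ℕ} {M : Type*} [TopologicalSpace M]
  [ChartedSpace (EuclideanQuadrant n) M]
  {F : Type*} [NormedAddCommGroup F] [NormedSpace ℝ F]
  {E : M → Type*} [∀ x, AddCommGroup (E x)] [∀ x, Module ℝ (E x)]
  [∀ x, TopologicalSpace (E x)] [TopologicalSpace (TotalSpace F E)] [FiberBundle F E]

/-- Smooth sections `e i` of `E` that span every fiber, with a smooth choice `ε i` of
coefficients. -/
structure IsGlobalFrame (n : ℕ) {M : Type*} [TopologicalSpace M]
    [ChartedSpace (EuclideanQuadrant n) M]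
    (F : Type*) [NormedAddCommGroup F] [NormedSpace ℝ F]
    {E : M → Type*} [∀ x, AddCommGroup (E x)] [∀ x, Module ℝ (E x)]
    [∀ x, TopologicalSpace (E x)] [TopologicalSpace (TotalSpace F E)] [FiberBundle F E]
    {κ : Type*} [Fintype κ] (e : κ → ∀ x : M, E x) (ε : κ → ∀ x : M, E x →L[ℝ] ℝ) : Prop where
  sum_smul : ∀ x v, ∑ k, ε k x v • e k x = v
  smooth : ∀ k, ContMDiff (modelWithCornersEuclideanQuadrant n)
    ((modelWithCornersEuclideanQuadrant n).prod 𝓘(ℝ, F)) ∞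
    (fun x => (TotalSpace.mk' F x (e k x) : TotalSpace F E))
  smooth_coeff : ∀ (k : κ) (D : Set (ℝ × M)) (s : ∀ q : ℝ × M, E q.2),
    ContMDiffOn (𝓘(ℝ, ℝ).prod (modelWithCornersEuclideanQuadrant n))
      ((modelWithCornersEuclideanQuadrant n).prod 𝓘(ℝ, F)) ∞
      (fun q => (TotalSpace.mk' F q.2 (s q) : TotalSpace F E)) D →
    ContMDiffOn (𝓘(ℝ, ℝ).prod (modelWithCornersEuclideanQuadrant n)) 𝓘(ℝ, ℝ) ∞
      (fun q => ε k q.2 (s q)) D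

/-- Local frames are cut off by a partition of unity `χ`, and the local coordinates by `χ / θ`.
Since `θ = ∑ χ ^ 2`, the weights `χ ^ 2 / θ` of the reconstructed vector add up to one. -/
theorem exists_isGlobalFrame [T2Space M] [CompactSpace M]
    [IsManifold (modelWithCornersEuclideanQuadrant n) ∞ M] [FiniteDimensional ℝ F]
    [∀ x, IsTopologicalAddGroup (E x)] [∀ x, ContinuousSMul ℝ (E x)] [VectorBundle ℝ F E]
    [ContMDiffVectorBundle ∞ F E (modelWithCornersEuclideanQuadrant n)] :
    ∃ (d : ℕ) (e : Fin d → ∀ x : M, E x) (ε : Fin d → ∀ x : M, E x →L[ℝ] ℝ),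
      IsGlobalFrame n F e ε := by
  classical
  obtain ⟨t, -, ht⟩ := isCompact_univ.elim_nhds_subcover
    (fun x : M => (trivializationAt F E x).baseSet)
    fun x _ => (trivializationAt F E x).open_baseSet.mem_nhds (mem_baseSet_trivializationAt F E x)
  obtain ⟨χ, hχ⟩ := SmoothPartitionOfUnity.exists_isSubordinate
    (modelWithCornersEuclideanQuadrant n) isClosed_univ
    (fun j : t => (trivializationAt F E (j : M)).baseSet)
    (fun j => (trivializationAt F E (j : M)).open_baseSet)
    (fun x hx => by simpa using ht hx)
  set b := Module.finBasis ℝ F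
  set θ : M → ℝ := fun x => ∑ j, χ j x ^ 2 with hθ
  have hsum : ∀ x, ∑ j, χ j x = 1 := fun x => by
    rw [← finsum_eq_sum_of_fintype]; exact χ.sum_eq_one (mem_univ x)
  have hθ0 : ∀ x, θ x ≠ 0 := fun x h => by
    have h1 := (Finset.sum_eq_zero_iff_of_nonneg fun j _ => sq_nonneg (χ j x)).1 h
    have h2 : ∑ j, χ j x = 0 := Finset.sum_eq_zero fun j hj => by simpa using h1 j hj
    rw [hsum x] at h2
    exact one_ne_zero h2
  have hχs : ∀ j, ContMDiff (modelWithCornersEuclideanQuadrant n) 𝓘(ℝ, ℝ) ∞ (χ j) :=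
    fun j => (χ j).contMDiff
  have hθs : ContMDiff (modelWithCornersEuclideanQuadrant n) 𝓘(ℝ, ℝ) ∞ θ :=
    contMDiff_finsetSum fun j _ => (hχs j).pow 2
  set κ := t × Fin (Module.finrank ℝ F)
  set e : κ → ∀ x : M, E x := fun k x =>
    χ k.1 x • (trivializationAt F E (k.1 : M)).localFrame b k.2 x with he
  set ε : κ → ∀ x : M, E x →L[ℝ] ℝ := fun k x => (χ k.1 x / θ x) •
    ((b.coord k.2).toContinuousLinearMap.comp
      ((trivializationAt F E (k.1 : M)).continuousLinearMapAt ℝ x)) with hε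
  have hfr : IsGlobalFrame n F e ε := by
    refine ⟨fun x v => ?_, fun k => ?_, fun k D s hs => ?_⟩
    · have h1 : ∀ j : t, ∑ k, ε (j, k) x v • e (j, k) x = (χ j x ^ 2 / θ x) • v := by
        intro j
        by_cases hx : x ∈ (trivializationAt F E (j : M)).baseSet
        · have h2 : ∑ k, b.coord k ((trivializationAt F E (j : M)).continuousLinearMapAt ℝ x v) •
              (trivializationAt F E (j : M)).localFrame b k x = v := by
            have h3 := ((trivializationAt F E (j : M)).basisAt b hx).sum_repr v
            refine Eq.trans (Finset.sum_congr rfl fun k _ => ?_) h3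
            rw [Trivialization.localFrame_apply_of_mem_baseSet _ _ hx]
            simp [Trivialization.basisAt, Trivialization.coe_linearMapAt_of_mem _ hx]
          conv_rhs => rw [← h2, Finset.smul_sum]
          refine Finset.sum_congr rfl fun k _ => ?_
          simp only [he, hε, smul_apply, ContinuousLinearMap.comp_apply,
            smul_smul, smul_eq_mul, LinearMap.coe_toContinuousLinearMap']
          congr 1
          ring
        · have h2 : χ j x = 0 := by
            by_contra h
            exact hx (hχ j (subset_tsupport _ h))
          simp [he, h2]
      rw [Fintype.sum_prod_type]
      simp only [h1]
      rw [← Finset.sum_smul, ← Finset.sum_div, div_self (hθ0 x), one_smul]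
    · exact ContMDiffOn.smul_section_of_tsupport (hχs k.1).contMDiffOn
        (trivializationAt F E (k.1 : M)).open_baseSet (hχ k.1)
        ((trivializationAt F E (k.1 : M)).contMDiffOn_localFrame_baseSet ∞ b k.2)
    · intro q hq
      by_cases hx : q.2 ∈ (trivializationAt F E (k.1 : M)).baseSet
      · have h1 := ((trivializationAt F E (k.1 : M)).contMDiffWithinAt_iff
          ((trivializationAt F E (k.1 : M)).mem_source.2 hx)).1 (hs q hq)
        have h2 : ContMDiffWithinAt (𝓘(ℝ, ℝ).prod (modelWithCornersEuclideanQuadrant n)) 𝓘(ℝ, ℝ) ∞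
            (fun q : ℝ × M => χ k.1 q.2 / θ q.2) D q :=
          ContMDiffAt.contMDiffWithinAt (((hχs k.1).comp contMDiff_snd).div₀
            (hθs.comp contMDiff_snd) (fun q => hθ0 q.2) q)
        have h3 := ContMDiffAt.comp_contMDiffWithinAt q
          ((b.coord k.2).toContinuousLinearMap.contMDiff (n := ∞) _) h1.2
        refine (h2.mul h3).congr_of_eventuallyEq ?_ ?_
        · have : ∀ᶠ p in 𝓝[D] q, p.2 ∈ (trivializationAt F E (k.1 : M)).baseSet :=
            nhdsWithin_le_nhds (continuous_snd.continuousAt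
              ((trivializationAt F E (k.1 : M)).open_baseSet.mem_nhds hx))
          filter_upwards [this] with p hp
          simp [hε, Trivialization.coe_linearMapAt_of_mem _ hp]
        · simp [hε, Trivialization.coe_linearMapAt_of_mem _ hx]
      -- Outside the base set of the trivialization the point is off the closed support of `χ`, so
      -- the coefficient vanishes nearby.
      · have h1 : q.2 ∉ tsupport (χ k.1) := fun h => hx (hχ k.1 h)
        have h2 : ∀ᶠ p in 𝓝[D] q, ε k p.2 (s p) = 0 := by
          have : ∀ᶠ p : ℝ × M in 𝓝[D] q, p.2 ∉ tsupport (χ k.1) :=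
            nhdsWithin_le_nhds (continuous_snd.continuousAt
              ((isClosed_tsupport _).isOpen_compl.mem_nhds h1))
          filter_upwards [this] with p hp
          simp [hε, image_eq_zero_of_notMem_tsupport hp]
        refine (contMDiffWithinAt_const (c := (0 : ℝ))).congr_of_eventuallyEq h2 ?_
        simp [hε, image_eq_zero_of_notMem_tsupport h1]
  refine ⟨Fintype.card κ, fun i => e ((Fintype.equivFin κ).symm i),
    fun i => ε ((Fintype.equivFin κ).symm i), fun x v => ?_, fun k => hfr.smooth _,
    fun k => hfr.smooth_coeff _⟩
  rw [(Fintype.equivFin κ).symm.sum_comp (fun k => ε k x v • e k x)]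
  exact hfr.sum_smul x v

end Frames

/-! ### Reduction to a scalar system -/

section Reduction

variable {n : ℕ} {M : Type*} [TopologicalSpace M]
  [ChartedSpace (EuclideanQuadrant n) M]
  {F : Type*} [NormedAddCommGroup F] [NormedSpace ℝ F]
  {E : M → Type*} [∀ x, AddCommGroup (E x)] [∀ x, Module ℝ (E x)]
  [∀ x, TopologicalSpace (E x)] [TopologicalSpace (TotalSpace F E)] [FiberBundle F E]
  {κ : Type} [Fintype κ] {e : κ → ∀ x : M, E x} {ε : κ → ∀ x : M, E x →L[ℝ] ℝ}
  {T : ℝ} {ρ : BoundaryHypersurface n M → M → ℝ}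
  {G : BoundaryHypersurface n M → Set (ℂ × ℕ)}
  {l : ∀ q : ℝ × M, E q.2 →L[ℝ] E q.2} {f : ∀ q : ℝ × M, E q.2} {u₀ : ∀ x : M, E x}

/-- The matrix of `l` in a frame. -/
def frameMatrix (e : κ → ∀ x : M, E x) (ε : κ → ∀ x : M, E x →L[ℝ] ℝ)
    (l : ∀ q : ℝ × M, E q.2 →L[ℝ] E q.2) (k m : κ) (q : ℝ × M) : ℝ :=
  ε k q.2 (l q (e m q.2))

/-- The inhomogeneous term of the system satisfied by the coefficients of `u - u₀` in a frame. -/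
def frameForcing (e : κ → ∀ x : M, E x) (ε : κ → ∀ x : M, E x →L[ℝ] ℝ)
    (l : ∀ q : ℝ × M, E q.2 →L[ℝ] E q.2) (f : ∀ q : ℝ × M, E q.2) (u₀ : ∀ x : M, E x) (k : κ)
    (q : ℝ × M) : ℝ :=
  ∑ m, frameMatrix e ε l k m q * ε m q.2 (u₀ q.2) + ε k q.2 (f q)

/-- The frame may be redundant, but the reconstruction identity alone makes the matrix act correctly
on the coefficients of a vector. -/
theorem IsGlobalFrame.sum_frameMatrix_mul (h : IsGlobalFrame n F e ε) (k : κ) (q : ℝ × M)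
    (v : E q.2) : ∑ m, frameMatrix e ε l k m q * ε m q.2 v = ε k q.2 (l q v) := by
  conv_rhs => rw [← h.sum_smul q.2 v]
  simp only [map_sum, map_smul, smul_eq_mul, frameMatrix]
  exact Finset.sum_congr rfl fun m _ => mul_comm _ _

theorem IsSolution.solvesSystem [∀ x, ContinuousSMul ℝ (E x)] (h : IsGlobalFrame n F e ε)
    {u : ∀ q : ℝ × M, E q.2} (hu : IsSolution n T l f u₀ u) :
    SolvesSystem T (cornerInterior n M) (frameMatrix e ε l) (frameForcing e ε l f u₀)
      (fun k q => ε k q.2 (u q) - ε k q.2 (u₀ q.2)) := by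
  refine fun x hx k => ⟨by simp [(hu x hx).1], fun t ht => ?_⟩
  obtain ⟨u', hu', heq⟩ := (hu x hx).2 t ht
  refine ((HasDerivWithinAt.clm_comp (ε k x) hu').sub_const (ε k x (u₀ x))).congr_deriv ?_
  simp only [frameForcing, mul_sub, Finset.sum_sub_distrib]
  rw [h.sum_frameMatrix_mul k (t, x) (u (t, x)), sub_eq_iff_eq_add.1 heq]
  simp only [map_add]
  ring

/-- `w` need not consist of the frame coefficients of a section. Still, each derivative is `ε k` of
`f + l u`, where `u` is the assembled section, and the reconstruction identity turns the sum of
these back into `f + l u`. -/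
theorem SolvesSystem.isSolution [∀ x, IsTopologicalAddGroup (E x)] [∀ x, ContinuousSMul ℝ (E x)]
    (h : IsGlobalFrame n F e ε) {w : κ → ℝ × M → ℝ}
    (hw : SolvesSystem T (cornerInterior n M) (frameMatrix e ε l) (frameForcing e ε l f u₀) w) :
    IsSolution n T l f u₀ (fun q => ∑ k, (w k q + ε k q.2 (u₀ q.2)) • e k q.2) := by
  refine fun x hx => ⟨?_, fun t ht => ?_⟩
  · simp only [(hw x hx _).1, zero_add]
    exact h.sum_smul x (u₀ x)
  · set A : (κ → ℝ) →L[ℝ] E x :=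
      ∑ k, (ContinuousLinearMap.proj (R := ℝ) (φ := fun _ : κ => ℝ) k).smulRight (e k x) with hA
    have hAv : ∀ v, A v = ∑ k, v k • e k x := fun v => by simp [hA, sum_apply]
    have h1 : HasDerivWithinAt (fun s k => w k (s, x) + ε k x (u₀ x)) (fun k =>
        ∑ m, frameMatrix e ε l k m (t, x) * w m (t, x) + frameForcing e ε l f u₀ k (t, x))
        (Icc 0 T) t :=
      hasDerivWithinAt_pi.2 fun k => ((hw x hx k).2 t ht).add_const _
    have h3 := HasDerivWithinAt.clm_comp A h1
    simp only [hAv] at h3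
    refine ⟨_, h3, ?_⟩
    rw [sub_eq_iff_eq_add]
    have h2 : ∀ k, ∑ m, frameMatrix e ε l k m (t, x) * w m (t, x) +
        frameForcing e ε l f u₀ k (t, x) =
        ε k x (f (t, x) + l (t, x) (∑ m, (w m (t, x) + ε m x (u₀ x)) • e m x)) := fun k => by
      simp only [frameForcing, frameMatrix, map_add, map_sum, map_smul, smul_eq_mul, add_mul,
        Finset.sum_add_distrib]
      simp only [mul_comm]
      ring
    simp only [h2]
    exact h.sum_smul x _

theorem IsSolution.eqOn [∀ x, ContinuousSMul ℝ (E x)] (h : IsGlobalFrame n F e ε)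
    (hl : ∀ x ∈ cornerInterior n M, ∀ k m,
      ContinuousOn (fun t => frameMatrix e ε l k m (t, x)) (Icc 0 T))
    {u v : ∀ q : ℝ × M, E q.2} (hu : IsSolution n T l f u₀ u) (hv : IsSolution n T l f u₀ v)
    {t : ℝ} (ht : t ∈ Icc 0 T) {x : M} (hx : x ∈ cornerInterior n M) : v (t, x) = u (t, x) := by
  rw [← h.sum_smul x (v (t, x)), ← h.sum_smul x (u (t, x))]
  refine Finset.sum_congr rfl fun k _ => ?_
  rw [sub_left_inj.1 ((hv.solvesSystem h).eqOn hl (hu.solvesSystem h) k (mk_mem_prod ht hx))]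

/-- Without available coefficient functions, only the empty sum remains. -/
theorem IsSectionWithCoeffs.eq_zero {EX HX X : Type*} [NormedAddCommGroup EX] [NormedSpace ℝ EX]
    [TopologicalSpace HX] [TopologicalSpace X] [ChartedSpace HX X]
    {J : ModelWithCorners ℝ EX HX} {pr : X → M} {D U : Set X} {𝒜 : Set (X → ℝ)}
    {u : ∀ x : X, E (pr x)} (hu : IsSectionWithCoeffs n J pr D U 𝒜 F u) (h𝒜 : 𝒜 = ∅) :
    ∀ x ∈ U, u x = 0 := by
  obtain ⟨m, c, s, hc, -, h⟩ := hu
  intro x hx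
  rw [h x hx]
  refine Finset.sum_eq_zero fun i _ => ?_
  have := hc i
  simp [h𝒜] at this

variable [IsManifold (modelWithCornersEuclideanQuadrant n) ∞ M] [CompactSpace M]

theorem isPhgTime_sum_mul (hT : 0 < T) (hρ : ∀ H, IsDefiningFunction H (ρ H))
    (hG : ∀ H, IsPositiveIndexSet (G H)) {S : Set (BoundaryHypersurface n M)} (hS : S.Finite)
    {m : ℕ} {c h : Fin m → ℝ × M → ℝ} (hc : ∀ i, IsPhgTime T ρ G S (c i))
    (hh : ∀ i, ContMDiffOn (𝓘(ℝ, ℝ).prod (modelWithCornersEuclideanQuadrant n)) 𝓘(ℝ, ℝ) ∞ (h i)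
      (Icc 0 T ×ˢ univ)) :
    IsPhgTime T ρ G S (fun q => ∑ i, h i q * c i q) := by
  refine IsPhgTime.sum hT hG hS _ fun i _ =>
    IsPhgTime.mul (G := fun _ => smoothIndexSet) hT (fun _ => isPositiveIndexSet_smoothIndexSet) hG
      (fun H => smoothIndexSet_add_subset (hG H)) hρ
      (isPhgTime_of_smooth hT (fun _ => isPositiveIndexSet_smoothIndexSet) hS ?_) (hc i)
  rw [SmoothAway, awayFrom_empty]
  exact hh i

theorem IsGlobalFrame.isPhgTime_coeff (h : IsGlobalFrame n F e ε) (hT : 0 < T)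
    (hρ : ∀ H, IsDefiningFunction H (ρ H)) (hG : ∀ H, IsPositiveIndexSet (G H))
    (hS : (univ : Set (BoundaryHypersurface n M)).Finite) (hf : IsPhgSectionTime T ρ G F f)
    (k : κ) : IsPhgTime T ρ G univ (fun q => ε k q.2 (f q)) := by
  obtain ⟨m, c, s, hc, hs, hcs⟩ := hf
  refine (isPhgTime_sum_mul hT hρ hG hS hc fun i => h.smooth_coeff k _ (s i) (hs i)).congr hT hS
    fun q hq => ?_
  simp only [hcs q hq, map_sum, map_smul, smul_eq_mul]
  exact Finset.sum_congr rfl fun i _ => mul_comm _ _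

theorem IsGlobalFrame.isPhgTime_coeff_comp_snd (h : IsGlobalFrame n F e ε) (hT : 0 < T)
    (hρ : ∀ H, IsDefiningFunction H (ρ H)) (hG : ∀ H, IsPositiveIndexSet (G H))
    (hS : (univ : Set (BoundaryHypersurface n M)).Finite) (hf : IsPhgSection ρ G F u₀)
    (k : κ) : IsPhgTime T ρ G univ (fun q => ε k q.2 (u₀ q.2)) := by
  obtain ⟨m, c, s, hc, hs, hcs⟩ := hf
  refine h.isPhgTime_coeff hT hρ hG hS (f := fun q => u₀ q.2) ⟨m, fun i q => c i q.2,
    fun i q => s i q.2, fun i => IsPhg.comp_snd hT hG (hc i), fun i => ?_,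
    fun q hq => hcs q.2 hq.2⟩ k
  exact ContMDiffOn.comp (hs i) contMDiffOn_snd fun _ _ => mem_univ _

theorem IsGlobalFrame.isPhgTime_frameMatrix [FiniteDimensional ℝ F]
    [∀ x, IsTopologicalAddGroup (E x)] [∀ x, ContinuousSMul ℝ (E x)] [VectorBundle ℝ F E]
    [ContMDiffVectorBundle ∞ F E (modelWithCornersEuclideanQuadrant n)]
    (h : IsGlobalFrame n F e ε) (hT : 0 < T)
    (hρ : ∀ H, IsDefiningFunction H (ρ H)) (hG : ∀ H, IsPositiveIndexSet (G H))
    (hS : (univ : Set (BoundaryHypersurface n M)).Finite)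
    (hl : IsPhgSectionTime T ρ G (F →L[ℝ] F) (E := fun x => E x →L[ℝ] E x) l) (k m : κ) :
    IsPhgTime T ρ G univ (frameMatrix e ε l k m) := by
  obtain ⟨d, c, s, hc, hs, hcs⟩ := hl
  refine h.isPhgTime_coeff hT hρ hG hS (f := fun q => l q (e m q.2))
    ⟨d, c, fun i q => s i q (e m q.2), hc, fun i => ?_, fun q hq => ?_⟩ k
  · exact (hs i).clm_bundle_apply ((h.smooth m).comp contMDiff_snd).contMDiffOn
  · simp only [hcs q hq, sum_apply, smul_apply]

end Reduction

end Polyhomogeneous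

end

/-! ### The main theorem -/

theorem mainTheorem12 {n : ℕ} {M : Type*} [TopologicalSpace M] [T2Space M] [CompactSpace M]
    [ChartedSpace (EuclideanQuadrant n) M]
    [IsManifold (modelWithCornersEuclideanQuadrant n) ∞ M]
    (ρ : Polyhomogeneous.BoundaryHypersurface n M → M → ℝ)
    (hρ : ∀ H, Polyhomogeneous.IsDefiningFunction H (ρ H))
    {F : Type*} [NormedAddCommGroup F] [NormedSpace ℝ F] [FiniteDimensional ℝ F]
    {E : M → Type*} [∀ x, AddCommGroup (E x)] [∀ x, Module ℝ (E x)]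
    [∀ x, TopologicalSpace (E x)] [∀ x, IsTopologicalAddGroup (E x)]
    [∀ x, ContinuousSMul ℝ (E x)] [TopologicalSpace (TotalSpace F E)]
    [FiberBundle F E] [VectorBundle ℝ F E]
    [ContMDiffVectorBundle ∞ F E (modelWithCornersEuclideanQuadrant n)]
    (T : ℝ) (hT : 0 < T)
    (G G₁ G₂ : Polyhomogeneous.BoundaryHypersurface n M → Set (ℂ × ℕ))
    (hG : ∀ H, Polyhomogeneous.IsPositiveIndexSet (G H))
    (hG₁ : ∀ H, Polyhomogeneous.IsPositiveIndexSet (G₁ H))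
    (hG₂ : ∀ H, Polyhomogeneous.IsPositiveIndexSet (G₂ H))
    (l : ∀ q : ℝ × M, E q.2 →L[ℝ] E q.2)
    (hl : Polyhomogeneous.IsPhgSectionTime T ρ G (F →L[ℝ] F) (E := fun x => E x →L[ℝ] E x) l)
    (u₀ : ∀ x : M, E x) (hu₀ : Polyhomogeneous.IsPhgSection ρ G₁ F u₀)
    (f : ∀ q : ℝ × M, E q.2) (hf : Polyhomogeneous.IsPhgSectionTime T ρ G₂ F f) :
    (∀ H, Polyhomogeneous.IsPositiveIndexSet
      (Polyhomogeneous.solutionIndexFamily G G₁ G₂ H)) ∧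
    ∃ u : ∀ q : ℝ × M, E q.2,
      Polyhomogeneous.IsSolution n T l f u₀ u ∧
      Polyhomogeneous.IsPhgSectionTime T ρ
        (Polyhomogeneous.solutionIndexFamily G G₁ G₂) F u ∧
      ∀ v : ∀ q : ℝ × M, E q.2, Polyhomogeneous.IsSolution n T l f u₀ v →
        ∀ t ∈ Icc 0 T, ∀ x ∈ Polyhomogeneous.cornerInterior n M, v (t, x) = u (t, x) := by
  have hK := Polyhomogeneous.isPositiveIndexSet_solutionIndexFamily hG hG₁ hG₂
  refine ⟨hK, ?_⟩
  obtain ⟨d, e, ε, hfr⟩ := Polyhomogeneous.exists_isGlobalFrame (n := n) (F := F) (E := E)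
  -- With infinitely many hypersurfaces there would be no polyhomogeneous functions, by
  -- `IsPhg.finite`. Then `l`, `f` and `u₀` vanish over the interior and `u = 0` works, so
  -- finiteness need not be deduced from compactness.
  by_cases hS : (univ : Set (Polyhomogeneous.BoundaryHypersurface n M)).Finite
  · have hL := hfr.isPhgTime_frameMatrix hT hρ hG hS hl
    have hu := fun k => (hfr.isPhgTime_coeff_comp_snd hT hρ hG₁ hS hu₀ k).mono hT hG₁ hK
      (Polyhomogeneous.subset_solutionIndexFamily_left hG)
    have hg : ∀ k, Polyhomogeneous.IsPhgTime T ρ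
        (Polyhomogeneous.solutionIndexFamily G G₁ G₂) univ
        (Polyhomogeneous.frameForcing e ε l f u₀ k) := fun k =>
      (Polyhomogeneous.IsPhgTime.sum hT hK hS _ fun m _ =>
        (hL k m).mul hT hG hK Polyhomogeneous.add_solutionIndexFamily_subset hρ (hu m)).add hT hK
        ((hfr.isPhgTime_coeff hT hρ hG₂ hS hf k).mono hT hG₂ hK
          (Polyhomogeneous.subset_solutionIndexFamily_right hG))
    obtain ⟨w, hw, hws⟩ := Polyhomogeneous.hasPhgSolutions hT hρ hG hK
      Polyhomogeneous.add_solutionIndexFamily_subset hS (Fin d) _ _ hL hg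
    have hsol := hws.isSolution hfr
    -- The frame coefficients of the solution are `w k + ε k u₀`, and both summands are
    -- polyhomogeneous with respect to `K`.
    refine ⟨_, hsol, ⟨d, _, fun k q => e k q.2, fun k => (hw k).add hT hK (hu k),
      fun k => ((hfr.smooth k).comp contMDiff_snd).contMDiffOn, fun q _ => rfl⟩,
      fun v hv t ht x hx => hsol.eqOn hfr ?_ hv ht hx⟩
    exact fun x hx k m => (hL k m).smooth.continuousOn_time hx
  · have hempty : ∀ G' : Polyhomogeneous.BoundaryHypersurface n M → Set (ℂ × ℕ),
        (∀ H, Polyhomogeneous.IsPositiveIndexSet (G' H)) →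
        Polyhomogeneous.phgFunctionsTime T ρ G' = ∅ := fun G' hG' =>
      eq_empty_of_forall_notMem fun c hc => hS (Polyhomogeneous.IsPhg.finite hG' hc)
    have hl0 := Polyhomogeneous.IsSectionWithCoeffs.eq_zero hl (hempty G hG)
    have hf0 := Polyhomogeneous.IsSectionWithCoeffs.eq_zero hf (hempty G₂ hG₂)
    have hu0 := Polyhomogeneous.IsSectionWithCoeffs.eq_zero hu₀
      (eq_empty_of_forall_notMem fun c hc => hS (Polyhomogeneous.IsPhg.finite hG₁ hc))
    have hsol : Polyhomogeneous.IsSolution n T l f u₀ (fun _ => 0) := fun x hx =>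
      ⟨(hu0 x hx).symm, fun t ht => ⟨0, by
        simpa using Polyhomogeneous.HasDerivWithinAt.clm_comp (0 : ℝ →L[ℝ] E x)
          (hasDerivWithinAt_id t (Icc 0 T)), by simp [hf0 (t, x) ⟨ht, hx⟩]⟩⟩
    refine ⟨fun _ => 0, hsol, ⟨0, Fin.elim0, Fin.elim0, fun i => i.elim0, fun i => i.elim0,
      fun _ _ => by simp⟩, fun v hv t ht x hx => hsol.eqOn hfr ?_ hv ht hx⟩
    refine fun x hx k m => (continuousOn_const (c := (0 : ℝ))).congr fun t ht => ?_
    rw [Polyhomogeneous.frameMatrix, hl0 (t, x) ⟨ht, hx⟩]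
    simp
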